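/- Let $n\ge 1$, let $S^{2n+1}\subset\mathbb C^{n+1}$ be the unit sphere with its standard CR structure $T^{1,0}S^{2n+1}=T^{1,0}\mathbb C^{n+1}\cap\mathbb C TS^{2n+1}$, contact form $\theta_0=\frac i2\sum_l (z^l d\bar z^l-\bar z^l dz^l)$ and volume $d\xi=\theta_0\wedge(d\theta_0)^n$. A CR automorphism is a diffeomorphism $\tau$ of $S^{2n+1}$ that preserves $T^{1,0}S^{2n+1}$; its conformal factor is a smooth nowhere vanishing function $J_\tau$ with $\tau^*(dz_1\wedge\dots\wedge dz_{n+1})=J_\tau^{n+2}\,dz_1\wedge\dots\wedge dz_{n+1}$ (restricted to the sphere) and $\tau^*\theta_0=|J_\tau|^2\theta_0$; it is determined up to a constant $(n+2)$-nd root of unity, whose choice does not matter below. Let $\mathcal H^{\mathbb S}_{j,k}$ be the space of restrictions to $S^{2n+1}$ of harmonic polynomials on $\mathbb C^{n+1}$ of bidegree $(j,k)$ in $(z,\bar z)$. Let $0<\gamma<n+1$ and $w,w'\in\mathbb R$ with $w+w'+n+1=\gamma$ and $w-w'\in\mathbb Z$, so that $J^a\bar J^b:=|J|^{2b}J^{a-b}$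 makes sense for $(a,b)=(-w,-w')$ and $(\gamma-w,\gamma-w')$. Assume that neither $\gamma-w$ nor $\gamma-w'$ is a non-positive integer, and put $$\lambda_j(w)=\frac{\Gamma(j+\gamma-w)}{\Gamma(j-w)},\qquad \lambda_k(w')=\frac{\Gamma(k+\gamma-w')}{\Gamma(k-w')}\qquad (j,k\in\mathbb N_0),$$ where $1/\Gamma=0$ at the poles of $\Gamma$. Call a linear operator $A:C^\infty(S^{2n+1})\to C^\infty(S^{2n+1})$ formally self-adjoint if $\int (AF)\,\overline G\,d\xi=\int F\,\overline{AG}\,d\xi$ for all $F,G\in C^\infty(S^{2n+1})$, and intertwining if for all $F\in C^\infty(S^{2n+1})$ and all CR automorphisms $\tau$, $$J_\tau^{\gamma-w}\bar J_\tau^{\gamma-w'}\,(AF)\circ\tau=A\bigl(J_\tau^{-w}\bar J_\tau^{-w'}\,(F\circ\tau)\bigr).$$ (i) If $A$ is formally self-adjoint and intertwining, then there is $c\in\mathbb R$ with $AY=c\,\lambda_j(w)\lambda_k(w')\,Y$ for all $j,k\in\mathbb N_0$ and all $Y\in\mathcal H^{\mathbb S}_{j,k}$. (ii) Conversely, if $Q$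 is formally self-adjoint and there is $c\in\mathbb R$ such that $QY=c\,\lambda_j(w)\lambda_k(w')\,Y$ for all $j,k\in\mathbb N_0$ and all $Y\in\mathcal H^{\mathbb S}_{j,k}$, then $Q$ is intertwining. -/

import Mathlib

open scoped Manifold ContDiff ComplexConjugate
open MeasureTheory

noncomputable section

namespace CRSphere

/-- The complex Euclidean space `ℂ^{n+1}`. -/
abbrev Cn (n : ℕ) : Type := EuclideanSpace ℂ (Fin (n + 1))

instance finrank_Cn (n : ℕ) : Fact (Module.finrank ℝ (Cn n) = (2 * n + 1) + 1) := ⟨by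
  rw [← Module.finrank_mul_finrank ℝ ℂ (Cn n), Complex.finrank_real_complex,
    finrank_euclideanSpace, Fintype.card_fin]
  ring⟩

/-- The unit sphere `S^{2n+1}` in `ℂ^{n+1}`. -/
abbrev Sph (n : ℕ) : Type := Metric.sphere (0 : Cn n) 1

/-- `C^∞(S^{2n+1})`, the smooth complex-valued functions on the sphere. -/
def smoothFunctions (n : ℕ) : Submodule ℂ (Sph n → ℂ) where
  carrier := {F | ContMDiff (𝓡 (2 * n + 1)) 𝓘(ℝ, ℂ) ∞ F}
  zero_mem' := contMDiff_const
  add_mem' := fun hF hG =>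
    (contDiff_fst.add contDiff_snd : ContDiff ℝ ∞ (fun p : ℂ × ℂ => p.1 + p.2)).contMDiff.comp
      (hF.prodMk_space hG)
  smul_mem' := fun c _ hF =>
    (contDiff_const.mul contDiff_id : ContDiff ℝ ∞ (fun x : ℂ => c * x)).contMDiff.comp hF

/-- `C^∞(S^{2n+1})` as a complex vector space. -/
abbrev Smooth (n : ℕ) : Type := smoothFunctions n

instance (n : ℕ) : CoeFun (Smooth n) (fun _ => Sph n → ℂ) := ⟨fun F => F.1⟩

/-- The diffeomorphisms of `S^{2n+1}`. -/
abbrev SphDiffeo (n : ℕ) : Type := Sph n ≃ₘ⟮𝓡 (2 * n + 1), 𝓡 (2 * n + 1)⟯ Sph n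

/-- The tangent space of the sphere at `z`. -/
abbrev Tan {n : ℕ} (z : Sph n) : Type := TangentSpace (𝓡 (2 * n + 1)) z

/-- The differential at `z` of the inclusion of the sphere in `ℂ^{n+1}`. -/
def dIncl {n : ℕ} (z : Sph n) : Tan z → Cn n :=
  fun v => mfderiv (𝓡 (2 * n + 1)) 𝓘(ℝ, Cn n) (fun x : Sph n => (x : Cn n)) z v

/-- The differential at `z` of a diffeomorphism `τ` of the sphere, its values being read as
vectors of `ℂ^{n+1}`. -/
def dMap {n : ℕ} (τ : SphDiffeo n) (z : Sph n) : Tan z → Cn n :=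
  fun v => mfderiv (𝓡 (2 * n + 1)) 𝓘(ℝ, Cn n) (fun x : Sph n => (τ x : Cn n)) z v

/-- The contact form `θ₀ = (i/2) ∑ (z^l dz̄^l - z̄^l dz^l)` at `z`, evaluated at `v`. -/
def contactForm {n : ℕ} (z v : Cn n) : ℂ :=
  Complex.I / 2 * ∑ l, (z l * conj (v l) - conj (z l) * v l)

/-- The form `dz_1 ∧ ⋯ ∧ dz_{n+1}` evaluated at `v_1, …, v_{n+1}`. -/
def holVolume {n : ℕ} (v : Fin (n + 1) → Cn n) : ℂ :=
  Matrix.det (Matrix.of fun a l => v a l)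

/-- CR automorphisms of the sphere: diffeomorphisms preserving `T^{1,0}`. If `v` is tangent to the
sphere and `i v` is too (that is, `v` lies in the maximal complex subspace of the tangent space),
then the differential of `τ` sends `i v` to `i` times the image of `v`. -/
def IsCRAut {n : ℕ} (τ : SphDiffeo n) : Prop :=
  ∀ (z : Sph n) (u v : Tan z), dIncl z u = Complex.I • dIncl z v →
    dMap τ z u = Complex.I • dMap τ z v

/-- `J` is a conformal factor `J_τ` of `τ`: a smooth nowhere vanishing function with
`τ^*(dz_1 ∧ ⋯ ∧ dz_{n+1}) = J^{n+2} dz_1 ∧ ⋯ ∧ dz_{n+1}` on the sphere and `τ^* θ₀ = |J|² θ₀`.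
It is determined by `τ` up to a constant factor, an `(n+2)`-nd root of unity. -/
structure IsConformalFactor {n : ℕ} (τ : SphDiffeo n) (J : Smooth n) : Prop where
  ne_zero : ∀ z, J z ≠ 0
  pullback_holVolume : ∀ (z : Sph n) (v : Fin (n + 1) → Tan z),
    holVolume (fun a => dMap τ z (v a)) = J z ^ (n + 2) * holVolume (fun a => dIncl z (v a))
  pullback_contactForm : ∀ (z : Sph n) (v : Tan z),
    contactForm (τ z : Cn n) (dMap τ z v)
      = ((‖J z‖ ^ 2 : ℝ) : ℂ) * contactForm (z : Cn n) (dIncl z v)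

/-- `J^a J̄^b = |J|^{2b} J^{a-b}` for `J ≠ 0` and real `a`, `b` with `a - b ∈ ℤ` (so that no branch
of the logarithm matters). -/
def mixedPow (J : ℂ) (a b : ℝ) : ℂ :=
  ((‖J‖ ^ (2 * b) : ℝ) : ℂ) * J ^ ((a - b : ℝ) : ℂ)

theorem mixedPow_smooth {n : ℕ} (J : Smooth n) (hJ : ∀ z, J z ≠ 0) (a b : ℝ)
    (h : ∃ m : ℤ, a - b = m) :
    ContMDiff (𝓡 (2 * n + 1)) 𝓘(ℝ, ℂ) ∞ (fun z => mixedPow (J z) a b) := by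
  obtain ⟨m, hm⟩ := h
  intro z
  have key : ContDiffAt ℝ ∞ (fun x : ℂ => mixedPow x a b) (J z) := by
    simp only [mixedPow, hm, Complex.ofReal_intCast, Complex.cpow_intCast]
    refine ContDiffAt.mul ?_ ?_
    · exact Complex.ofRealCLM.contDiff.contDiffAt.comp _
        ((contDiffAt_norm ℝ (hJ z)).rpow_const_of_ne (norm_ne_zero_iff.2 (hJ z)))
    · cases m with
      | ofNat k => simpa using (contDiff_id.pow k).contDiffAt
      | negSucc k =>
        simp only [zpow_negSucc]
        exact ((contDiff_id.pow (k + 1)).contDiffAt).inv (pow_ne_zero _ (hJ z))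
  exact key.contMDiffAt.comp z (J.2 z)

/-- The smooth function `J^a J̄^b (F ∘ τ)`. -/
def twist {n : ℕ} (τ : SphDiffeo n) (J : Smooth n) (hJ : ∀ z, J z ≠ 0) (a b : ℝ)
    (h : ∃ m : ℤ, a - b = m) (F : Smooth n) : Smooth n :=
  ⟨fun z => mixedPow (J z) a b * F (τ z),
    (contDiff_fst.mul contDiff_snd : ContDiff ℝ ∞ (fun p : ℂ × ℂ => p.1 * p.2)).contMDiff.comp
      ((mixedPow_smooth J hJ a b h).prodMk_space (ContMDiff.comp F.2 τ.contMDiff))⟩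

/-- The `(w, w')`-intertwining property of order `2γ`: for every CR automorphism `τ` and smooth `F`,
`J_τ^{γ-w} J̄_τ^{γ-w'} (A F) ∘ τ = A (J_τ^{-w} J̄_τ^{-w'} (F ∘ τ))`.
Both sides change by the same constant when `J_τ` is multiplied by a root of unity. -/
def IsIntertwining {n : ℕ} (γ w w' : ℝ) (h : ∃ m : ℤ, w - w' = m)
    (A : Smooth n →ₗ[ℂ] Smooth n) : Prop :=
  ∀ (τ : SphDiffeo n), IsCRAut τ → ∀ (J : Smooth n) (hJ : IsConformalFactor τ J) (F : Smooth n),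
    twist τ J hJ.ne_zero (γ - w) (γ - w')
        (by obtain ⟨m, hm⟩ := h; exact ⟨-m, by push_cast; linarith⟩) (A F)
      = A (twist τ J hJ.ne_zero (-w) (-w')
          (by obtain ⟨m, hm⟩ := h; exact ⟨-m, by push_cast; linarith⟩) F)

/-- The measure `dξ = θ₀ ∧ (dθ₀)^n` on the sphere, which is `2^n n!` times the surface measure,
because `θ₀ = ∑ (x dy - y dx)` and `dθ₀ = 2 ∑ dx ∧ dy`. -/
def crVolume (n : ℕ) : Measure (Sph n) :=
  ((2 ^ n * n.factorial : ℕ) : ENNReal) • (volume : Measure (Cn n)).toSphere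

/-- Formal self-adjointness with respect to `(F, G) = ∫ F Ḡ dξ` on smooth functions. -/
def IsFormallySelfAdjoint {n : ℕ} (A : Smooth n →ₗ[ℂ] Smooth n) : Prop :=
  ∀ F G : Smooth n, ∫ z, A F z * conj (G z) ∂(crVolume n) = ∫ z, F z * conj (A G z) ∂(crVolume n)

/-- Complex polynomials on `ℂ^{n+1}`, as polynomials in `z_l` (the variable `inl l`) and `z̄_l`
(the variable `inr l`). -/
abbrev CPoly (n : ℕ) : Type := MvPolynomial (Fin (n + 1) ⊕ Fin (n + 1)) ℂ

/-- The value of a polynomial at a point of `ℂ^{n+1}`. -/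
def evalAt {n : ℕ} (p : CPoly n) (z : Cn n) : ℂ :=
  MvPolynomial.eval (Sum.elim (fun l => z l) (fun l => conj (z l))) p

/-- `𝓗_{j,k}`: harmonic polynomials (the Laplacian is `4 ∑ ∂²/∂z_l∂z̄_l`) of bidegree `(j, k)`,
the bidegree being read off with the Euler fields `Z = ∑ z_l ∂/∂z_l` and `Z̄ = ∑ z̄_l ∂/∂z̄_l`. -/
structure IsHarmonicBihomogeneous {n : ℕ} (j k : ℕ) (p : CPoly n) : Prop where
  harmonic : ∑ l, MvPolynomial.pderiv (Sum.inl l) (MvPolynomial.pderiv (Sum.inr l) p) = 0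
  euler : ∑ l, MvPolynomial.X (Sum.inl l) * MvPolynomial.pderiv (Sum.inl l) p = (j : ℂ) • p
  conj_euler : ∑ l, MvPolynomial.X (Sum.inr l) * MvPolynomial.pderiv (Sum.inr l) p = (k : ℂ) • p

/-- The space of spherical harmonics of bidegree `(j, k)`: restrictions to the sphere of the
elements of `𝓗_{j,k}`. -/
def sphHarm (n j k : ℕ) : Submodule ℂ (Smooth n) where
  carrier := {Y | ∃ p : CPoly n, IsHarmonicBihomogeneous j k p ∧ ∀ z : Sph n, Y z = evalAt p z}
  zero_mem' := ⟨0, ⟨by simp, by simp, by simp⟩, fun z => by simp [evalAt]⟩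
  add_mem' := by
    rintro Y Y' ⟨p, hp, hY⟩ ⟨q, hq, hY'⟩
    refine ⟨p + q, ⟨?_, ?_, ?_⟩, fun z => ?_⟩
    · simp [Finset.sum_add_distrib, hp.harmonic, hq.harmonic]
    · simp [mul_add, Finset.sum_add_distrib, hp.euler, hq.euler]
    · simp [mul_add, Finset.sum_add_distrib, hp.conj_euler, hq.conj_euler]
    · simp [hY, hY', evalAt]
  smul_mem' := by
    rintro a Y ⟨p, hp, hY⟩
    refine ⟨a • p, ⟨?_, ?_, ?_⟩, fun z => ?_⟩
    · simp [← Finset.smul_sum, hp.harmonic]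
    · simp only [Derivation.map_smul, mul_smul_comm, ← Finset.smul_sum, hp.euler]
      exact smul_comm _ _ _
    · simp only [Derivation.map_smul, mul_smul_comm, ← Finset.smul_sum, hp.conj_euler]
      exact smul_comm _ _ _
    · simp [hY, evalAt]

/-- `λ_j(w) = Γ(j + γ - w) / Γ(j - w)`. Where `j - w` is a pole of `Γ` this is `0`, in accordance
with `1 / Γ` being entire. -/
def lam (γ w : ℝ) (j : ℕ) : ℝ := Real.Gamma (j + γ - w) / Real.Gamma (j - w)

end CRSphere

end

/-!
The group of CR automorphisms of the sphere is generated by unitary maps and by the *boosts*, the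
one-parameter groups `z ↦ (z_l + s) / (1 + s z_l), √(1 - s²) z_m / (1 + s z_l)` fixing `± e_l`.
Both halves of the theorem reduce to these two kinds of transformations.

**Uniqueness of the eigenvalues.** An intertwining operator `A` gives a bilinear form
`β (F, G) = ∫ A F · G` on polynomials. Invariance under unitary maps, in infinitesimal form, makes
`β` vanish on pairs of spherical harmonics unless the bidegrees are dual to each other
(`RotInvariant.eq_zero`: a Casimir argument) and proportional to `∫ F G` when they are. This needs
no irreducibility theorem: proportionality is shown for bidegrees `(d, 0)` by induction on `d`
(`RotInvariant.exists_eq_mul_holomorphic`), and the derivative of the intertwining relation along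
the boosts (`boostInvariant_opForm`) then carries it from bidegree `(j, k)` to its neighbours
(`BoostInvariant.eq_mul_succ`). The same relation yields the recursions
`(j - w) μ_{j+1,k} = (j + γ - w) μ_{j,k}` and `(k - w') μ_{j,k+1} = (k + γ - w') μ_{j,k}`. The only
solutions are the multiples of `λ_j(w) λ_k(w')`, also where a coefficient vanishes, because
`w + w' + n + 1 = γ < n + 1` prevents both `w` and `w'` from being nonnegative integers. The factor
is real since `A` is formally self-adjoint.

**Intertwining with boosts.** Conversely let `Q` have these eigenvalues. Both sides of the
intertwining relation for a boost, applied to a spherical harmonic and paired with another one,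
extend holomorphically in the parameter `s`; the recursions show that they satisfy the same
infinite system of linear differential equations, with the same initial values, so that they have
the same derivatives of all orders at `s = 0` (`eq_zero_of_deriv_mem_span`,
`mul_boostPairing_eq`). Formal
self-adjointness, the change of variables under boosts (`integral_boost`, obtained by the same
uniqueness argument) and the density of spherical harmonics extend this to all smooth functions
(`IsDiagonal.intertwines_boost`). The operator commutes with unitary maps because these preserve
the spaces of spherical harmonics (`IsDiagonal.commutesWithUnitary`).

**CR automorphisms.** It remains to see that every CR automorphism is a product of unitary maps and
a boost (`IsCRAut.exists_decomposition`). By the weak tangential Cauchy-Riemann equations a CR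
function is orthogonal to all spherical harmonics of bidegree `(j, k)` with `k ≠ 0`, so it is a
limit in mean of holomorphic polynomials (`exists_hol_near`). Consequently the mean value is
multiplicative on CR functions and the pairing with `z̄_l` is a derivation there
(`sphInt_mul`, `sphInt_mul_mul_star`); these play the parts of the value and of the derivative at
the centre of the ball of the holomorphic extension, which itself is not needed. After composition
with a unitary map and a boost the components of the automorphism have mean value zero. Then the
chain rule at the centre, applied to the automorphism and its inverse, and Bessel's inequality
show that it is unitary (`IsCRAut.exists_unitary`), as in Schwarz's lemma. Finally the conformal
factor of an automorphism is unique up to a constant of modulus one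
(`IsConformalFactor.exists_eq_const_mul`), and such constants do not affect the intertwining
relation.
-/

noncomputable section

namespace CRSphere

open MvPolynomial

variable {n : ℕ}

/-! ### Polynomials in `z` and `z̄` -/

/-- The polynomial `z_l`. -/
abbrev zv (l : Fin (n + 1)) : CPoly n := X (Sum.inl l)

/-- The polynomial `z̄_l`. -/
abbrev wv (l : Fin (n + 1)) : CPoly n := X (Sum.inr l)

/-- The derivation `∂/∂z_l`. -/
abbrev dz (l : Fin (n + 1)) : Derivation ℂ (CPoly n) (CPoly n) := pderiv (Sum.inl l)

/-- The derivation `∂/∂z̄_l`. -/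
abbrev dw (l : Fin (n + 1)) : Derivation ℂ (CPoly n) (CPoly n) := pderiv (Sum.inr l)

/-- The polynomial `|z|² = ∑ z_l z̄_l`. -/
def rho (n : ℕ) : CPoly n := ∑ l, zv l * wv l

/-- The holomorphic Euler field `∑ z_l ∂/∂z_l`. -/
def eulerZ (n : ℕ) : Derivation ℂ (CPoly n) (CPoly n) := ∑ l, zv l • dz l

/-- The antiholomorphic Euler field `∑ z̄_l ∂/∂z̄_l`. -/
def eulerW (n : ℕ) : Derivation ℂ (CPoly n) (CPoly n) := ∑ l, wv l • dw l

/-- The complexified rotation field `z_l ∂/∂z_m - z̄_m ∂/∂z̄_l`; these fields span the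
complexification of the Lie algebra of the unitary group. -/
def rot (l m : Fin (n + 1)) : Derivation ℂ (CPoly n) (CPoly n) := zv l • dz m - wv m • dw l

/-- The complex Laplacian `∑ ∂²/∂z_l∂z̄_l`. -/
def lap (n : ℕ) : CPoly n →ₗ[ℂ] CPoly n :=
  ∑ l : Fin (n + 1), (dz l).toLinearMap ∘ₗ (dw l).toLinearMap

theorem derivation_sum_apply {ι : Type*} (s : Finset ι)
    (D : ι → Derivation ℂ (CPoly n) (CPoly n)) (p : CPoly n) :
    (∑ i ∈ s, D i) p = ∑ i ∈ s, D i p := by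
  classical
  induction s using Finset.induction_on with
  | empty => simp
  | insert i s hi ih => rw [Finset.sum_insert hi, Finset.sum_insert hi, Derivation.add_apply, ih]

theorem eulerZ_apply (p : CPoly n) : eulerZ n p = ∑ l, zv l * dz l p := by
  simp [eulerZ, derivation_sum_apply]

theorem eulerW_apply (p : CPoly n) : eulerW n p = ∑ l, wv l * dw l p := by
  simp [eulerW, derivation_sum_apply]

theorem rot_apply (l m : Fin (n + 1)) (p : CPoly n) :
    rot l m p = zv l * dz m p - wv m * dw l p := by
  simp [rot]

theorem lap_apply (p : CPoly n) : lap n p = ∑ l, dz l (dw l p) := by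
  simp [lap]

theorem pderiv_comm {σ : Type*} (i j : σ) (p : MvPolynomial σ ℂ) :
    pderiv i (pderiv j p) = pderiv j (pderiv i p) := by
  classical
  have h : ⁅(pderiv i : Derivation ℂ (MvPolynomial σ ℂ) (MvPolynomial σ ℂ)),
      (pderiv j : Derivation ℂ (MvPolynomial σ ℂ) (MvPolynomial σ ℂ))⁆ = 0 := by
    refine MvPolynomial.derivation_ext fun k => ?_
    rw [Derivation.commutator_apply]
    simp only [pderiv_X, Pi.single_apply]
    split_ifs <;> simp
  have := congrArg (fun D => D p) h
  rw [Derivation.commutator_apply] at this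
  simpa [sub_eq_zero] using this

theorem dz_zv (l m : Fin (n + 1)) : dz l (zv m) = if l = m then 1 else 0 := by
  rw [dz, pderiv_X, Pi.single_apply]; simp [eq_comm]

theorem dw_wv (l m : Fin (n + 1)) : dw l (wv m) = if l = m then 1 else 0 := by
  rw [dw, pderiv_X, Pi.single_apply]; simp [eq_comm]

theorem dz_wv (l m : Fin (n + 1)) : dz l (wv m) = 0 := pderiv_X_of_ne (by simp)

theorem dw_zv (l m : Fin (n + 1)) : dw l (zv m) = 0 := pderiv_X_of_ne (by simp)

theorem dz_rho (l : Fin (n + 1)) : dz l (rho n) = wv l := by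
  simp only [rho, map_sum, pderiv_mul, dz_zv, dz_wv]; simp

theorem dw_rho (l : Fin (n + 1)) : dw l (rho n) = zv l := by
  simp only [rho, map_sum, pderiv_mul, dw_wv, dw_zv]; simp

theorem lap_zv_mul (l : Fin (n + 1)) (p : CPoly n) :
    lap n (zv l * p) = dw l p + zv l * lap n p := by
  simp only [lap_apply, pderiv_mul, dw_zv, dz_zv, zero_mul, zero_add, Finset.sum_add_distrib,
    Finset.mul_sum]
  simp

theorem lap_wv_mul (l : Fin (n + 1)) (p : CPoly n) :
    lap n (wv l * p) = dz l p + wv l * lap n p := by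
  have h : ∀ m, dz m (dw m (wv l * p)) = (if m = l then dz m p else 0) + wv l * dz m (dw m p) := by
    intro m
    rw [pderiv_mul, dw_wv]
    split_ifs <;> simp
  simp only [lap_apply, h, Finset.sum_add_distrib, Finset.mul_sum]
  simp

theorem lap_rho_mul (p : CPoly n) :
    lap n (rho n * p) = ((n : ℂ) + 1) • p + eulerZ n p + eulerW n p + rho n * lap n p := by
  simp only [lap_apply, pderiv_mul, dw_rho, dz_rho, map_add, Finset.sum_add_distrib, dz_zv,
    Finset.mul_sum, eulerZ_apply, eulerW_apply]
  simp
  simp [smul_eq_C_mul]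
  ring

theorem eulerZ_mul (p q : CPoly n) : eulerZ n (p * q) = eulerZ n p * q + p * eulerZ n q := by
  rw [Derivation.leibniz]; simp only [smul_eq_mul]; ring

theorem eulerW_mul (p q : CPoly n) : eulerW n (p * q) = eulerW n p * q + p * eulerW n q := by
  rw [Derivation.leibniz]; simp only [smul_eq_mul]; ring

theorem rot_mul (l m : Fin (n + 1)) (p q : CPoly n) :
    rot l m (p * q) = rot l m p * q + p * rot l m q := by
  rw [Derivation.leibniz]; simp only [smul_eq_mul]; ring

theorem eulerZ_zv (l : Fin (n + 1)) : eulerZ n (zv l) = zv l := by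
  rw [eulerZ_apply, Finset.sum_eq_single l] <;> simp +contextual

theorem eulerZ_wv (l : Fin (n + 1)) : eulerZ n (wv l) = 0 := by
  simp [eulerZ_apply]

theorem eulerW_zv (l : Fin (n + 1)) : eulerW n (zv l) = 0 := by
  simp [eulerW_apply]

theorem eulerW_wv (l : Fin (n + 1)) : eulerW n (wv l) = wv l := by
  rw [eulerW_apply, Finset.sum_eq_single l] <;> simp +contextual

theorem eulerZ_rho : eulerZ n (rho n) = rho n := by
  simp only [eulerZ_apply, dz_rho]; rfl

theorem eulerW_rho : eulerW n (rho n) = rho n := by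
  simp only [eulerW_apply, dw_rho, mul_comm (wv _)]; rfl

theorem eulerZ_dz (l : Fin (n + 1)) (p : CPoly n) :
    eulerZ n (dz l p) = dz l (eulerZ n p) - dz l p := by
  simp only [eulerZ_apply, map_sum, pderiv_mul, dz_zv, Finset.sum_add_distrib]
  simp [pderiv_comm (Sum.inl l)]

theorem eulerZ_dw (l : Fin (n + 1)) (p : CPoly n) :
    eulerZ n (dw l p) = dw l (eulerZ n p) := by
  simp only [eulerZ_apply, map_sum, pderiv_mul, dw_zv, Finset.sum_add_distrib]
  simp [pderiv_comm (Sum.inr l)]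

theorem eulerW_dw (l : Fin (n + 1)) (p : CPoly n) :
    eulerW n (dw l p) = dw l (eulerW n p) - dw l p := by
  simp only [eulerW_apply, map_sum, pderiv_mul, dw_wv, Finset.sum_add_distrib]
  simp [pderiv_comm (Sum.inr l)]

theorem eulerW_dz (l : Fin (n + 1)) (p : CPoly n) :
    eulerW n (dz l p) = dz l (eulerW n p) := by
  simp only [eulerW_apply, map_sum, pderiv_mul, dz_wv, Finset.sum_add_distrib]
  simp [pderiv_comm (Sum.inl l)]

theorem lap_dz (l : Fin (n + 1)) (p : CPoly n) : lap n (dz l p) = dz l (lap n p) := by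
  simp only [lap_apply, map_sum]
  refine Finset.sum_congr rfl fun m _ => ?_
  rw [dw, pderiv_comm (Sum.inr m) (Sum.inl l), dz, pderiv_comm (Sum.inl m)]

theorem lap_dw (l : Fin (n + 1)) (p : CPoly n) : lap n (dw l p) = dw l (lap n p) := by
  simp only [lap_apply, map_sum]
  refine Finset.sum_congr rfl fun m _ => ?_
  rw [dw, pderiv_comm (Sum.inr m) (Sum.inr l), dz, pderiv_comm (Sum.inl m)]

theorem isHarmonicBihomogeneous_iff {j k : ℕ} {p : CPoly n} :
    IsHarmonicBihomogeneous j k p ↔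
      lap n p = 0 ∧ eulerZ n p = (j : ℂ) • p ∧ eulerW n p = (k : ℂ) • p := by
  rw [lap_apply, eulerZ_apply, eulerW_apply]
  exact ⟨fun h => ⟨h.1, h.2, h.3⟩, fun h => ⟨h.1, h.2.1, h.2.2⟩⟩

/-- The harmonic polynomials of bidegree `(j, k)`. -/
def harm (n j k : ℕ) : Submodule ℂ (CPoly n) where
  carrier := {p | IsHarmonicBihomogeneous j k p}
  zero_mem' := by simp [isHarmonicBihomogeneous_iff]
  add_mem' := by
    intro p q hp hq
    simp only [Set.mem_ofPred_eq, isHarmonicBihomogeneous_iff] at *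
    simp [hp, hq]
  smul_mem' := by
    intro c p hp
    simp only [Set.mem_ofPred_eq, isHarmonicBihomogeneous_iff] at *
    simp [hp, smul_comm c]

theorem mem_harm {j k : ℕ} {p : CPoly n} : p ∈ harm n j k ↔
    lap n p = 0 ∧ eulerZ n p = (j : ℂ) • p ∧ eulerW n p = (k : ℂ) • p :=
  isHarmonicBihomogeneous_iff

theorem one_mem_harm : (1 : CPoly n) ∈ harm n 0 0 := by simp [mem_harm, lap_apply]

/-- An Euler field `∑ x_i ∂/∂x_i` in some of the variables acts diagonally on monomials, with
nonnegative eigenvalues; hence a polynomial that it kills does not involve these variables. -/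
theorem notMem_vars_of_euler {σ ι : Type*} [Fintype ι] (f : ι → σ) {p : MvPolynomial σ ℂ}
    (h : ∑ i, X (f i) * pderiv (f i) p = 0) (i : ι) : f i ∉ p.vars := by
  classical
  have key : ∀ (q : MvPolynomial σ ℂ) (m : _ →₀ ℕ), coeff m (∑ i, X (f i) * pderiv (f i) q)
      = (∑ i, m (f i) : ℕ) * coeff m q := by
    intro q m
    induction q using MvPolynomial.induction_on' with
    | monomial u a =>
      simp only [X_mul_pderiv_monomial, coeff_sum, coeff_smul, coeff_monomial]
      split_ifs with hu
      · subst hu; simp [Finset.sum_mul]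
      · simp
    | add p q hp hq => simp only [map_add, mul_add, Finset.sum_add_distrib, coeff_add, hp, hq]
  intro hl
  obtain ⟨m, hm, hml⟩ := (mem_vars_iff_mem_support _).1 hl
  have h1 := key p m
  rw [h, coeff_zero, eq_comm, mul_eq_zero, Nat.cast_eq_zero] at h1
  rcases h1 with h1 | h1
  · rw [Finset.sum_eq_zero_iff] at h1
    exact (Finsupp.mem_support_iff.1 hml) (h1 i (Finset.mem_univ _))
  · exact (mem_support_iff.1 hm) h1

theorem inr_notMem_vars {p : CPoly n} (h : eulerW n p = 0) (l : Fin (n + 1)) :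
    Sum.inr l ∉ p.vars :=
  notMem_vars_of_euler Sum.inr (by rw [← h, eulerW_apply]) l

theorem inl_notMem_vars {p : CPoly n} (h : eulerZ n p = 0) (l : Fin (n + 1)) :
    Sum.inl l ∉ p.vars :=
  notMem_vars_of_euler Sum.inl (by rw [← h, eulerZ_apply]) l

theorem dw_eq_zero_of_eulerW {p : CPoly n} (h : eulerW n p = 0) (l : Fin (n + 1)) :
    dw l p = 0 :=
  pderiv_eq_zero_of_notMem_vars (inr_notMem_vars h l)

theorem dz_eq_zero_of_eulerZ {p : CPoly n} (h : eulerZ n p = 0) (l : Fin (n + 1)) :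
    dz l p = 0 :=
  pderiv_eq_zero_of_notMem_vars (inl_notMem_vars h l)

theorem exists_smul_one_of_mem_harm_zero {p : CPoly n} (hp : p ∈ harm n 0 0) :
    ∃ c : ℂ, p = c • 1 := by
  rw [mem_harm] at hp
  have : p.vars = ∅ := by
    rw [Finset.eq_empty_iff_forall_notMem]
    rintro (l | l)
    · exact inl_notMem_vars (by simp [hp.2.1]) l
    · exact inr_notMem_vars (by simp [hp.2.2]) l
  exact ⟨_, by rw [vars_eq_empty_iff_eq_C.1 this, smul_eq_C_mul, mul_one]⟩

theorem dz_mem_harm {j k : ℕ} {p : CPoly n} (hp : p ∈ harm n j k) (l : Fin (n + 1)) :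
    dz l p ∈ harm n (j - 1) k := by
  rw [mem_harm] at *
  rcases j with _ | j
  · have : dz l p = 0 := dz_eq_zero_of_eulerZ (by simp [hp.2.1]) l
    simp [this]
  · rw [lap_dz, eulerZ_dz, eulerW_dz, hp.1, hp.2.1, hp.2.2]
    simp [add_smul]

theorem dw_mem_harm {j k : ℕ} {p : CPoly n} (hp : p ∈ harm n j k) (l : Fin (n + 1)) :
    dw l p ∈ harm n j (k - 1) := by
  rw [mem_harm] at *
  rcases k with _ | k
  · have : dw l p = 0 := dw_eq_zero_of_eulerW (by simp [hp.2.2]) l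
    simp [this]
  · rw [lap_dw, eulerZ_dw, eulerW_dw, hp.1, hp.2.1, hp.2.2]
    simp [add_smul]

/-- For `p` harmonic of bidegree `(j, k)`: the component of bidegree `(j + 1, k)` of `z_l p`. -/
def raiseZ (j k : ℕ) (l : Fin (n + 1)) (p : CPoly n) : CPoly n :=
  zv l * p - ((n + j + k : ℂ)⁻¹) • (rho n * dw l p)

/-- For `p` harmonic of bidegree `(j, k)`: the component of bidegree `(j, k + 1)` of `z̄_l p`. -/
def raiseW (j k : ℕ) (l : Fin (n + 1)) (p : CPoly n) : CPoly n :=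
  wv l * p - ((n + j + k : ℂ)⁻¹) • (rho n * dz l p)

theorem natCast_add_ne_zero (hn : 1 ≤ n) (j k : ℕ) : (n + j + k : ℂ) ≠ 0 := by
  have : n + j + k ≠ 0 := by omega
  exact_mod_cast this

theorem raiseZ_mem_harm (hn : 1 ≤ n) {j k : ℕ} {p : CPoly n} (hp : p ∈ harm n j k)
    (l : Fin (n + 1)) : raiseZ j k l p ∈ harm n (j + 1) k := by
  have hd := dw_mem_harm hp l
  rw [mem_harm] at hp hd ⊢
  obtain ⟨h1, h2, h3⟩ := hp
  obtain ⟨g1, g2, -⟩ := hd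
  have g3 : eulerW n (dw l p) = ((k : ℂ) - 1) • dw l p := by
    rw [eulerW_dw, h3]; simp [sub_smul]
  refine ⟨?_, ?_, ?_⟩
  · rw [raiseZ, map_sub, map_smul, lap_zv_mul, lap_rho_mul, h1, g1, g2, g3, ← add_smul, ← add_smul,
      mul_zero, mul_zero, add_zero, add_zero, smul_smul]
    rw [show (n + 1 + j + (k - 1) : ℂ) = n + j + k by ring,
      inv_mul_cancel₀ (natCast_add_ne_zero hn j k), one_smul, sub_self]
  · rw [raiseZ, map_sub, Derivation.map_smul, eulerZ_mul, eulerZ_mul, eulerZ_zv, eulerZ_rho, h2, g2]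
    simp only [smul_eq_C_mul, map_natCast, Nat.cast_add, Nat.cast_one, map_add, map_one]
    ring
  · rw [raiseZ, map_sub, Derivation.map_smul, eulerW_mul, eulerW_mul, eulerW_zv, eulerW_rho, h3, g3]
    simp only [smul_eq_C_mul, map_natCast, map_sub, map_one]
    ring

theorem raiseW_mem_harm (hn : 1 ≤ n) {j k : ℕ} {p : CPoly n} (hp : p ∈ harm n j k)
    (l : Fin (n + 1)) : raiseW j k l p ∈ harm n j (k + 1) := by
  have hd := dz_mem_harm hp l
  rw [mem_harm] at hp hd ⊢
  obtain ⟨h1, h2, h3⟩ := hp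
  obtain ⟨g1, -, g2⟩ := hd
  have g3 : eulerZ n (dz l p) = ((j : ℂ) - 1) • dz l p := by
    rw [eulerZ_dz, h2]; simp [sub_smul]
  refine ⟨?_, ?_, ?_⟩
  · rw [raiseW, map_sub, map_smul, lap_wv_mul, lap_rho_mul, h1, g1, g2, g3, ← add_smul, ← add_smul,
      mul_zero, mul_zero, add_zero, add_zero, smul_smul]
    rw [show (n + 1 + (j - 1) + k : ℂ) = n + j + k by ring,
      inv_mul_cancel₀ (natCast_add_ne_zero hn j k), one_smul, sub_self]
  · rw [raiseW, map_sub, Derivation.map_smul, eulerZ_mul, eulerZ_mul, eulerZ_wv, eulerZ_rho, h2, g3]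
    simp only [smul_eq_C_mul, map_natCast, map_sub, map_one]
    ring
  · rw [raiseW, map_sub, Derivation.map_smul, eulerW_mul, eulerW_mul, eulerW_wv, eulerW_rho, h3, g2]
    simp only [smul_eq_C_mul, map_natCast, Nat.cast_add, Nat.cast_one, map_add, map_one]
    ring

/-! ### Conjugation and evaluation -/

/-- Complex conjugation of polynomials in `z` and `z̄`. -/
def conjPoly (p : CPoly n) : CPoly n := rename Sum.swap (map (starRingEnd ℂ) p)

theorem evalAt_add (p q : CPoly n) (z : Cn n) : evalAt (p + q) z = evalAt p z + evalAt q z := by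
  simp [evalAt]

theorem evalAt_sub (p q : CPoly n) (z : Cn n) : evalAt (p - q) z = evalAt p z - evalAt q z := by
  simp [evalAt]

theorem evalAt_mul (p q : CPoly n) (z : Cn n) : evalAt (p * q) z = evalAt p z * evalAt q z := by
  simp [evalAt]

theorem evalAt_smul (c : ℂ) (p : CPoly n) (z : Cn n) : evalAt (c • p) z = c * evalAt p z := by
  simp [evalAt]

theorem evalAt_sum {ι : Type*} (s : Finset ι) (p : ι → CPoly n) (z : Cn n) :
    evalAt (∑ i ∈ s, p i) z = ∑ i ∈ s, evalAt (p i) z := by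
  simp [evalAt]

@[simp] theorem evalAt_one (z : Cn n) : evalAt (1 : CPoly n) z = 1 := by simp [evalAt]

@[simp] theorem evalAt_zero (z : Cn n) : evalAt (0 : CPoly n) z = 0 := by simp [evalAt]

@[simp] theorem evalAt_zv (l : Fin (n + 1)) (z : Cn n) : evalAt (zv l) z = z l := by simp [evalAt]

@[simp] theorem evalAt_wv (l : Fin (n + 1)) (z : Cn n) : evalAt (wv l) z = conj (z l) := by
  simp [evalAt]

theorem sum_mul_conj_sphere (z : Sph n) : ∑ l, (z : Cn n) l * conj ((z : Cn n) l) = 1 := by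
  have h : ‖(z : Cn n)‖ ^ 2 = 1 := by
    have := z.2
    rw [mem_sphere_zero_iff_norm] at this
    rw [this]; norm_num
  rw [EuclideanSpace.norm_sq_eq] at h
  simp_rw [Complex.mul_conj, Complex.normSq_eq_norm_sq]
  exact_mod_cast h

theorem evalAt_rho_sphere (z : Sph n) : evalAt (rho n) (z : Cn n) = 1 := by
  rw [rho, evalAt_sum, ← sum_mul_conj_sphere z]
  simp only [evalAt_mul, evalAt_zv, evalAt_wv]

theorem evalAt_conjPoly (p : CPoly n) (z : Cn n) : evalAt (conjPoly p) z = conj (evalAt p z) := by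
  rw [conjPoly, evalAt, evalAt, eval_rename, ← eval₂_id, eval₂_map,
    ← eval₂_id (p := p), hom_eval₂]
  congr 1
  funext i
  rcases i with i | i <;> simp

theorem conjPoly_conjPoly (p : CPoly n) : conjPoly (conjPoly p) = p := by
  rw [conjPoly, conjPoly, map_rename, rename_rename, map_map]
  simp [map_id]

theorem conjPoly_smul (c : ℂ) (p : CPoly n) : conjPoly (c • p) = conj c • conjPoly p := by
  simp [conjPoly, smul_eq_C_mul]

theorem dz_conjPoly (l : Fin (n + 1)) (p : CPoly n) : dz l (conjPoly p) = conjPoly (dw l p) := by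
  have hs : Function.Injective (Sum.swap : Fin (n + 1) ⊕ Fin (n + 1) → _) :=
    Function.LeftInverse.injective Sum.swap_swap
  have := pderiv_rename hs (Sum.inr l) (map (starRingEnd ℂ) p)
  rw [Sum.swap_inr] at this
  rw [conjPoly, dz, this, pderiv_map, conjPoly]

theorem dw_conjPoly (l : Fin (n + 1)) (p : CPoly n) : dw l (conjPoly p) = conjPoly (dz l p) := by
  have hs : Function.Injective (Sum.swap : Fin (n + 1) ⊕ Fin (n + 1) → _) :=
    Function.LeftInverse.injective Sum.swap_swap
  have := pderiv_rename hs (Sum.inl l) (map (starRingEnd ℂ) p)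
  rw [Sum.swap_inl] at this
  rw [conjPoly, dw, this, pderiv_map, conjPoly]

theorem conjPoly_mem_harm {j k : ℕ} {p : CPoly n} (hp : p ∈ harm n j k) :
    conjPoly p ∈ harm n k j := by
  have hx : ∀ l : Fin (n + 1), conjPoly (wv l) = zv l := by simp [conjPoly]
  have hy : ∀ l : Fin (n + 1), conjPoly (zv l) = wv l := by simp [conjPoly]
  have hm : ∀ p q : CPoly n, conjPoly (p * q) = conjPoly p * conjPoly q := by simp [conjPoly]
  have hsum : ∀ f : Fin (n + 1) → CPoly n, conjPoly (∑ l, f l) = ∑ l, conjPoly (f l) := by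
    simp [conjPoly]
  rw [mem_harm] at *
  obtain ⟨h1, h2, h3⟩ := hp
  rw [lap_apply] at h1 ⊢
  rw [eulerZ_apply] at h2 ⊢
  rw [eulerW_apply] at h3 ⊢
  replace h2 := congrArg conjPoly h2
  replace h3 := congrArg conjPoly h3
  simp only [hsum, hm, hx, hy, conjPoly_smul, Complex.conj_natCast] at h2 h3
  simp only [dz_conjPoly, dw_conjPoly, h2, h3, and_true]
  rw [← hsum]
  have : ∑ l : Fin (n + 1), dw l (dz l p) = 0 := by
    rw [← h1]
    exact Finset.sum_congr rfl fun m _ => pderiv_comm _ _ _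
  rw [this]
  simp [conjPoly]

/-- Modulo `|z|² - 1`, every polynomial is a sum of harmonic ones: the span of the latter contains
`1` and, by the decompositions of `z_l p` and `z̄_l p`, is stable under multiplication by the
coordinates. -/
theorem exists_harmonic_decomposition (hn : 1 ≤ n) (p : CPoly n) :
    ∃ h ∈ Submodule.span ℂ (⋃ j, ⋃ k, (harm n j k : Set (CPoly n))), ∃ r, p = h + (rho n - 1) * r := by
  set S := Submodule.span ℂ (⋃ j, ⋃ k, (harm n j k : Set (CPoly n))) with hS
  have hmem : ∀ {j k : ℕ} {q : CPoly n}, q ∈ harm n j k → q ∈ S := fun {j k q} hq =>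
    Submodule.subset_span (Set.mem_iUnion.2 ⟨j, Set.mem_iUnion.2 ⟨k, hq⟩⟩)
  have hz : ∀ l, ∀ h ∈ S, ∃ h' ∈ S, ∃ r, zv l * h = h' + (rho n - 1) * r := by
    intro l h hh
    induction hh using Submodule.span_induction with
    | mem q hq =>
      simp only [Set.mem_iUnion] at hq
      obtain ⟨j, k, hq⟩ := hq
      refine ⟨raiseZ j k l q + ((n + j + k : ℂ)⁻¹) • dw l q,
        S.add_mem (hmem (raiseZ_mem_harm hn hq l)) (S.smul_mem _ (hmem (dw_mem_harm hq l))),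
        ((n + j + k : ℂ)⁻¹) • dw l q, ?_⟩
      simp only [raiseZ, smul_eq_C_mul]; ring
    | zero => exact ⟨0, S.zero_mem, 0, by simp⟩
    | add p q _ _ hp hq =>
      obtain ⟨p', hp', r, h1⟩ := hp
      obtain ⟨q', hq', t, h2⟩ := hq
      exact ⟨p' + q', S.add_mem hp' hq', r + t, by rw [mul_add, h1, h2]; ring⟩
    | smul c q _ hq =>
      obtain ⟨q', hq', t, h2⟩ := hq
      exact ⟨c • q', S.smul_mem _ hq', c • t, by
        rw [mul_smul_comm, h2, smul_add, mul_smul_comm]⟩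
  have hw : ∀ l, ∀ h ∈ S, ∃ h' ∈ S, ∃ r, wv l * h = h' + (rho n - 1) * r := by
    intro l h hh
    induction hh using Submodule.span_induction with
    | mem q hq =>
      simp only [Set.mem_iUnion] at hq
      obtain ⟨j, k, hq⟩ := hq
      refine ⟨raiseW j k l q + ((n + j + k : ℂ)⁻¹) • dz l q,
        S.add_mem (hmem (raiseW_mem_harm hn hq l)) (S.smul_mem _ (hmem (dz_mem_harm hq l))),
        ((n + j + k : ℂ)⁻¹) • dz l q, ?_⟩
      simp only [raiseW, smul_eq_C_mul]; ring
    | zero => exact ⟨0, S.zero_mem, 0, by simp⟩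
    | add p q _ _ hp hq =>
      obtain ⟨p', hp', r, h1⟩ := hp
      obtain ⟨q', hq', t, h2⟩ := hq
      exact ⟨p' + q', S.add_mem hp' hq', r + t, by rw [mul_add, h1, h2]; ring⟩
    | smul c q _ hq =>
      obtain ⟨q', hq', t, h2⟩ := hq
      exact ⟨c • q', S.smul_mem _ hq', c • t, by
        rw [mul_smul_comm, h2, smul_add, mul_smul_comm]⟩
  induction p using MvPolynomial.induction_on with
  | C a =>
    exact ⟨a • 1, S.smul_mem _ (hmem one_mem_harm), 0, by simp [smul_eq_C_mul]⟩
  | add p q hp hq =>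
    obtain ⟨p', hp', r, h1⟩ := hp
    obtain ⟨q', hq', t, h2⟩ := hq
    exact ⟨p' + q', S.add_mem hp' hq', r + t, by rw [h1, h2]; ring⟩
  | mul_X p i hp =>
    obtain ⟨p', hp', r, h1⟩ := hp
    rcases i with l | l
    · obtain ⟨q, hq, t, h2⟩ := hz l p' hp'
      exact ⟨q, hq, t + zv l * r, by rw [h1, add_mul, mul_comm p', h2]; ring⟩
    · obtain ⟨q, hq, t, h2⟩ := hw l p' hp'
      exact ⟨q, hq, t + wv l * r, by rw [h1, add_mul, mul_comm p', h2]; ring⟩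

/-! ### Invariant bilinear forms on polynomials -/

/-- Infinitesimal unitary invariance of a bilinear form on polynomials. -/
def RotInvariant (β : CPoly n →ₗ[ℂ] CPoly n →ₗ[ℂ] ℂ) : Prop :=
  ∀ l m F G, β (rot l m F) G = -β F (rot l m G)

/-- The form depends only on the restrictions of its arguments to `|z|² = 1`. -/
def RhoInvariant (β : CPoly n →ₗ[ℂ] CPoly n →ₗ[ℂ] ℂ) : Prop :=
  (∀ F G, β (rho n * F) G = β F G) ∧ ∀ F G, β F (rho n * G) = β F G

/-- The action, on functions of weight `(a, b)`, of the infinitesimal Möbius transformation of the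
ball which moves the origin in the direction `e_l`. -/
def boostField (a b : ℂ) (l : Fin (n + 1)) (p : CPoly n) : CPoly n :=
  dz l p + dw l p - zv l * (a • p + eulerZ n p) - wv l * (b • p + eulerW n p)

/-- Infinitesimal Möbius invariance of a bilinear form for the weights `(a, b)`. -/
def BoostInvariant (a b : ℂ) (β : CPoly n →ₗ[ℂ] CPoly n →ₗ[ℂ] ℂ) : Prop :=
  ∀ l F G, β (boostField a b l F) G = -β F (boostField b a l G)

/-- The components of `boostField a b l p` for `p` harmonic of bidegree `(j, k)`: modulo
`|z|² - 1` they have the bidegrees `(j ± 1, k)` and `(j, k ± 1)`. -/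
theorem boostField_harm (hn : 1 ≤ n) (a b : ℂ) {j k : ℕ} {p : CPoly n} (hp : p ∈ harm n j k)
    (l : Fin (n + 1)) :
    boostField a b l p = -(a + j) • raiseZ j k l p - (b + k) • raiseW j k l p
      + ((n + j - b) / (n + j + k)) • dz l p + ((n + k - a) / (n + j + k)) • dw l p
      + (1 - rho n) * (((a + j) / (n + j + k)) • dw l p + ((b + k) / (n + j + k)) • dz l p) := by
  have hN := natCast_add_ne_zero hn j k
  rw [mem_harm] at hp
  have h1 : C (((n : ℂ) + j - b) / (n + j + k)) + C ((b + k) / (n + j + k)) = (1 : CPoly n) := by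
    rw [← C_add, ← C_1]; congr 1; field_simp; ring
  have h2 : C (((n : ℂ) + k - a) / (n + j + k)) + C ((a + j) / (n + j + k)) = (1 : CPoly n) := by
    rw [← C_add, ← C_1]; congr 1; field_simp; ring
  rw [boostField, raiseZ, raiseW, hp.2.1, hp.2.2]
  rw [div_eq_mul_inv] at h1 h2
  rw [div_eq_mul_inv] at h1 h2
  simp only [smul_eq_C_mul, div_eq_mul_inv, C_mul, map_add, map_neg] at h1 h2 ⊢
  linear_combination (-dz l p) * h1 - dw l p * h2

theorem sum_rot_self (p : CPoly n) : ∑ l, rot l l p = eulerZ n p - eulerW n p := by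
  simp only [rot_apply, Finset.sum_sub_distrib, eulerZ_apply, eulerW_apply]

/-- The Casimir operator of the unitary group acts by a scalar on harmonic polynomials. -/
theorem sum_rot_rot {j k : ℕ} {p : CPoly n} (hp : p ∈ harm n j k) :
    ∑ l, ∑ m, rot l m (rot m l p) = ((j : ℂ) * (j + n) + k * (k + n)) • p := by
  have e1 : ∀ l, ∑ m, zv m * dz m (dz l p) = ((j : ℂ) - 1) • dz l p := by
    intro l
    rw [← eulerZ_apply, eulerZ_dz, (mem_harm.1 hp).2.1]; simp [sub_smul]
  have e2 : ∀ m, ∑ l, wv l * dw l (dw m p) = ((k : ℂ) - 1) • dw m p := by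
    intro l
    rw [← eulerW_apply, eulerW_dw, (mem_harm.1 hp).2.2]; simp [sub_smul]
  have e3 : ∑ m, dz m (dw m p) = 0 := by rw [← lap_apply, (mem_harm.1 hp).1]
  have h : ∀ l m, rot l m (rot m l p) = zv l * dz l p + zv l * (zv m * dz m (dz l p))
      - zv l * (wv l * dz m (dw m p)) - wv m * (zv m * dz l (dw l p)) + wv m * dw m p
      + wv m * (wv l * dw l (dw m p)) := by
    intro l m
    simp only [rot_apply, map_sub, pderiv_mul, dz_zv, dw_wv, dw_zv, dz_wv, if_true]
    rw [pderiv_comm (Sum.inr l) (Sum.inl l)]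
    ring
  simp only [h, Finset.sum_add_distrib, Finset.sum_sub_distrib, ← Finset.mul_sum, e1, e3]
  have e4 : ∑ l, ∑ m, wv m * (wv l * dw l (dw m p)) = ((k : ℂ) - 1) • eulerW n p := by
    rw [Finset.sum_comm]
    simp only [← Finset.mul_sum, e2, mul_smul_comm, ← Finset.smul_sum, eulerW_apply]
  have e5 : ∑ l : Fin (n + 1), ∑ m : Fin (n + 1), wv m * (zv m * dz l (dw l p)) = 0 := by
    rw [Finset.sum_comm]
    simp only [← Finset.mul_sum, e3, mul_zero, Finset.sum_const_zero]
  rw [e4, e5]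
  simp only [mul_smul_comm, ← Finset.smul_sum, ← eulerZ_apply, ← eulerW_apply, Finset.sum_const,
    Finset.card_univ, Fintype.card_fin, (mem_harm.1 hp).2.1, (mem_harm.1 hp).2.2, mul_zero]
  simp only [← Nat.cast_smul_eq_nsmul ℂ, smul_smul, sub_zero, smul_zero, ← add_smul]
  congr 1
  push_cast
  ring

/-- An invariant form pairs bidegree `(j, k)` with bidegree `(k, j)` only: the other pairs are
separated by the eigenvalues of `∑ rot l l` and of the Casimir operator. -/
theorem RotInvariant.eq_zero (hn : 1 ≤ n) {β : CPoly n →ₗ[ℂ] CPoly n →ₗ[ℂ] ℂ}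
    (hβ : RotInvariant β) {j k j' k' : ℕ} {p q : CPoly n} (hp : p ∈ harm n j k)
    (hq : q ∈ harm n j' k') (hne : ¬(j' = k ∧ k' = j)) : β p q = 0 := by
  have h1 : β (∑ l, rot l l p) q = -β p (∑ l, rot l l q) := by
    simp only [map_sum, LinearMap.sum_apply, hβ _ _ p q, Finset.sum_neg_distrib]
  have h2 : β (∑ l, ∑ m, rot l m (rot m l p)) q = β p (∑ l, ∑ m, rot l m (rot m l q)) := by
    simp only [map_sum, LinearMap.sum_apply]
    rw [Finset.sum_comm]
    refine Finset.sum_congr rfl fun l _ => Finset.sum_congr rfl fun m _ => ?_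
    rw [hβ, hβ, neg_neg]
  rw [sum_rot_self, sum_rot_self, (mem_harm.1 hp).2.1, (mem_harm.1 hp).2.2, (mem_harm.1 hq).2.1,
    (mem_harm.1 hq).2.2, ← sub_smul, ← sub_smul, map_smul, map_smul, LinearMap.smul_apply,
    smul_eq_mul, smul_eq_mul] at h1
  rw [sum_rot_rot hp, sum_rot_rot hq, map_smul, map_smul, LinearMap.smul_apply, smul_eq_mul,
    smul_eq_mul] at h2
  by_contra hb
  have h3 : ((j : ℂ) - k) = -(j' - k') := mul_right_cancel₀ hb (by linear_combination h1)
  have h4 := mul_right_cancel₀ hb h2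
  have h3' : (j : ℤ) - k = -(j' - k') := by exact_mod_cast h3
  have h4' : (j : ℤ) * (j + n) + k * (k + n) = j' * (j' + n) + k' * (k' + n) := by exact_mod_cast h4
  have h5 : ((j : ℤ) + k - (j' + k')) * (j + k + j' + k' + 2 * n) = 0 := by
    have hk' : (k' : ℤ) = j - k + j' := by linarith
    rw [hk'] at h4' ⊢
    linear_combination 2 * h4'
  rcases mul_eq_zero.1 h5 with h5 | h5
  · exact hne ⟨by omega, by omega⟩
  · omega

/-- A linear functional on polynomials with the invariance properties of integration over the
sphere. -/
structure IsSphereMean (L : CPoly n →ₗ[ℂ] ℂ) : Prop where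
  map_rot : ∀ l m p, L (rot l m p) = 0
  map_rho : ∀ p, L (rho n * p) = L p
  map_one_ne_zero : L 1 ≠ 0

/-- The bilinear form `(F, G) ↦ L (F G)`. -/
def mulForm (L : CPoly n →ₗ[ℂ] ℂ) : CPoly n →ₗ[ℂ] CPoly n →ₗ[ℂ] ℂ :=
  (LinearMap.mul ℂ (CPoly n)).compr₂ L

theorem mulForm_apply (L : CPoly n →ₗ[ℂ] ℂ) (F G : CPoly n) : mulForm L F G = L (F * G) := rfl

theorem IsSphereMean.rotInvariant {L : CPoly n →ₗ[ℂ] ℂ} (hL : IsSphereMean L) :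
    RotInvariant (mulForm L) := by
  intro l m F G
  rw [mulForm_apply, mulForm_apply, eq_neg_iff_add_eq_zero, ← map_add, ← rot_mul, hL.map_rot]

/-- Integration by parts: on the sphere, `z̄_l` is adjoint to `∂/∂z_l` up to a factor. -/
theorem IsSphereMean.wv_mul {L : CPoly n →ₗ[ℂ] ℂ} (hL : IsSphereMean L) {k : ℂ} {p : CPoly n}
    (hp : eulerW n p = k • p) (l : Fin (n + 1)) : (n + 1 + k) * L (wv l * p) = L (dz l p) := by
  have h : ∑ m, rot m l (wv m * p) = rho n * dz l p - (n + 1 + k) • (wv l * p) := by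
    have : ∀ m, rot m l (wv m * p) = (zv m * wv m) * dz l p - wv l * p - wv l * (wv m * dw m p) := by
      intro m
      rw [rot_apply, pderiv_mul, pderiv_mul, dz_wv, dw_wv, if_pos rfl]; ring
    simp only [this, Finset.sum_sub_distrib, ← Finset.sum_mul, ← Finset.mul_sum, ← eulerW_apply, hp]
    simp only [rho, Finset.sum_const, Finset.card_univ, Fintype.card_fin, smul_eq_C_mul,
      nsmul_eq_mul, map_add, map_natCast, map_one]
    push_cast
    ring
  have h2 : L (∑ m, rot m l (wv m * p)) = 0 := by
    rw [map_sum]; exact Finset.sum_eq_zero fun m _ => hL.map_rot _ _ _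
  rw [h, map_sub, hL.map_rho, map_smul, smul_eq_mul] at h2
  linear_combination -h2

theorem IsSphereMean.zv_mul {L : CPoly n →ₗ[ℂ] ℂ} (hL : IsSphereMean L) {j : ℂ} {p : CPoly n}
    (hp : eulerZ n p = j • p) (l : Fin (n + 1)) : (n + 1 + j) * L (zv l * p) = L (dw l p) := by
  have h : ∑ m, rot l m (zv m * p) = (n + 1 + j) • (zv l * p) - rho n * dw l p := by
    have : ∀ m, rot l m (zv m * p) = zv l * p + zv l * (zv m * dz m p) - (zv m * wv m) * dw l p := by
      intro m
      rw [rot_apply, pderiv_mul, pderiv_mul, dz_zv, dw_zv, if_pos rfl]; ring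
    simp only [this, Finset.sum_sub_distrib, Finset.sum_add_distrib, ← Finset.sum_mul,
      ← Finset.mul_sum, ← eulerZ_apply, hp]
    simp only [rho, Finset.sum_const, Finset.card_univ, Fintype.card_fin, smul_eq_C_mul,
      nsmul_eq_mul, map_add, map_natCast, map_one]
    push_cast
    ring
  have h2 : L (∑ m, rot l m (zv m * p)) = 0 := by
    rw [map_sum]; exact Finset.sum_eq_zero fun m _ => hL.map_rot _ _ _
  rw [h, map_sub, hL.map_rho, map_smul, smul_eq_mul] at h2
  linear_combination h2

theorem zv_pow_mem_harm (l : Fin (n + 1)) (j : ℕ) : zv l ^ j ∈ harm n j 0 := by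
  rw [mem_harm]
  refine ⟨?_, ?_, ?_⟩
  · simp [lap_apply]
  · induction j with
    | zero => simp
    | succ j ih =>
      rw [pow_succ, eulerZ_mul, ih, eulerZ_zv, Nat.cast_succ, smul_mul_assoc, add_smul, one_smul]
  · induction j with
    | zero => simp
    | succ j ih => rw [pow_succ, eulerW_mul, ih, eulerW_zv]; simp

theorem wv_pow_mem_harm (l : Fin (n + 1)) (k : ℕ) : wv l ^ k ∈ harm n 0 k := by
  have := conjPoly_mem_harm (zv_pow_mem_harm l k)
  simpa [conjPoly] using this

theorem IsSphereMean.zv_pow_mul_wv_pow_ne_zero {L : CPoly n →ₗ[ℂ] ℂ} (hL : IsSphereMean L)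
    (l : Fin (n + 1)) (j : ℕ) : L (zv l ^ j * wv l ^ j) ≠ 0 := by
  induction j with
  | zero => simpa using hL.map_one_ne_zero
  | succ j ih =>
    have hp : eulerZ n (zv l ^ j * wv l ^ (j + 1)) = (j : ℂ) • (zv l ^ j * wv l ^ (j + 1)) := by
      rw [eulerZ_mul, (mem_harm.1 (zv_pow_mem_harm l j)).2.1,
        (mem_harm.1 (wv_pow_mem_harm l (j + 1))).2.1]
      simp
    have h := hL.zv_mul hp l
    have hd : dw l (zv l ^ j * wv l ^ (j + 1)) = ((j : ℂ) + 1) • (zv l ^ j * wv l ^ j) := by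
      rw [pderiv_mul, pderiv_pow, pderiv_pow, dw_zv, dw_wv, if_pos rfl]
      simp only [smul_eq_C_mul, map_add, map_natCast, map_one, Nat.add_sub_cancel]
      push_cast
      ring
    rw [hd, map_smul, smul_eq_mul] at h
    intro h0
    rw [pow_succ', mul_assoc] at h0
    rw [h0, mul_zero, eq_comm, mul_eq_zero] at h
    rcases h with h | h
    · exact Nat.cast_add_one_ne_zero j h
    · exact ih h

/-- The form induced by `β` one degree lower, by contraction with the coordinates. -/
def contractForm (β : CPoly n →ₗ[ℂ] CPoly n →ₗ[ℂ] ℂ) : CPoly n →ₗ[ℂ] CPoly n →ₗ[ℂ] ℂ :=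
  ∑ m : Fin (n + 1), β.compl₁₂ (LinearMap.mulLeft ℂ (zv m)) (LinearMap.mulLeft ℂ (wv m))

theorem contractForm_apply (β : CPoly n →ₗ[ℂ] CPoly n →ₗ[ℂ] ℂ) (F G : CPoly n) :
    contractForm β F G = ∑ m, β (zv m * F) (wv m * G) := by
  simp [contractForm, LinearMap.sum_apply]

theorem rot_zv_mul (p q m : Fin (n + 1)) (F : CPoly n) :
    rot p q (zv m * F) = zv m * rot p q F + if q = m then zv p * F else 0 := by
  rw [rot_mul, rot_apply p q (zv m), dz_zv, dw_zv]
  split_ifs <;> ring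

theorem rot_wv_mul (p q m : Fin (n + 1)) (F : CPoly n) :
    rot p q (wv m * F) = wv m * rot p q F - if p = m then wv q * F else 0 := by
  rw [rot_mul, rot_apply p q (wv m), dz_wv, dw_wv]
  split_ifs <;> ring

theorem RotInvariant.contract {β : CPoly n →ₗ[ℂ] CPoly n →ₗ[ℂ] ℂ} (hβ : RotInvariant β) :
    RotInvariant (contractForm β) := by
  intro p q F G
  rw [contractForm_apply, contractForm_apply]
  have h1 : ∑ m, β (zv m * rot p q F) (wv m * G)
      = ∑ m, β (rot p q (zv m * F)) (wv m * G) - β (zv p * F) (wv q * G) := by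
    have : ∀ m, β (zv m * rot p q F) (wv m * G) = β (rot p q (zv m * F)) (wv m * G)
        - if q = m then β (zv p * F) (wv m * G) else 0 := by
      intro m
      rw [rot_zv_mul, map_add, LinearMap.add_apply]
      split_ifs <;> simp
    simp only [this, Finset.sum_sub_distrib, Finset.sum_ite_eq, Finset.mem_univ, if_true]
  have h2 : ∑ m, β (zv m * F) (wv m * rot p q G)
      = ∑ m, β (zv m * F) (rot p q (wv m * G)) + β (zv p * F) (wv q * G) := by
    have : ∀ m, β (zv m * F) (wv m * rot p q G) = β (zv m * F) (rot p q (wv m * G))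
        + if p = m then β (zv m * F) (wv q * G) else 0 := by
      intro m
      rw [rot_wv_mul, map_sub]
      split_ifs <;> simp
    simp only [this, Finset.sum_add_distrib, Finset.sum_ite_eq, Finset.mem_univ, if_true]
  rw [h1, h2]
  simp only [hβ _ _ _ _, Finset.sum_neg_distrib]
  ring

/-- On holomorphic polynomials of degree `d + 1`, an invariant form is recovered from its
contraction. -/
theorem RotInvariant.eq_sum_contract {β : CPoly n →ₗ[ℂ] CPoly n →ₗ[ℂ] ℂ}
    (hβ : RotInvariant β) {d : ℕ} {p q : CPoly n} (hp : p ∈ harm n (d + 1) 0)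
    (hq : q ∈ harm n 0 (d + 1)) :
    ((n + 1 + d : ℂ) * (d + 1)) * β p q = ∑ l, contractForm β (dz l p) (dw l q) := by
  have h0 : ∀ l, dz l q = 0 := dz_eq_zero_of_eulerZ (by simp [(mem_harm.1 hq).2.1])
  have key : ∀ l, (n + 1 + d : ℂ) * β (zv l * dz l p) q
      = contractForm β (dz l p) (dw l q) := by
    intro l
    have hd := dz_mem_harm hp l
    rw [Nat.add_sub_cancel, mem_harm] at hd
    have hw : ∀ m, dw m (dz l p) = 0 := dw_eq_zero_of_eulerW (by simp [hd.2.2])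
    have h : ∑ m, rot l m (zv m * dz l p) = (n + 1 + d : ℂ) • (zv l * dz l p) := by
      have : ∀ m, rot l m (zv m * dz l p) = zv l * dz l p + zv l * (zv m * dz m (dz l p)) := by
        intro m
        rw [rot_apply, pderiv_mul, pderiv_mul, dz_zv, dw_zv, if_pos rfl, hw]; ring
      simp only [this, Finset.sum_add_distrib, ← Finset.mul_sum, ← eulerZ_apply, hd.2.1]
      simp only [Finset.sum_const, Finset.card_univ, Fintype.card_fin, smul_eq_C_mul,
        nsmul_eq_mul, map_add, map_natCast, map_one]
      push_cast
      ring
    rw [← smul_eq_mul, ← LinearMap.smul_apply, ← map_smul, ← h, map_sum, LinearMap.sum_apply,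
      contractForm_apply]
    refine Finset.sum_congr rfl fun m _ => ?_
    rw [hβ, rot_apply, h0, mul_zero, zero_sub, map_neg, neg_neg]
  rw [← Finset.sum_congr rfl fun l _ => key l, ← Finset.mul_sum, ← LinearMap.sum_apply, ← map_sum,
    ← eulerZ_apply, (mem_harm.1 hp).2.1, map_smul, LinearMap.smul_apply, smul_eq_mul]
  push_cast
  ring

/-- Schur's lemma for the homogeneous holomorphic polynomials. -/
theorem RotInvariant.exists_eq_mul_holomorphic {L : CPoly n →ₗ[ℂ] ℂ} (hL : IsSphereMean L) (d : ℕ)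
    {β : CPoly n →ₗ[ℂ] CPoly n →ₗ[ℂ] ℂ} (hβ : RotInvariant β) :
    ∃ μ : ℂ, ∀ p ∈ harm n d 0, ∀ q ∈ harm n 0 d, β p q = μ * L (p * q) := by
  induction d generalizing β with
  | zero =>
    refine ⟨β 1 1 / L 1, fun p hp q hq => ?_⟩
    obtain ⟨a, rfl⟩ := exists_smul_one_of_mem_harm_zero hp
    obtain ⟨b, rfl⟩ := exists_smul_one_of_mem_harm_zero hq
    have := hL.map_one_ne_zero
    simp
    field_simp
  | succ d ih =>
    obtain ⟨μ, hμ⟩ := ih hβ.contract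
    refine ⟨μ, fun p hp q hq => ?_⟩
    have hc : ((n + 1 + d : ℂ) * (d + 1)) ≠ 0 := by
      have : (n + 1 + d) * (d + 1) ≠ 0 := by positivity
      exact_mod_cast this
    apply mul_left_cancel₀ hc
    have h1 := hβ.eq_sum_contract hp hq
    have h2 := hL.rotInvariant.eq_sum_contract hp hq
    have h3 : ∀ F G, contractForm (mulForm L) F G = L (F * G) := by
      intro F G
      rw [contractForm_apply, ← hL.map_rho (F * G), rho, Finset.sum_mul, map_sum]
      refine Finset.sum_congr rfl fun m _ => ?_
      rw [mulForm_apply]; congr 1; ring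
    rw [mulForm_apply] at h2
    rw [h1, mul_left_comm, h2, Finset.mul_sum]
    refine Finset.sum_congr rfl fun l _ => ?_
    rw [h3]
    refine hμ _ ?_ _ ?_
    · simpa using dz_mem_harm hp l
    · simpa using dw_mem_harm hq l

/-- The invariance under boosts links the values of the form on neighbouring bidegrees. -/
theorem BoostInvariant.apply_raiseW (hn : 1 ≤ n) {a b : ℂ} {β : CPoly n →ₗ[ℂ] CPoly n →ₗ[ℂ] ℂ}
    (hβ : BoostInvariant a b β) (hrot : RotInvariant β) (hrho : RhoInvariant β) {j k : ℕ}
    {p q : CPoly n} (hp : p ∈ harm n j k) (hq : q ∈ harm n (k + 1) j) (l : Fin (n + 1)) :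
    (b + k) * β (raiseW j k l p) q = ((n + 1 + k - a) / (n + 1 + j + k)) * β p (dz l q) := by
  have h := hβ l p q
  rw [boostField_harm hn a b hp, boostField_harm hn b a hq] at h
  have z1 := hrot.eq_zero hn (raiseZ_mem_harm hn hp l) hq (by omega)
  have z2 := hrot.eq_zero hn (dz_mem_harm hp l) hq (by omega)
  have z3 := hrot.eq_zero hn (dw_mem_harm hp l) hq (by omega)
  have z4 := hrot.eq_zero hn hp (raiseZ_mem_harm hn hq l) (by omega)
  have z5 := hrot.eq_zero hn hp (raiseW_mem_harm hn hq l) (by omega)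
  have z6 := hrot.eq_zero hn hp (dw_mem_harm hq l) (by omega)
  have e1 : ∀ r, β ((1 - rho n) * r) q = 0 := by
    intro r
    rw [sub_mul, one_mul, map_sub, LinearMap.sub_apply, hrho.1, sub_self]
  have e2 : ∀ r, β p ((1 - rho n) * r) = 0 := by
    intro r
    rw [sub_mul, one_mul, map_sub, hrho.2, sub_self]
  simp only [map_add, map_sub, map_smul, LinearMap.add_apply, LinearMap.sub_apply,
    LinearMap.smul_apply, z1, z2, z3, z4, z5, z6, e1, e2, smul_eq_mul, mul_zero, add_zero,
    zero_sub, sub_zero, zero_add] at h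
  push_cast at h
  rw [show (n : ℂ) + 1 + j + k = n + (k + 1) + j by ring,
    show (n : ℂ) + 1 + k - a = n + (k + 1) - a by ring]
  linear_combination -h

theorem IsSphereMean.raiseW_mul (hn : 1 ≤ n) {L : CPoly n →ₗ[ℂ] ℂ} (hL : IsSphereMean L) {j k : ℕ}
    {p q : CPoly n} (hp : p ∈ harm n j k) (hq : q ∈ harm n (k + 1) j) (l : Fin (n + 1)) :
    (n + 1 + j + k) * L (raiseW j k l p * q) = L (p * dz l q) := by
  have z1 := hL.rotInvariant.eq_zero hn (dz_mem_harm hp l) hq (by omega)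
  rw [mulForm_apply] at z1
  have hw : eulerW n (p * q) = (k + j : ℂ) • (p * q) := by
    rw [eulerW_mul, (mem_harm.1 hp).2.2, (mem_harm.1 hq).2.2, smul_mul_assoc, mul_smul_comm,
      add_smul]
  have h := hL.wv_mul hw l
  rw [pderiv_mul, map_add, z1, zero_add] at h
  rw [raiseW, sub_mul, map_sub, smul_mul_assoc, map_smul, mul_assoc (rho n), hL.map_rho, z1, smul_zero,
    sub_zero, mul_assoc, ← h]
  ring

theorem sum_raiseW_dw {j k : ℕ} {p : CPoly n} (hp : p ∈ harm n j (k + 1)) :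
    ∑ l, raiseW j k l (dw l p) = ((k : ℂ) + 1) • p := by
  simp only [raiseW, Finset.sum_sub_distrib, ← Finset.smul_sum, ← Finset.mul_sum]
  rw [← lap_apply, (mem_harm.1 hp).1, ← eulerW_apply, (mem_harm.1 hp).2.2]
  simp

/-- Going from bidegree `(j, k)` to `(j, k + 1)`: an invariant form stays proportional to
`L (p q)`. -/
theorem BoostInvariant.eq_mul_succ (hn : 1 ≤ n) {L : CPoly n →ₗ[ℂ] ℂ} (hL : IsSphereMean L)
    {a b : ℂ} {β : CPoly n →ₗ[ℂ] CPoly n →ₗ[ℂ] ℂ} (hβ : BoostInvariant a b β)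
    (hrot : RotInvariant β) (hrho : RhoInvariant β) {j k : ℕ} {μ : ℂ}
    (hμ : ∀ p ∈ harm n j k, ∀ q ∈ harm n k j, β p q = μ * L (p * q)) {p q : CPoly n}
    (hp : p ∈ harm n j (k + 1)) (hq : q ∈ harm n (k + 1) j) :
    (b + k) * β p q = (n + 1 - a + k) * μ * L (p * q) := by
  have hk : ((k : ℂ) + 1) ≠ 0 := Nat.cast_add_one_ne_zero k
  have hN : (n + 1 + j + k : ℂ) ≠ 0 := by
    have : n + 1 + j + k ≠ 0 := by omega
    exact_mod_cast this
  have key : ∀ l, (b + k) * β (raiseW j k l (dw l p)) q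
      = (n + 1 - a + k) * μ * L (raiseW j k l (dw l p) * q) := by
    intro l
    have hd := dw_mem_harm hp l
    rw [Nat.add_sub_cancel] at hd
    have hd' := dz_mem_harm hq l
    rw [Nat.add_sub_cancel] at hd'
    rw [hβ.apply_raiseW hn hrot hrho hd hq l, hμ _ hd _ hd', ← hL.raiseW_mul hn hd hq l]
    field_simp
    ring
  apply mul_left_cancel₀ hk
  have h1 : ((k : ℂ) + 1) * β p q = ∑ l, β (raiseW j k l (dw l p)) q := by
    rw [← LinearMap.sum_apply, ← map_sum, sum_raiseW_dw hp, map_smul, LinearMap.smul_apply,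
      smul_eq_mul]
  have h2 : ((k : ℂ) + 1) * L (p * q) = ∑ l, L (raiseW j k l (dw l p) * q) := by
    rw [← map_sum, ← Finset.sum_mul, sum_raiseW_dw hp, smul_mul_assoc, map_smul, smul_eq_mul]
  calc ((k : ℂ) + 1) * ((b + k) * β p q) = (b + k) * (((k : ℂ) + 1) * β p q) := by ring
    _ = (n + 1 - a + k) * μ * (((k : ℂ) + 1) * L (p * q)) := by
      rw [h1, h2, Finset.mul_sum, Finset.mul_sum]
      exact Finset.sum_congr rfl fun l _ => key l
    _ = _ := by ring

theorem BoostInvariant.flip {a b : ℂ} {β : CPoly n →ₗ[ℂ] CPoly n →ₗ[ℂ] ℂ}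
    (hβ : BoostInvariant a b β) : BoostInvariant b a β.flip := by
  intro l F G
  rw [LinearMap.flip_apply, LinearMap.flip_apply, hβ l G F, neg_neg]

theorem RotInvariant.flip {β : CPoly n →ₗ[ℂ] CPoly n →ₗ[ℂ] ℂ} (hβ : RotInvariant β) :
    RotInvariant β.flip := by
  intro l m F G
  rw [LinearMap.flip_apply, LinearMap.flip_apply, hβ l m G F, neg_neg]

theorem RhoInvariant.flip {β : CPoly n →ₗ[ℂ] CPoly n →ₗ[ℂ] ℂ} (hβ : RhoInvariant β) :
    RhoInvariant β.flip :=
  ⟨fun F G => hβ.2 G F, fun F G => hβ.1 G F⟩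

/-- A first order recursion `(a + j) x_{j+1} = (a' + j) x_j` with `a' + j ≠ 0` has a
one-dimensional solution space, also if `a + j` vanishes for some `j`. -/
theorem recursion_unique {a a' : ℂ} (ha' : ∀ j : ℕ, a' + j ≠ 0) {x y : ℕ → ℂ}
    (hx : ∀ j : ℕ, (a + j) * x (j + 1) = (a' + j) * x j)
    (hy : ∀ j : ℕ, (a + j) * y (j + 1) = (a' + j) * y j) {i : ℕ} (hi : x i ≠ 0) (j : ℕ) :
    y j = y i / x i * x j := by
  set u : ℕ → ℂ := fun j => y j - y i / x i * x j with hu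
  have hrec : ∀ j : ℕ, (a + j) * u (j + 1) = (a' + j) * u j := by
    intro j
    simp only [hu]
    linear_combination hy j - y i / x i * hx j
  have hui : u i = 0 := by simp only [hu]; field_simp; ring
  -- Both `u` and `x` vanish below any of their zeros.
  have down : ∀ v : ℕ → ℂ, (∀ j : ℕ, (a + j) * v (j + 1) = (a' + j) * v j) →
      ∀ d j, v (j + d) = 0 → v j = 0 := by
    intro v hv d
    induction d with
    | zero => intro j h; simpa using h
    | succ d ih =>
      intro j h
      apply ih
      have := hv (j + d)
      rw [show j + d + 1 = j + (d + 1) by ring, h, mul_zero, eq_comm, mul_eq_zero] at this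
      exact this.resolve_left (ha' _)
  have hne : ∀ d : ℕ, a + ((i + d : ℕ) : ℂ) ≠ 0 := by
    intro d h
    have := hx (i + d)
    rw [h, zero_mul, eq_comm, mul_eq_zero] at this
    exact hi (down x hx d i (this.resolve_left (ha' _)))
  have up : ∀ d, u (i + d) = 0 := by
    intro d
    induction d with
    | zero => simpa using hui
    | succ d ih =>
      have := hrec (i + d)
      rw [ih, mul_zero, mul_eq_zero] at this
      exact this.resolve_left (hne d)
  have : u j = 0 := by
    rcases le_total i j with h | h
    · obtain ⟨d, rfl⟩ := Nat.exists_eq_add_of_le h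
      exact up d
    · obtain ⟨d, rfl⟩ := Nat.exists_eq_add_of_le h
      exact down u hrec d j hui
  exact sub_eq_zero.1 this

/-- An invariant form is determined up to a constant, if `b` is not a nonpositive integer. -/
theorem exists_eq_mul_of_boostInvariant_aux (hn : 1 ≤ n) {L : CPoly n →ₗ[ℂ] ℂ}
    (hL : IsSphereMean L) {a b : ℂ} {β : CPoly n →ₗ[ℂ] CPoly n →ₗ[ℂ] ℂ}
    (hβ : BoostInvariant a b β) (hrot : RotInvariant β) (hrho : RhoInvariant β)
    (hb : ∀ k : ℕ, b + k ≠ 0) (ha' : ∀ j : ℕ, n + 1 - b + j ≠ 0)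
    {x y : ℕ → ℂ} (hx : ∀ j : ℕ, (a + j) * x (j + 1) = (n + 1 - b + j) * x j)
    (hy : ∀ k : ℕ, (b + k) * y (k + 1) = (n + 1 - a + k) * y k) (hx0 : ∃ i, x i ≠ 0)
    (hy0 : y 0 ≠ 0) :
    ∃ c : ℂ, ∀ j k, ∀ p ∈ harm n j k, ∀ q ∈ harm n k j, β p q = c * x j * y k * L (p * q) := by
  choose μ hμ using fun d => hrot.exists_eq_mul_holomorphic hL d
  obtain ⟨i, hi⟩ := hx0
  have hrec : ∀ j : ℕ, (a + j) * μ (j + 1) = (n + 1 - b + j) * μ j := by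
    intro j
    have h1 := hβ.flip.eq_mul_succ hn hL hrot.flip hrho.flip (j := 0) (k := j) (μ := μ j)
      (fun p hp q hq => by rw [LinearMap.flip_apply, hμ _ _ hq _ hp, mul_comm q])
      (wv_pow_mem_harm 0 (j + 1)) (zv_pow_mem_harm 0 (j + 1))
    rw [LinearMap.flip_apply, hμ _ _ (zv_pow_mem_harm 0 (j + 1)) _ (wv_pow_mem_harm 0 (j + 1)),
      mul_comm (wv 0 ^ (j + 1)), ← mul_assoc] at h1
    exact mul_right_cancel₀ (hL.zv_pow_mul_wv_pow_ne_zero 0 (j + 1)) h1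
  have hμx := recursion_unique ha' hx hrec hi
  refine ⟨μ i / x i / y 0, fun j k => ?_⟩
  induction k with
  | zero =>
    intro p hp q hq
    rw [hμ _ _ hp _ hq, hμx j]
    field_simp
  | succ k ih =>
    intro p hp q hq
    apply mul_left_cancel₀ (hb k)
    rw [hβ.eq_mul_succ hn hL hrot hrho ih hp hq]
    linear_combination (-(μ i / x i / y 0) * x j * L (p * q)) * hy k

/-- An invariant form is determined up to a constant. At most one of the weights is a nonpositive
integer, and the two cases are exchanged by transposing the form. -/
theorem exists_eq_mul_of_boostInvariant (hn : 1 ≤ n) {L : CPoly n →ₗ[ℂ] ℂ}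
    (hL : IsSphereMean L) {a b : ℂ} {β : CPoly n →ₗ[ℂ] CPoly n →ₗ[ℂ] ℂ}
    (hβ : BoostInvariant a b β) (hrot : RotInvariant β) (hrho : RhoInvariant β)
    (hab : (∀ k : ℕ, a + k ≠ 0) ∨ ∀ k : ℕ, b + k ≠ 0)
    (ha' : ∀ j : ℕ, n + 1 - b + j ≠ 0) (hb' : ∀ j : ℕ, n + 1 - a + j ≠ 0)
    {x y : ℕ → ℂ} (hx : ∀ j : ℕ, (a + j) * x (j + 1) = (n + 1 - b + j) * x j)
    (hy : ∀ k : ℕ, (b + k) * y (k + 1) = (n + 1 - a + k) * y k)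
    (hx0 : ∃ i, x i ≠ 0) (hy0 : ∃ i, y i ≠ 0) :
    ∃ c : ℂ, ∀ j k, ∀ p ∈ harm n j k, ∀ q ∈ harm n k j, β p q = c * x j * y k * L (p * q) := by
  have first : ∀ {a a' : ℂ}, (∀ k : ℕ, a + k ≠ 0) → (∀ k : ℕ, a' + k ≠ 0) → ∀ {x : ℕ → ℂ},
      (∀ j : ℕ, (a + j) * x (j + 1) = (a' + j) * x j) → (∃ i, x i ≠ 0) → x 0 ≠ 0 := by
    intro a a' h1 h2 x hx ⟨i, hi⟩ h0
    apply hi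
    clear hi
    induction i with
    | zero => exact h0
    | succ i ih =>
      have := hx i
      rw [ih, mul_zero, mul_eq_zero] at this
      exact this.resolve_left (h1 i)
  rcases hab with h | h
  · obtain ⟨c, hc⟩ := exists_eq_mul_of_boostInvariant_aux hn hL hβ.flip hrot.flip hrho.flip h hb' hy
      hx hy0 (first h ha' hx hx0)
    refine ⟨c, fun j k p hp q hq => ?_⟩
    have := hc k j q hq p hp
    rw [LinearMap.flip_apply] at this
    rw [this, mul_comm q]
    ring
  · exact exists_eq_mul_of_boostInvariant_aux hn hL hβ hrot hrho h ha' hx hy hx0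
      (first h hb' hy hy0)

/-! ### Integration over the sphere -/

instance (n : ℕ) : IsFiniteMeasure (crVolume n) := by
  refine ⟨?_⟩
  rw [crVolume, Measure.smul_apply, smul_eq_mul]
  exact ENNReal.mul_lt_top (ENNReal.natCast_lt_top _) (measure_lt_top _ _)

instance (n : ℕ) : (crVolume n).IsOpenPosMeasure := by
  refine ⟨fun U hU hne => ?_⟩
  rw [crVolume, Measure.smul_apply, smul_eq_mul]
  refine mul_ne_zero ?_ (hU.measure_ne_zero _ hne)
  have : 2 ^ n * n.factorial ≠ 0 := by positivity
  exact_mod_cast this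

theorem integrable_of_continuous {f : Sph n → ℂ} (hf : Continuous f) :
    Integrable f (crVolume n) :=
  hf.integrable_of_hasCompactSupport (HasCompactSupport.of_compactSpace f)

theorem integrable_of_continuous_real {f : Sph n → ℝ} (hf : Continuous f) :
    Integrable f (crVolume n) :=
  hf.integrable_of_hasCompactSupport (HasCompactSupport.of_compactSpace f)

/-- The restriction of a norm preserving map to the unit sphere. -/
def sphMap (e : Cn n → Cn n) (he : ∀ x, ‖e x‖ = ‖x‖) (z : Sph n) : Sph n :=
  ⟨e z, by have := z.2; rw [mem_sphere_zero_iff_norm] at *; rw [he, this]⟩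

open scoped Pointwise in
theorem measurePreserving_sphMap (e : Cn n ≃ₗᵢ[ℝ] Cn n) :
    MeasurePreserving (sphMap e e.norm_map) (crVolume n) (crVolume n) := by
  have hc : Continuous (sphMap e e.norm_map) :=
    Continuous.subtype_mk (e.continuous.comp continuous_subtype_val) _
  refine ⟨hc.measurable, ?_⟩
  rw [crVolume, Measure.map_smul]
  congr 1
  ext s hs
  rw [Measure.map_apply hc.measurable hs, Measure.toSphere_apply' _ hs,
    Measure.toSphere_apply' _ (hc.measurable hs)]
  congr 1
  have hset : Set.Ioo (0 : ℝ) 1 • (Subtype.val '' (sphMap e e.norm_map ⁻¹' s))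
      = e ⁻¹' (Set.Ioo (0 : ℝ) 1 • (Subtype.val '' s)) := by
    ext x
    simp only [Set.mem_smul, Set.mem_image, Set.mem_preimage]
    constructor
    · rintro ⟨r, hr, _, ⟨y, hy, rfl⟩, rfl⟩
      exact ⟨r, hr, _, ⟨_, hy, rfl⟩, by simp [sphMap]⟩
    · rintro ⟨r, hr, _, ⟨y, hy, rfl⟩, h⟩
      have hy1 : ‖(y : Cn n)‖ = 1 := by simp
      have hyy : sphMap e e.norm_map ⟨e.symm y, by simp [hy1]⟩ = y := by
        ext1; simp [sphMap]
      refine ⟨r, hr, _, ⟨⟨e.symm y, by simp [hy1]⟩, ?_, rfl⟩, ?_⟩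
      · rw [hyy]; exact hy
      · apply e.injective; rw [← h]; simp
  rw [hset]
  exact e.measurePreserving.measure_preimage_emb e.toHomeomorph.measurableEmbedding _

theorem integral_comp_sphMap (e : Cn n ≃ₗᵢ[ℝ] Cn n) {f : Sph n → ℂ} (hf : Continuous f) :
    ∫ z, f (sphMap e e.norm_map z) ∂(crVolume n) = ∫ z, f z ∂(crVolume n) := by
  have h := measurePreserving_sphMap e
  conv_rhs => rw [← h.map_eq]
  rw [integral_map h.measurable.aemeasurable hf.aestronglyMeasurable]

/-- Differentiation under the integral sign for integrands that are continuously differentiable in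
the parameter, uniformly on the compact sphere. -/
theorem hasDerivAt_integral_sphere {𝕜 : Type*} [RCLike 𝕜] [NormedSpace 𝕜 ℂ] {U : Set 𝕜}
    (hU : IsOpen U) {F F' : 𝕜 → Sph n → ℂ} (hF : ∀ s ∈ U, Continuous (F s))
    (hF' : ContinuousOn (fun p : 𝕜 × Sph n => F' p.1 p.2) (U ×ˢ Set.univ))
    (hd : ∀ s ∈ U, ∀ z, HasDerivAt (fun s => F s z) (F' s z) s) {s : 𝕜} (hs : s ∈ U) :
    HasDerivAt (fun s => ∫ z, F s z ∂(crVolume n)) (∫ z, F' s z ∂(crVolume n)) s := by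
  have : ProperSpace 𝕜 := FiniteDimensional.proper_rclike 𝕜 𝕜
  obtain ⟨r, hr, hrU⟩ := Metric.nhds_basis_closedBall.mem_iff.1 (hU.mem_nhds hs)
  have hcomp : IsCompact (Metric.closedBall s r ×ˢ (Set.univ : Set (Sph n))) :=
    (isCompact_closedBall s r).prod isCompact_univ
  obtain ⟨M, hM⟩ := hcomp.exists_bound_of_continuousOn
    (hF'.mono (Set.prod_mono hrU subset_rfl))
  have hcont : Continuous (F' s) := by
    rw [← continuousOn_univ]
    exact hF'.comp (by fun_prop : Continuous fun z : Sph n => (s, z)).continuousOn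
      fun z _ => ⟨hs, trivial⟩
  refine (hasDerivAt_integral_of_dominated_loc_of_deriv_le
    (Metric.closedBall_mem_nhds s hr) ?_ (integrable_of_continuous (hF s hs))
    (F' := F') hcont.aestronglyMeasurable (bound := fun _ => M) ?_ (integrable_const M) ?_).2
  · filter_upwards [hU.mem_nhds hs] with t ht using (hF t ht).aestronglyMeasurable
  · exact Filter.Eventually.of_forall fun z t ht => hM (t, z) ⟨ht, trivial⟩
  · exact Filter.Eventually.of_forall fun z t ht => hd t (hrU ht) z

section Flow

variable (V : Cn n →L[ℝ] Cn n)

/-- The flow `exp (t V)` of a skew-adjoint `V` with `V³ = -V`. -/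
def flow (t : ℝ) : Cn n →L[ℝ] Cn n :=
  ContinuousLinearMap.id ℝ (Cn n) + Real.sin t • V + (1 - Real.cos t) • V.comp V

theorem flow_apply (t : ℝ) (x : Cn n) :
    flow V t x = x + Real.sin t • V x + (1 - Real.cos t) • V (V x) := rfl

variable {V}

theorem norm_flow (hskew : ∀ x y, inner ℝ (V x) y = -inner ℝ x (V y))
    (hV : ∀ x, V (V (V x)) = -V x) (t : ℝ) (x : Cn n) : ‖flow V t x‖ = ‖x‖ := by
  have h1 : ∀ y, inner ℝ y (V y) = 0 := by
    intro y
    have := hskew y y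
    rw [real_inner_comm] at this
    linarith
  have h2 : inner ℝ x (V (V x)) = -‖V x‖ ^ 2 := by
    rw [← real_inner_self_eq_norm_sq, hskew, neg_neg]
  have h3 : ‖V (V x)‖ ^ 2 = ‖V x‖ ^ 2 := by
    rw [← real_inner_self_eq_norm_sq, hskew, hV, inner_neg_right, neg_neg,
      real_inner_self_eq_norm_sq]
  have h : ‖flow V t x‖ ^ 2 = ‖x‖ ^ 2 := by
    rw [flow_apply, norm_add_sq_real, norm_add_sq_real, inner_add_left]
    simp only [inner_smul_left, inner_smul_right, norm_smul, mul_pow, h1, h2, h3]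
    simp only [Real.norm_eq_abs, sq_abs, conj_trivial]
    linear_combination (‖V x‖ ^ 2) * Real.sin_sq_add_cos_sq t
  rwa [sq_eq_sq₀ (norm_nonneg _) (norm_nonneg _)] at h

/-- The flow as an isometry. -/
def flowEquiv (hskew : ∀ x y, inner ℝ (V x) y = -inner ℝ x (V y))
    (hV : ∀ x, V (V (V x)) = -V x) (t : ℝ) : Cn n ≃ₗᵢ[ℝ] Cn n :=
  LinearIsometry.toLinearIsometryEquiv ⟨(flow V t).toLinearMap, norm_flow hskew hV t⟩ rfl

theorem hasDerivAt_flow (t : ℝ) (x : Cn n) :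
    HasDerivAt (fun t => flow V t x) (Real.cos t • V x + Real.sin t • V (V x)) t := by
  have h1 := (Real.hasDerivAt_sin t).smul_const (V x)
  have h2 := ((Real.hasDerivAt_cos t).const_sub 1).smul_const (V (V x))
  rw [neg_neg] at h2
  exact (h1.const_add x).add h2

theorem continuous_deriv_flow_uncurry : Continuous fun p : ℝ × Sph n =>
    Real.cos p.1 • V (p.2 : Cn n) + Real.sin p.1 • V (V (p.2 : Cn n)) := by
  fun_prop

theorem continuous_flow_sphere : Continuous fun p : ℝ × Sph n => flow V p.1 (p.2 : Cn n) := by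
  simp only [flow_apply]
  fun_prop

theorem continuous_comp_flow {F : Type*} [TopologicalSpace F]
    (hskew : ∀ x y, inner ℝ (V x) y = -inner ℝ x (V y))
    (hV : ∀ x, V (V (V x)) = -V x) {g : Cn n → F} (hg : ∀ z : Sph n, ContinuousAt g z) :
    Continuous fun p : ℝ × Sph n => g (flow V p.1 (p.2 : Cn n)) := by
  rw [continuous_iff_continuousAt]
  rintro ⟨t, z⟩
  exact ContinuousAt.comp (f := fun p : ℝ × Sph n => flow V p.1 (p.2 : Cn n))
    (hg (sphMap (flow V t) (norm_flow hskew hV t) z)) continuous_flow_sphere.continuousAt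

/-- The derivative at `t = 0` of an integral of `g` along the flow, against a weight `h`. -/
theorem hasDerivAt_integral_flow (hskew : ∀ x y, inner ℝ (V x) y = -inner ℝ x (V y))
    (hV : ∀ x, V (V (V x)) = -V x) {g : Cn n → ℂ} (hg : ∀ z : Sph n, ContDiffAt ℝ 1 g z)
    {h : Sph n → ℂ} (hh : Continuous h) :
    HasDerivAt (fun t => ∫ z : Sph n, g (flow V t z) * h z ∂(crVolume n))
      (∫ z : Sph n, fderiv ℝ g z (V z) * h z ∂(crVolume n)) 0 := by
  have hcg := continuous_comp_flow hskew hV fun z => (hg z).continuousAt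
  have hcd := continuous_comp_flow hskew hV fun z =>
    ((hg z).fderiv_right (m := 0) le_rfl).continuousAt
  have hd : ∀ t (z : Sph n), HasDerivAt (fun t => g (flow V t z) * h z)
      (fderiv ℝ g (flow V t z) (Real.cos t • V z + Real.sin t • V (V z)) * h z) t := by
    intro t z
    have h1 := ((hg (sphMap (flow V t) (norm_flow hskew hV t) z)).differentiableAt
      one_ne_zero).hasFDerivAt
    exact (h1.comp_hasDerivAt t (hasDerivAt_flow t (z : Cn n))).mul_const _
  have hc1 : ∀ t : ℝ, Continuous fun z : Sph n => g (flow V t z) * h z := fun t =>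
    (hcg.comp (continuous_const.prodMk continuous_id)).mul hh
  have hc2 : Continuous fun p : ℝ × Sph n => fderiv ℝ g (flow V p.1 (p.2 : Cn n))
      (Real.cos p.1 • V p.2 + Real.sin p.1 • V (V p.2)) * h p.2 :=
    (hcd.clm_apply continuous_deriv_flow_uncurry).mul (hh.comp continuous_snd)
  have key := hasDerivAt_integral_sphere (n := n) (𝕜 := ℝ) isOpen_univ (fun t _ => hc1 t)
    (F' := fun t z => fderiv ℝ g (flow V t z) (Real.cos t • V z + Real.sin t • V (V z)) * h z)
    hc2.continuousOn (fun t _ z => hd t z) (Set.mem_univ 0)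
  have h0 : ∀ z : Sph n, fderiv ℝ g z (V z) = fderiv ℝ g (flow V 0 z)
      (Real.cos 0 • V z + Real.sin 0 • V (V z)) := by
    intro z
    rw [flow_apply, Real.cos_zero, Real.sin_zero, sub_self, zero_smul, zero_smul,
      add_zero, add_zero, add_zero, one_smul]
  simp only [h0]
  exact key

/-- A divergence theorem on the sphere, for the vector field of a one-parameter group of
isometries. -/
theorem integral_fderiv_skew (hskew : ∀ x y, inner ℝ (V x) y = -inner ℝ x (V y))
    (hV : ∀ x, V (V (V x)) = -V x) {g : Cn n → ℂ} (hg : ∀ z : Sph n, ContDiffAt ℝ 1 g z) :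
    ∫ z : Sph n, fderiv ℝ g z (V z) ∂(crVolume n) = 0 := by
  have h1 := hasDerivAt_integral_flow hskew hV hg (h := fun _ => 1) continuous_const
  simp only [mul_one] at h1
  have hgS : Continuous fun z : Sph n => g z := by
    rw [continuous_iff_continuousAt]
    intro z
    exact (hg z).continuousAt.comp (f := fun z : Sph n => (z : Cn n)) (by fun_prop)
  have h2 : (fun t => ∫ z : Sph n, g (flow V t z) ∂(crVolume n))
      = fun _ => ∫ z : Sph n, g z ∂(crVolume n) := by
    funext t
    rw [← integral_comp_sphMap (flowEquiv hskew hV t) hgS]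
    rfl
  rw [h2] at h1
  exact (hasDerivAt_const (0 : ℝ) _).unique h1 |>.symm

end Flow

/-! ### Polynomials on the sphere -/

theorem hasFDerivAt_evalAt (p : CPoly n) (z : Cn n) :
    ∃ D : Cn n →L[ℝ] ℂ, HasFDerivAt (𝕜 := ℝ) (evalAt p) D z ∧
      ∀ v : Cn n, D v = ∑ l, (v l * evalAt (dz l p) z + conj (v l) * evalAt (dw l p) z) := by
  induction p using MvPolynomial.induction_on with
  | C a =>
    refine ⟨0, ?_, fun v => by simp⟩
    have : evalAt (n := n) (C a) = fun _ => a := by funext z; simp [evalAt]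
    rw [this]; exact hasFDerivAt_const _ _
  | add p q hp hq =>
    obtain ⟨D, hD, h1⟩ := hp
    obtain ⟨D', hD', h2⟩ := hq
    refine ⟨D + D', ?_, fun v => ?_⟩
    · rw [show evalAt (p + q) = fun z => evalAt p z + evalAt q z from funext (evalAt_add p q)]
      exact hD.add hD'
    · rw [_root_.add_apply, h1, h2, ← Finset.sum_add_distrib]
      refine Finset.sum_congr rfl fun l _ => ?_
      rw [map_add, map_add, evalAt_add, evalAt_add]; ring
  | mul_X p i hp =>
    obtain ⟨D, hD, h1⟩ := hp
    have hX : ∃ D' : Cn n →L[ℝ] ℂ, HasFDerivAt (𝕜 := ℝ) (evalAt (X i)) D' z ∧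
        ∀ v : Cn n, D' v = ∑ l, (v l * evalAt (dz l (X i)) z + conj (v l) * evalAt (dw l (X i)) z) := by
      rcases i with m | m
      · refine ⟨(EuclideanSpace.proj m : Cn n →L[ℂ] ℂ).restrictScalars ℝ, ?_, fun v => ?_⟩
        · rw [show evalAt (X (Sum.inl m)) = fun z : Cn n => z m from funext (evalAt_zv m)]
          exact ((EuclideanSpace.proj m : Cn n →L[ℂ] ℂ).restrictScalars ℝ).hasFDerivAt
        · have e1 : ∀ l, evalAt (dz l (X (Sum.inl m))) z = if l = m then 1 else 0 := fun l => by
            rw [dz_zv]; split_ifs <;> simp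
          have e2 : ∀ l, dw l (X (Sum.inl m)) = 0 := fun l => dw_zv l m
          simp only [e1, e2]; simp
      · refine ⟨(Complex.conjCLE : ℂ →L[ℝ] ℂ).comp
          ((EuclideanSpace.proj m : Cn n →L[ℂ] ℂ).restrictScalars ℝ), ?_, fun v => ?_⟩
        · rw [show evalAt (X (Sum.inr m)) = fun z : Cn n => conj (z m) from funext (evalAt_wv m)]
          exact ((Complex.conjCLE : ℂ →L[ℝ] ℂ).comp
            ((EuclideanSpace.proj m : Cn n →L[ℂ] ℂ).restrictScalars ℝ)).hasFDerivAt
        · have e1 : ∀ l, evalAt (dw l (X (Sum.inr m))) z = if l = m then 1 else 0 := fun l => by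
            rw [dw_wv]; split_ifs <;> simp
          have e2 : ∀ l, dz l (X (Sum.inr m)) = 0 := fun l => dz_wv l m
          simp only [e1, e2]; simp
    obtain ⟨D', hD', h2⟩ := hX
    refine ⟨evalAt p z • D' + evalAt (X i) z • D, ?_, fun v => ?_⟩
    · rw [show evalAt (p * X i) = fun z => evalAt p z * evalAt (X i) z from funext (evalAt_mul p _)]
      exact hD.mul hD'
    · simp only [_root_.add_apply, _root_.smul_apply, h1, h2,
        smul_eq_mul, Finset.mul_sum, ← Finset.sum_add_distrib, pderiv_mul, evalAt_add, evalAt_mul]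
      exact Finset.sum_congr rfl fun l _ => by ring

theorem fderiv_evalAt (p : CPoly n) (z v : Cn n) : fderiv ℝ (evalAt p) z v
    = ∑ l, (v l * evalAt (dz l p) z + conj (v l) * evalAt (dw l p) z) := by
  obtain ⟨D, h1, h2⟩ := hasFDerivAt_evalAt p z
  rw [h1.fderiv, h2]

theorem contDiff_evalAt (p : CPoly n) : ContDiff ℝ ∞ (evalAt p) := by
  induction p using MvPolynomial.induction_on with
  | C a =>
    have : evalAt (n := n) (C a) = fun _ => a := by funext z; simp [evalAt]
    rw [this]; exact contDiff_const
  | add p q hp hq =>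
    rw [show evalAt (p + q) = fun z => evalAt p z + evalAt q z from funext (evalAt_add p q)]
    exact hp.add hq
  | mul_X p i hp =>
    rw [show evalAt (p * X i) = fun z => evalAt p z * evalAt (X i) z from funext (evalAt_mul p _)]
    refine hp.mul ?_
    rcases i with m | m
    · rw [show evalAt (X (Sum.inl m)) = fun z : Cn n => z m from funext (evalAt_zv m)]
      exact ((EuclideanSpace.proj m : Cn n →L[ℂ] ℂ).restrictScalars ℝ).contDiff
    · rw [show evalAt (X (Sum.inr m)) = fun z : Cn n => conj (z m) from funext (evalAt_wv m)]
      exact ((Complex.conjCLE : ℂ →L[ℝ] ℂ).comp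
            ((EuclideanSpace.proj m : Cn n →L[ℂ] ℂ).restrictScalars ℝ)).contDiff

theorem continuous_evalAt (p : CPoly n) : Continuous fun z : Sph n => evalAt p (z : Cn n) :=
  (contDiff_evalAt p).continuous.comp continuous_subtype_val

theorem integral_add_sphere {f g : Sph n → ℂ} (hf : Continuous f) (hg : Continuous g) :
    ∫ z, (f z + g z) ∂(crVolume n) = ∫ z, f z ∂(crVolume n) + ∫ z, g z ∂(crVolume n) :=
  integral_add (integrable_of_continuous hf) (integrable_of_continuous hg)

theorem integral_sub_sphere {f g : Sph n → ℂ} (hf : Continuous f) (hg : Continuous g) :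
    ∫ z, (f z - g z) ∂(crVolume n) = ∫ z, f z ∂(crVolume n) - ∫ z, g z ∂(crVolume n) :=
  integral_sub (integrable_of_continuous hf) (integrable_of_continuous hg)

theorem eq_zero_of_integral_norm_sq {f : Sph n → ℂ} (hf : Continuous f)
    (h : ∫ z, ‖f z‖ ^ 2 ∂(crVolume n) = 0) : f = 0 := by
  have hc : Continuous fun z => ‖f z‖ ^ 2 := by fun_prop
  funext z
  by_contra hz
  refine (hc.integral_pos_of_hasCompactSupport_nonneg_nonzero (μ := crVolume n)
    (HasCompactSupport.of_compactSpace _) (fun z => by positivity) (x := z) ?_).ne' h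
  exact pow_ne_zero 2 (norm_ne_zero_iff.2 hz)

theorem continuous_mul_evalAt {f : Sph n → ℂ} (hf : Continuous f) (p : CPoly n) :
    Continuous fun z : Sph n => f z * evalAt p (z : Cn n) :=
  hf.mul (continuous_evalAt p)

/-! ### Rotations in coordinate planes -/

/-- The real-linear vector field `φ(z_m) e_l - ψ(z_l) e_m`. -/
def planeField (l m : Fin (n + 1)) (φ ψ : ℂ →ₗ[ℝ] ℂ) : Cn n →L[ℝ] Cn n :=
  LinearMap.toContinuousLinearMap
    { toFun := fun x => WithLp.toLp 2 fun i =>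
        (if i = l then φ (x m) else 0) - if i = m then ψ (x l) else 0
      map_add' := fun x y => by
        ext i; simp only [PiLp.add_apply, map_add]; split_ifs <;> ring
      map_smul' := fun c x => by
        ext i; simp only [PiLp.smul_apply, map_smul, RingHom.id_apply]; split_ifs <;> simp [mul_sub] }

theorem planeField_apply (l m : Fin (n + 1)) (φ ψ : ℂ →ₗ[ℝ] ℂ) (x : Cn n) (i : Fin (n + 1)) :
    planeField l m φ ψ x i = (if i = l then φ (x m) else 0) - if i = m then ψ (x l) else 0 := rfl

theorem planeField_skew (l m : Fin (n + 1)) {φ ψ : ℂ →ₗ[ℝ] ℂ}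
    (h : ∀ a b, inner ℝ (φ a) b = inner ℝ a (ψ b)) (x y : Cn n) :
    inner ℝ (planeField l m φ ψ x) y = -inner ℝ x (planeField l m φ ψ y) := by
  have h' : ∀ a b, inner ℝ (ψ a) b = inner ℝ a (φ b) := fun a b => by
    rw [real_inner_comm, ← h, real_inner_comm]
  rw [PiLp.inner_apply, PiLp.inner_apply]
  have e1 : ∀ i, inner ℝ (planeField l m φ ψ x i) (y i)
      = (if i = l then inner ℝ (φ (x m)) (y i) else 0)
        - if i = m then inner ℝ (ψ (x l)) (y i) else 0 := by
    intro i
    rw [planeField_apply, inner_sub_left]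
    congr 1 <;> split_ifs <;> simp
  have e2 : ∀ i, inner ℝ (x i) (planeField l m φ ψ y i)
      = (if i = l then inner ℝ (x i) (φ (y m)) else 0)
        - if i = m then inner ℝ (x i) (ψ (y l)) else 0 := by
    intro i
    rw [planeField_apply, inner_sub_right]
    congr 1 <;> split_ifs <;> simp
  simp only [e1, e2, Finset.sum_sub_distrib, Finset.sum_ite_eq', Finset.mem_univ, if_true]
  rw [h, h']
  ring

theorem planeField_cube {l m : Fin (n + 1)} (hlm : l ≠ m) {φ ψ : ℂ →ₗ[ℝ] ℂ}
    (h1 : ∀ a, φ (ψ a) = a) (h2 : ∀ a, ψ (φ a) = a) (x : Cn n) :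
    planeField l m φ ψ (planeField l m φ ψ (planeField l m φ ψ x)) = -planeField l m φ ψ x := by
  ext i
  simp only [planeField_apply, PiLp.neg_apply, if_true, if_neg hlm, if_neg hlm.symm, zero_sub,
    sub_zero, map_neg, h1, h2]
  split_ifs <;> simp <;> ring

theorem fderiv_evalAt_planeField (l m : Fin (n + 1)) (φ ψ : ℂ →ₗ[ℝ] ℂ) (p : CPoly n) (z : Cn n) :
    fderiv ℝ (evalAt p) z (planeField l m φ ψ z)
      = φ (z m) * evalAt (dz l p) z - ψ (z l) * evalAt (dz m p) z
        + conj (φ (z m)) * evalAt (dw l p) z - conj (ψ (z l)) * evalAt (dw m p) z := by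
  rw [fderiv_evalAt]
  have : ∀ i, (planeField l m φ ψ z i * evalAt (dz i p) z
      + conj (planeField l m φ ψ z i) * evalAt (dw i p) z)
      = (if i = l then φ (z m) * evalAt (dz i p) z + conj (φ (z m)) * evalAt (dw i p) z else 0)
      - if i = m then ψ (z l) * evalAt (dz i p) z + conj (ψ (z l)) * evalAt (dw i p) z else 0 := by
    intro i
    rw [planeField_apply]
    split_ifs <;> simp <;> ring
  simp only [this, Finset.sum_sub_distrib, Finset.sum_ite_eq', Finset.mem_univ, if_true]
  ring

/-- The complex-linear skew-adjoint field `c z_m e_l - c̄ z_l e_m`. -/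
def unitaryField (l m : Fin (n + 1)) (c : ℂ) : Cn n →L[ℝ] Cn n :=
  planeField l m ((LinearMap.mulLeft ℂ c).restrictScalars ℝ)
    ((LinearMap.mulLeft ℂ (conj c)).restrictScalars ℝ)

theorem unitaryField_apply (l m : Fin (n + 1)) (c : ℂ) (x : Cn n) (i : Fin (n + 1)) :
    unitaryField l m c x i = (if i = l then c * x m else 0) - if i = m then conj c * x l else 0 :=
  rfl

theorem unitaryField_skew (l m : Fin (n + 1)) (c : ℂ) (x y : Cn n) :
    inner ℝ (unitaryField l m c x) y = -inner ℝ x (unitaryField l m c y) := by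
  refine planeField_skew l m (fun a b => ?_) x y
  simp only [Complex.inner, LinearMap.restrictScalars_apply, LinearMap.mulLeft_apply, map_mul]
  congr 1; ring

theorem unitaryField_cube {l m : Fin (n + 1)} (hlm : l ≠ m) {c : ℂ} (hc : ‖c‖ = 1) (x : Cn n) :
    unitaryField l m c (unitaryField l m c (unitaryField l m c x)) = -unitaryField l m c x := by
  have h : c * conj c = 1 := by rw [Complex.mul_conj, Complex.normSq_eq_norm_sq, hc]; simp
  refine planeField_cube hlm (fun a => ?_) (fun a => ?_) x
  · simp only [LinearMap.restrictScalars_apply, LinearMap.mulLeft_apply]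
    rw [← mul_assoc, h, one_mul]
  · simp only [LinearMap.restrictScalars_apply, LinearMap.mulLeft_apply]
    rw [← mul_assoc, mul_comm (conj c), h, one_mul]

theorem fderiv_evalAt_unitaryField (l m : Fin (n + 1)) (c : ℂ) (p : CPoly n) (z : Cn n) :
    fderiv ℝ (evalAt p) z (unitaryField l m c z)
      = evalAt (c • rot m l p - conj c • rot l m p) z := by
  rw [unitaryField, fderiv_evalAt_planeField]
  simp only [LinearMap.restrictScalars_apply, LinearMap.mulLeft_apply, evalAt_sub, evalAt_smul,
    rot_apply, evalAt_mul, evalAt_zv, evalAt_wv, map_mul, Complex.conj_conj]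
  ring

/-- The field `i z_l e_l`, as `½ (i z_l e_l - conj i z_l e_l)`. -/
def phaseField (l : Fin (n + 1)) : Cn n →L[ℝ] Cn n := (1 / 2 : ℝ) • unitaryField l l Complex.I

theorem phaseField_apply (l : Fin (n + 1)) (x : Cn n) (i : Fin (n + 1)) :
    phaseField l x i = if i = l then Complex.I * x l else 0 := by
  rw [phaseField, _root_.smul_apply, PiLp.smul_apply, unitaryField_apply]
  split_ifs
  · simp; ring
  · simp

theorem phaseField_skew (l : Fin (n + 1)) (x y : Cn n) :
    inner ℝ (phaseField l x) y = -inner ℝ x (phaseField l y) := by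
  rw [phaseField, _root_.smul_apply, _root_.smul_apply, inner_smul_left, inner_smul_right,
    unitaryField_skew]
  simp

theorem phaseField_cube (l : Fin (n + 1)) (x : Cn n) :
    phaseField l (phaseField l (phaseField l x)) = -phaseField l x := by
  ext i
  simp only [phaseField_apply, PiLp.neg_apply, if_true]
  split_ifs
  · linear_combination (Complex.I * x l) * Complex.I_mul_I
  · simp

theorem fderiv_evalAt_phaseField (l : Fin (n + 1)) (p : CPoly n) (z : Cn n) :
    fderiv ℝ (evalAt p) z (phaseField l z) = evalAt (Complex.I • rot l l p) z := by
  rw [phaseField, _root_.smul_apply, map_smul, fderiv_evalAt_unitaryField]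
  simp only [evalAt_sub, evalAt_smul, Complex.conj_I, Complex.real_smul]
  push_cast
  ring

/-! ### The mean value over the sphere -/

/-- Integration of polynomials over the sphere. -/
def meanL (n : ℕ) : CPoly n →ₗ[ℂ] ℂ where
  toFun p := ∫ z : Sph n, evalAt p z ∂(crVolume n)
  map_add' p q := by
    simp only [evalAt_add]
    exact integral_add (integrable_of_continuous (continuous_evalAt p))
      (integrable_of_continuous (continuous_evalAt q))
  map_smul' c p := by
    simp only [evalAt_smul, RingHom.id_apply, smul_eq_mul]
    exact integral_const_mul _ _

theorem meanL_apply (p : CPoly n) : meanL n p = ∫ z : Sph n, evalAt p z ∂(crVolume n) := rfl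

/-- The total mass of `crVolume`. -/
def mass (n : ℕ) : ℝ := (crVolume n).real Set.univ

instance : Nonempty (Sph n) :=
  ⟨⟨EuclideanSpace.single 0 1, by simp⟩⟩

theorem mass_pos : 0 < mass n := by
  have h : crVolume n Set.univ ≠ 0 := isOpen_univ.measure_ne_zero _ Set.univ_nonempty
  exact ENNReal.toReal_pos h (measure_ne_top _ _)

theorem integral_const_crVolume (c : ℂ) : ∫ _ : Sph n, c ∂(crVolume n) = mass n * c := by
  rw [integral_const, Complex.real_smul, mass]

/-- Infinitesimal unitary invariance follows from invariance under the real generators of the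
unitary group. -/
theorem rotInvariant_of_generators {β : CPoly n →ₗ[ℂ] CPoly n →ₗ[ℂ] ℂ}
    (h1 : ∀ (l m : Fin (n + 1)) (c : ℂ), l ≠ m → ‖c‖ = 1 → ∀ F G, β (c • rot m l F - conj c • rot l m F) G
      = -β F (c • rot m l G - conj c • rot l m G))
    (h2 : ∀ l F G, β (Complex.I • rot l l F) G = -β F (Complex.I • rot l l G)) :
    RotInvariant β := by
  intro l m F G
  rcases eq_or_ne l m with rfl | hlm
  · have h := h2 l F G
    simp only [map_smul, LinearMap.smul_apply, smul_eq_mul] at h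
    rw [← mul_neg] at h
    exact mul_left_cancel₀ Complex.I_ne_zero h
  · have e1 := h1 l m 1 hlm (by simp) F G
    have e2 := h1 l m Complex.I hlm (by simp) F G
    simp only [map_sub, map_smul, LinearMap.smul_apply, LinearMap.sub_apply, smul_eq_mul,
      Complex.conj_I, map_one] at e1 e2
    have e3 : Complex.I * ((β (rot m l F)) G + (β (rot l m F)) G
        + ((β F) (rot m l G) + (β F) (rot l m G))) = 0 := by linear_combination e2
    have e4 := (mul_eq_zero.1 e3).resolve_left Complex.I_ne_zero
    linear_combination (e4 - e1) / 2

theorem isSphereMean_meanL : IsSphereMean (meanL n) where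
  map_rot := by
    have key : ∀ (V : Cn n →L[ℝ] Cn n), (∀ x y, inner ℝ (V x) y = -inner ℝ x (V y)) →
        (∀ x, V (V (V x)) = -V x) → ∀ p q, (∀ z, fderiv ℝ (evalAt p) z (V z) = evalAt q z) →
        meanL n q = 0 := by
      intro V h1 h2 p q hq
      have := integral_fderiv_skew h1 h2 (g := evalAt p)
        fun z => ((contDiff_evalAt p).of_le (by simp)).contDiffAt
      rw [meanL_apply, ← this]
      simp only [hq]
    intro l m p
    rcases eq_or_ne l m with rfl | hlm
    · have h := key _ (phaseField_skew l) (phaseField_cube l) p _ (fderiv_evalAt_phaseField l p)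
      rw [map_smul, smul_eq_mul] at h
      exact (mul_eq_zero.1 h).resolve_left Complex.I_ne_zero
    · have e1 := key _ (unitaryField_skew l m 1) (unitaryField_cube hlm (by simp)) p _
        (fderiv_evalAt_unitaryField l m 1 p)
      have e2 := key _ (unitaryField_skew l m Complex.I) (unitaryField_cube hlm (by simp)) p _
        (fderiv_evalAt_unitaryField l m Complex.I p)
      simp only [map_sub, map_smul, smul_eq_mul, Complex.conj_I, map_one] at e1 e2
      have e3 : Complex.I * (meanL n (rot m l p) + meanL n (rot l m p)) = 0 := by
        linear_combination e2
      have e4 := (mul_eq_zero.1 e3).resolve_left Complex.I_ne_zero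
      linear_combination (e4 - e1) / 2
  map_rho p := by
    rw [meanL_apply, meanL_apply]
    simp only [evalAt_mul, evalAt_rho_sphere, one_mul]
  map_one_ne_zero := by
    rw [meanL_apply]
    simp only [evalAt_one]
    rw [integral_const_crVolume, mul_one]
    exact_mod_cast mass_pos.ne'

/-! ### Density of polynomials -/

/-- Polynomials are uniformly dense in the continuous functions on the sphere. -/
theorem exists_evalAt_near {f : Sph n → ℂ} (hf : Continuous f) {ε : ℝ} (hε : 0 < ε) :
    ∃ p : CPoly n, ∀ z : Sph n, ‖f z - evalAt p z‖ < ε := by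
  let A : StarSubalgebra ℂ C(Sph n, ℂ) :=
    { carrier := Set.range fun p : CPoly n => (⟨fun z => evalAt p z, continuous_evalAt p⟩ : C(Sph n, ℂ))
      mul_mem' := by
        rintro _ _ ⟨p, rfl⟩ ⟨q, rfl⟩
        exact ⟨p * q, by ext z; exact evalAt_mul p q z⟩
      add_mem' := by
        rintro _ _ ⟨p, rfl⟩ ⟨q, rfl⟩
        exact ⟨p + q, by ext z; exact evalAt_add p q z⟩
      algebraMap_mem' := fun c => ⟨C c, by ext z; simp [evalAt, Algebra.algebraMap_eq_smul_one]⟩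
      star_mem' := by
        rintro _ ⟨p, rfl⟩
        exact ⟨conjPoly p, by ext z; exact evalAt_conjPoly p z⟩ }
  have hA : A.topologicalClosure = ⊤ := by
    apply ContinuousMap.starSubalgebra_topologicalClosure_eq_top_of_separatesPoints
    intro z y hzy
    have : ∃ l, (z : Cn n) l ≠ (y : Cn n) l := by
      by_contra! h
      exact hzy (Subtype.ext (by ext l; exact h l))
    obtain ⟨l, hl⟩ := this
    exact ⟨fun z => evalAt (zv l) z, ⟨_, ⟨zv l, rfl⟩, rfl⟩, by simpa using hl⟩
  have hmem : (⟨f, hf⟩ : C(Sph n, ℂ)) ∈ closure (A : Set C(Sph n, ℂ)) := by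
    have : (⟨f, hf⟩ : C(Sph n, ℂ)) ∈ A.topologicalClosure := by rw [hA]; trivial
    exact this
  obtain ⟨_, ⟨p, rfl⟩, hp⟩ := Metric.mem_closure_iff.1 hmem ε hε
  refine ⟨p, fun z => ?_⟩
  have := (ContinuousMap.dist_lt_iff hε).1 hp z
  simpa [dist_eq_norm] using this

/-- A continuous function that is orthogonal to all polynomials vanishes. -/
theorem eq_zero_of_integral_mul_evalAt {f : Sph n → ℂ} (hf : Continuous f)
    (h : ∀ p : CPoly n, ∫ z : Sph n, f z * evalAt p z ∂(crVolume n) = 0) : f = 0 := by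
  have hI : ∫ z, ‖f z‖ ^ 2 ∂(crVolume n) = 0 := by
    obtain ⟨M, hM⟩ := (isCompact_range hf).isBounded.exists_norm_le
    have hM' : ∀ z, ‖f z‖ ≤ M := fun z => hM _ ⟨z, rfl⟩
    have hb : ∀ ε > 0, ‖∫ z, f z * conj (f z) ∂(crVolume n)‖ ≤ ε * (M * mass n) := by
      intro ε hε
      obtain ⟨p, hp⟩ := exists_evalAt_near (f := fun z => conj (f z)) (by fun_prop) hε
      have hc : Continuous fun z => conj (f z) := by fun_prop
      have : ∫ z, f z * conj (f z) ∂(crVolume n)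
          = ∫ z, f z * (conj (f z) - evalAt p z) ∂(crVolume n) := by
        simp only [mul_sub]
        rw [integral_sub_sphere (f := fun z => f z * conj (f z)) (hf.mul hc)
          (continuous_mul_evalAt hf p), h p, sub_zero]
      rw [this]
      have h2 := norm_integral_le_of_norm_le_const (μ := crVolume n)
        (f := fun z => f z * (conj (f z) - evalAt p z)) (C := M * ε)
        (Filter.Eventually.of_forall fun z => by
          rw [norm_mul]
          exact mul_le_mul (hM' z) (hp z).le (norm_nonneg _) ((norm_nonneg _).trans (hM' z)))
      calc _ ≤ _ := h2
        _ = _ := by rw [mass]; ring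
    have h0 : ∫ z, f z * conj (f z) ∂(crVolume n) = 0 := by
      rw [← norm_le_zero_iff]
      refine le_of_forall_pos_le_add fun δ hδ => ?_
      have hpos : 0 < |M * mass n| + 1 := by positivity
      refine (hb (δ / (|M * mass n| + 1)) (by positivity)).trans ?_
      rw [zero_add, div_mul_eq_mul_div, div_le_iff₀ hpos]
      nlinarith [le_abs_self (M * mass n)]
    have : ∀ z, f z * conj (f z) = ((‖f z‖ ^ 2 : ℝ) : ℂ) := fun z => by
      rw [Complex.mul_conj, Complex.normSq_eq_norm_sq]
    simp only [this, integral_complex_ofReal] at h0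
    exact_mod_cast h0
  exact eq_zero_of_integral_norm_sq hf hI

/-- A continuous function that is orthogonal to all spherical harmonics vanishes. -/
theorem eq_zero_of_integral_mul_harm (hn : 1 ≤ n) {f : Sph n → ℂ} (hf : Continuous f)
    (h : ∀ j k, ∀ p ∈ harm n j k, ∫ z : Sph n, f z * evalAt p z ∂(crVolume n) = 0) : f = 0 := by
  refine eq_zero_of_integral_mul_evalAt hf fun p => ?_
  obtain ⟨q, hq, r, rfl⟩ := exists_harmonic_decomposition hn p
  have hev : ∀ z : Sph n, evalAt (q + (rho n - 1) * r) (z : Cn n) = evalAt q z := fun z => by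
    rw [evalAt_add, evalAt_mul, evalAt_sub, evalAt_rho_sphere, evalAt_one, sub_self, zero_mul,
      add_zero]
  simp only [hev]
  clear hev
  induction hq using Submodule.span_induction with
  | mem q hq =>
    simp only [Set.mem_iUnion] at hq
    obtain ⟨j, k, hq⟩ := hq
    exact h j k q hq
  | zero => simp
  | add p q _ _ hp hq =>
    simp only [evalAt_add, mul_add]
    rw [integral_add_sphere (continuous_mul_evalAt hf p) (continuous_mul_evalAt hf q), hp, hq,
      add_zero]
  | smul c q _ hq =>
    simp only [evalAt_smul, mul_left_comm _ c]
    rw [integral_const_mul, hq, mul_zero]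

/-! ### The boosts of the ball, with complex parameter -/

theorem one_add_mul_re_pos {s x : ℂ} (hs : ‖s‖ < 1) (hx : ‖x‖ ≤ 1) : 0 < (1 + s * x).re := by
  have h1 : |(s * x).re| ≤ ‖s * x‖ := Complex.abs_re_le_norm _
  have h2 : ‖s * x‖ < 1 := by
    rw [norm_mul]
    calc ‖s‖ * ‖x‖ ≤ ‖s‖ * 1 := by gcongr
      _ < 1 := by linarith
  have h3 := neg_abs_le (s * x).re
  simp only [Complex.add_re, Complex.one_re]
  linarith

theorem one_sub_sq_re_pos {s : ℂ} (hs : ‖s‖ < 1) : 0 < (1 - s ^ 2).re := by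
  have := one_add_mul_re_pos (x := -s) hs (by simpa using hs.le)
  rwa [show 1 + s * -s = 1 - s ^ 2 by ring] at this

theorem ne_zero_of_re_pos {x : ℂ} (h : 0 < x.re) : x ≠ 0 := by
  rintro rfl; simp at h

/-- A branch of `√(1 - s²)`. -/
def boostFactor (s : ℂ) : ℂ := Complex.exp (Complex.log (1 - s ^ 2) / 2)

theorem boostFactor_sq {s : ℂ} (hs : ‖s‖ < 1) : boostFactor s ^ 2 = 1 - s ^ 2 := by
  rw [boostFactor, ← Complex.exp_nat_mul, Nat.cast_ofNat, mul_div_cancel₀ _ two_ne_zero,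
    Complex.exp_log (ne_zero_of_re_pos (one_sub_sq_re_pos hs))]

/-- The logarithm of the conformal factor `√(1 - s²) / (1 + s x)` of a boost. -/
def logJ (s x : ℂ) : ℂ := Complex.log (1 - s ^ 2) / 2 - Complex.log (1 + s * x)

/-- The weight `J^a J̄^b` of a boost; the conjugate is replaced by a holomorphic expression in
`s`. -/
def boostWeight (a b : ℂ) (s x : ℂ) : ℂ := Complex.exp (a * logJ s x + b * logJ s (conj x))

/-- The coordinates of the image of `z` under the boost of parameter `s` in the direction `e_l`,
as functions of the coordinates `ζ` of `z`. -/
def boostCoord (l : Fin (n + 1)) (s : ℂ) (ζ : Fin (n + 1) → ℂ) (m : Fin (n + 1)) : ℂ :=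
  if m = l then (ζ l + s) / (1 + s * ζ l) else boostFactor s * ζ m / (1 + s * ζ l)

/-- The coordinates of the image of `z` under a boost and their conjugates, the latter again
replaced by holomorphic expressions in `s`. -/
def boostPoint (l : Fin (n + 1)) (s : ℂ) (z : Cn n) : Fin (n + 1) ⊕ Fin (n + 1) → ℂ :=
  Sum.elim (boostCoord l s fun m => z m) (boostCoord l s fun m => conj (z m))

/-- The function `J^a J̄^b (p ∘ B_s)` for a boost `B_s`, continued analytically in `s`. -/
def boostPoly (a b : ℂ) (l : Fin (n + 1)) (p : CPoly n) (s : ℂ) (z : Cn n) : ℂ :=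
  boostWeight a b s (z l) * eval (boostPoint l s z) p

theorem boostFactor_zero : boostFactor 0 = 1 := by simp [boostFactor]

theorem boostPoly_zero (a b : ℂ) (l : Fin (n + 1)) (p : CPoly n) (z : Cn n) :
    boostPoly a b l p 0 z = evalAt p z := by
  have h : ∀ ζ : Fin (n + 1) → ℂ, boostCoord l 0 ζ = ζ := fun ζ => by
    funext m
    rw [boostCoord, boostFactor_zero]
    split_ifs with hm
    · subst hm; simp
    · simp
  rw [boostPoly, boostPoint, h, h, evalAt]
  simp [boostWeight, logJ]

theorem boostPoly_add (a b : ℂ) (l : Fin (n + 1)) (p q : CPoly n) (s : ℂ) (z : Cn n) :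
    boostPoly a b l (p + q) s z = boostPoly a b l p s z + boostPoly a b l q s z := by
  simp only [boostPoly, map_add, mul_add]

theorem boostPoly_smul (a b : ℂ) (l : Fin (n + 1)) (c : ℂ) (p : CPoly n) (s : ℂ) (z : Cn n) :
    boostPoly a b l (c • p) s z = c * boostPoly a b l p s z := by
  simp only [boostPoly, smul_eval]; ring

theorem boost_sphere_identity {s x y : ℂ} (hx : 1 + s * x ≠ 0) (hy : 1 + s * y ≠ 0) :
    (x + s) / (1 + s * x) * ((y + s) / (1 + s * y))
      + (1 - s ^ 2) / ((1 + s * x) * (1 + s * y)) * (1 - x * y) = 1 := by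
  rw [div_mul_div_comm, div_mul_eq_mul_div, ← add_div, div_eq_one_iff_eq (mul_ne_zero hx hy)]
  ring

/-- The analytically continued boosts preserve the complexified sphere. -/
theorem eval_boostPoint_rho (l : Fin (n + 1)) {s : ℂ} (hs : ‖s‖ < 1) (z : Sph n) :
    eval (boostPoint l s z) (rho n) = 1 := by
  have hz : ‖(z : Cn n) l‖ ≤ 1 := by
    have := PiLp.norm_apply_le (z : Cn n) l
    rwa [mem_sphere_zero_iff_norm.1 z.2] at this
  have h1 := ne_zero_of_re_pos (one_add_mul_re_pos hs hz)
  have h2 := ne_zero_of_re_pos (one_add_mul_re_pos hs (x := conj ((z : Cn n) l)) (by simpa using hz))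
  have h3 := boostFactor_sq hs
  have hsum := sum_mul_conj_sphere z
  rw [← Finset.add_sum_erase _ _ (Finset.mem_univ l)] at hsum
  simp only [rho, map_sum, map_mul, eval_X, boostPoint, Sum.elim_inl, Sum.elim_inr]
  rw [← Finset.add_sum_erase _ _ (Finset.mem_univ l)]
  have h4 : ∀ m ∈ Finset.univ.erase l, boostCoord l s (fun m => (z : Cn n) m) m
      * boostCoord l s (fun m => conj ((z : Cn n) m)) m
      = (1 - s ^ 2) / ((1 + s * (z : Cn n) l) * (1 + s * conj ((z : Cn n) l)))
        * ((z : Cn n) m * conj ((z : Cn n) m)) := by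
    intro m hm
    have hml := (Finset.mem_erase.1 hm).1
    rw [boostCoord, boostCoord, if_neg hml, if_neg hml, ← h3]
    field_simp
  rw [Finset.sum_congr rfl h4, ← Finset.mul_sum, ← sub_eq_iff_eq_add'.2 hsum.symm]
  simp only [boostCoord, if_true]
  exact boost_sphere_identity h1 h2

theorem boostPoly_one_sub_rho_mul (a b : ℂ) (l : Fin (n + 1)) (p : CPoly n) {s : ℂ} (hs : ‖s‖ < 1)
    (z : Sph n) : boostPoly a b l ((1 - rho n) * p) s z = 0 := by
  rw [boostPoly, map_mul, map_sub, eval_boostPoint_rho l hs z]; simp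

theorem norm_coord_le (z : Sph n) (l : Fin (n + 1)) : ‖(z : Cn n) l‖ ≤ 1 := by
  have := PiLp.norm_apply_le (z : Cn n) l
  rwa [mem_sphere_zero_iff_norm.1 z.2] at this

theorem norm_conj_coord_le (z : Sph n) (l : Fin (n + 1)) : ‖conj ((z : Cn n) l)‖ ≤ 1 := by
  rw [RCLike.norm_conj]; exact norm_coord_le z l

theorem hasDerivAt_boostFactor {s : ℂ} (hs : ‖s‖ < 1) :
    HasDerivAt boostFactor (boostFactor s * (-s / (1 - s ^ 2))) s := by
  have h1 := one_sub_sq_re_pos hs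
  have h : HasDerivAt (fun s : ℂ => 1 - s ^ 2) (-(2 * s)) s := by
    simpa using (hasDerivAt_pow 2 s).const_sub 1
  have h2 := ((h.clog (Or.inl h1)).div_const 2).cexp
  refine h2.congr_deriv ?_
  rw [boostFactor]
  ring

theorem hasDerivAt_logJ {s x : ℂ} (hs : ‖s‖ < 1) (hx : ‖x‖ ≤ 1) :
    HasDerivAt (fun s => logJ s x) (-((x + s) / (1 + s * x)) / (1 - s ^ 2)) s := by
  have h1 := one_sub_sq_re_pos hs
  have h2 := one_add_mul_re_pos hs hx
  have h : HasDerivAt (fun s : ℂ => 1 - s ^ 2) (-(2 * s)) s := by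
    simpa using (hasDerivAt_pow 2 s).const_sub 1
  have h' : HasDerivAt (fun s : ℂ => 1 + s * x) x s := by
    simpa using ((hasDerivAt_id s).mul_const x).const_add 1
  refine (((h.clog (Or.inl h1)).div_const 2).sub (h'.clog (Or.inl h2))).congr_deriv ?_
  have h3 := ne_zero_of_re_pos h1
  have h4 := ne_zero_of_re_pos h2
  field_simp
  ring

/-- The velocity of a boost: `e_l - u_l u` at the point `u`. -/
theorem hasDerivAt_boostCoord (l : Fin (n + 1)) {s : ℂ} {ζ : Fin (n + 1) → ℂ} (hs : ‖s‖ < 1)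
    (hζ : ‖ζ l‖ ≤ 1) (m : Fin (n + 1)) :
    HasDerivAt (fun s => boostCoord l s ζ m)
      (((if m = l then 1 else 0) - boostCoord l s ζ l * boostCoord l s ζ m) / (1 - s ^ 2)) s := by
  have h1 := ne_zero_of_re_pos (one_sub_sq_re_pos hs)
  have h2 := ne_zero_of_re_pos (one_add_mul_re_pos hs hζ)
  have h' : HasDerivAt (fun s : ℂ => 1 + s * ζ l) (ζ l) s := by
    simpa using ((hasDerivAt_id s).mul_const (ζ l)).const_add 1
  simp only [boostCoord, if_true]
  split_ifs with hm
  · refine (((hasDerivAt_id s).const_add (ζ l)).div h' h2).congr_deriv ?_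
    simp only [id]
    field_simp
    ring
  · refine (((hasDerivAt_boostFactor hs).mul_const (ζ m)).div h' h2).congr_deriv ?_
    field_simp
    ring

theorem hasDerivAt_eval {σ : Type*} [Fintype σ] (p : MvPolynomial σ ℂ) {γ : ℂ → σ → ℂ}
    {γ' : σ → ℂ} {s : ℂ} (h : ∀ i, HasDerivAt (fun s => γ s i) (γ' i) s) :
    HasDerivAt (fun s => eval (γ s) p) (∑ i, γ' i * eval (γ s) (pderiv i p)) s := by
  induction p using MvPolynomial.induction_on with
  | C a => simpa using hasDerivAt_const s a
  | add p q hp hq =>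
    simp only [map_add, mul_add, Finset.sum_add_distrib]
    exact hp.add hq
  | mul_X p j hp =>
    simp only [map_mul, eval_X]
    refine (hp.mul (h j)).congr_deriv ?_
    classical
    have : ∀ i, γ' i * eval (γ s) (pderiv i (p * X j)) = γ' i * eval (γ s) (pderiv i p) * γ s j
        + if i = j then eval (γ s) p * γ' i else 0 := by
      intro i
      rw [pderiv_mul, map_add, map_mul, map_mul, eval_X, pderiv_X, Pi.single_apply]
      split_ifs with h1 h2 h2
      · simp; ring
      · exact absurd h1.symm h2
      · exact absurd h2.symm h1
      · simp; ring
    simp only [this, Finset.sum_add_distrib, Finset.sum_mul, Finset.sum_ite_eq', Finset.mem_univ,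
      if_true]

/-- Differentiating the action of a boost in its parameter gives the action of the infinitesimal
boost. -/
theorem hasDerivAt_boostPoly (a b : ℂ) (l : Fin (n + 1)) (p : CPoly n) {s : ℂ} (hs : ‖s‖ < 1)
    (z : Sph n) : HasDerivAt (fun s => boostPoly a b l p s z)
      (boostPoly a b l (boostField a b l p) s z / (1 - s ^ 2)) s := by
  have hz := norm_coord_le z l
  have hz' := norm_conj_coord_le z l
  have h1 : HasDerivAt (fun s => boostWeight a b s ((z : Cn n) l)) _ s :=
    (((hasDerivAt_logJ hs hz).const_mul a).add ((hasDerivAt_logJ hs hz').const_mul b)).cexp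
  have h2 : HasDerivAt (fun s => eval (boostPoint l s z) p) _ s := hasDerivAt_eval p
    (γ' := Sum.elim
      (fun m => ((if m = l then 1 else 0) - boostPoint l s z (Sum.inl l) * boostPoint l s z (Sum.inl m))
        / (1 - s ^ 2))
      (fun m => ((if m = l then 1 else 0) - boostPoint l s z (Sum.inr l) * boostPoint l s z (Sum.inr m))
        / (1 - s ^ 2))) (by
      rintro (m | m)
      · exact hasDerivAt_boostCoord l hs hz m
      · exact hasDerivAt_boostCoord l hs (ζ := fun m => conj ((z : Cn n) m)) hz' m)
  refine (h1.mul h2).congr_deriv ?_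
  have e1 : ((z : Cn n) l + s) / (1 + s * (z : Cn n) l) = boostPoint l s z (Sum.inl l) := by
    simp [boostPoint, boostCoord]
  have e2 : (conj ((z : Cn n) l) + s) / (1 + s * conj ((z : Cn n) l))
      = boostPoint l s z (Sum.inr l) := by
    simp [boostPoint, boostCoord]
  have e3 : Complex.exp (a * logJ s ((z : Cn n) l) + b * logJ s (conj ((z : Cn n) l)))
    = boostWeight a b s ((z : Cn n) l) := rfl
  simp only [Pi.add_apply]
  rw [e1, e2, e3]
  simp only [boostPoly, boostField, map_add, map_sub, map_mul, eval_X, smul_eval, eulerZ_apply,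
    eulerW_apply, map_sum, Fintype.sum_sum_type, Sum.elim_inl, Sum.elim_inr, sub_div, sub_mul,
    Finset.sum_sub_distrib, ite_div, zero_div, ite_mul, zero_mul, Finset.sum_ite_eq',
    Finset.mem_univ, if_true]
  have e4 : ∀ f g : Fin (n + 1) → ℂ, ∀ c : ℂ, ∑ m, c * f m / (1 - s ^ 2) * g m
      = c / (1 - s ^ 2) * ∑ m, f m * g m := by
    intro f g c
    rw [Finset.mul_sum]; exact Finset.sum_congr rfl fun m _ => by ring
  rw [e4, e4]
  ring

theorem continuousOn_boostCoord (l m : Fin (n + 1)) {f : ℂ × Sph n → Fin (n + 1) → ℂ}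
    (hf : Continuous f) (hf1 : ∀ p, ‖f p l‖ ≤ 1) :
    ContinuousOn (fun p : ℂ × Sph n => boostCoord l p.1 (f p) m)
      (Metric.ball 0 1 ×ˢ Set.univ) := by
  have hf' : ∀ m, Continuous fun p => f p m := fun m => (continuous_apply m).comp hf
  have hd : ∀ p ∈ (Metric.ball 0 1 ×ˢ Set.univ : Set (ℂ × Sph n)), 1 + p.1 * f p l ≠ 0 :=
    fun p hp => ne_zero_of_re_pos (one_add_mul_re_pos (by simpa using hp.1) (hf1 p))
  have hfac : ContinuousOn (fun p : ℂ × Sph n => boostFactor p.1) (Metric.ball 0 1 ×ˢ Set.univ) := by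
    have : ContinuousOn boostFactor (Metric.ball 0 1) := fun s hs =>
      (hasDerivAt_boostFactor (by simpa using hs)).continuousAt.continuousWithinAt
    exact this.comp continuousOn_fst fun p hp => hp.1
  have hden : Continuous fun p : ℂ × Sph n => 1 + p.1 * f p l :=
    continuous_const.add (continuous_fst.mul (hf' l))
  simp only [boostCoord]
  split_ifs
  · exact ((hf' l).add continuous_fst).continuousOn.div hden.continuousOn hd
  · exact (hfac.mul (hf' m).continuousOn).div hden.continuousOn hd

theorem continuousOn_logJ {f : ℂ × Sph n → ℂ}
    (hf : Continuous f) (hf1 : ∀ p, ‖f p‖ ≤ 1) :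
    ContinuousOn (fun p : ℂ × Sph n => logJ p.1 (f p)) (Metric.ball 0 1 ×ˢ Set.univ) := by
  simp only [logJ]
  refine ContinuousOn.sub (ContinuousOn.div_const (ContinuousOn.clog (by fun_prop) ?_) _)
    (ContinuousOn.clog (by fun_prop) ?_)
  · exact fun p hp => Or.inl (one_sub_sq_re_pos (by simpa using hp.1))
  · exact fun p hp => Or.inl (one_add_mul_re_pos (by simpa using hp.1) (hf1 p))

theorem continuousOn_boostPoly (a b : ℂ) (l : Fin (n + 1)) (p : CPoly n) :
    ContinuousOn (fun q : ℂ × Sph n => boostPoly a b l p q.1 (q.2 : Cn n))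
      (Metric.ball 0 1 ×ˢ Set.univ) := by
  have c1 : Continuous fun q : ℂ × Sph n => fun m => (q.2 : Cn n) m := by fun_prop
  have c2 : Continuous fun q : ℂ × Sph n => fun m => conj ((q.2 : Cn n) m) := by fun_prop
  refine ContinuousOn.mul ?_ ?_
  · simp only [boostWeight]
    refine ContinuousOn.cexp (ContinuousOn.add ?_ ?_)
    · exact continuousOn_const.mul
        (continuousOn_logJ ((continuous_apply l).comp c1) fun q => norm_coord_le q.2 l)
    · exact continuousOn_const.mul
        (continuousOn_logJ ((continuous_apply l).comp c2) fun q => norm_conj_coord_le q.2 l)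
  · refine (MvPolynomial.continuous_eval p).comp_continuousOn (continuousOn_pi.2 ?_)
    rintro (m | m)
    · exact continuousOn_boostCoord l m c1 fun q => norm_coord_le _ _
    · exact continuousOn_boostCoord l m c2 fun q => norm_conj_coord_le _ _

/-- The pairing of `J^a J̄^b (p ∘ B_s)` with a continuous function `h`, continued analytically
in `s`. -/
def boostPairing (a b : ℂ) (l : Fin (n + 1)) (h : Sph n → ℂ) (p : CPoly n) (s : ℂ) : ℂ :=
  ∫ z : Sph n, boostPoly a b l p s z * h z ∂(crVolume n)

theorem continuous_boostPoly (a b : ℂ) (l : Fin (n + 1)) (p : CPoly n) {s : ℂ} (hs : ‖s‖ < 1) :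
    Continuous fun z : Sph n => boostPoly a b l p s (z : Cn n) := by
  rw [← continuousOn_univ]
  exact (continuousOn_boostPoly a b l p).comp (f := fun z : Sph n => (s, z))
    (by fun_prop : Continuous fun z : Sph n => (s, z)).continuousOn
    fun z _ => ⟨by simpa using hs, trivial⟩

theorem hasDerivAt_boostPairing (a b : ℂ) (l : Fin (n + 1)) {h : Sph n → ℂ} (hh : Continuous h)
    (p : CPoly n) {s : ℂ} (hs : ‖s‖ < 1) :
    HasDerivAt (boostPairing a b l h p)
      (boostPairing a b l h (boostField a b l p) s / (1 - s ^ 2)) s := by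
  have key := hasDerivAt_integral_sphere (n := n) (𝕜 := ℂ) (Metric.isOpen_ball (x := 0) (ε := 1))
    (F := fun s z => boostPoly a b l p s z * h z)
    (F' := fun s z => boostPoly a b l (boostField a b l p) s z / (1 - s ^ 2) * h z)
    (fun s hs => (continuous_boostPoly a b l p (by simpa using hs)).mul hh)
    (((continuousOn_boostPoly a b l _).div (by fun_prop) fun q hq =>
      ne_zero_of_re_pos (one_sub_sq_re_pos (by simpa using hq.1))).mul
        (hh.comp continuous_snd).continuousOn)
    (fun s hs z => (hasDerivAt_boostPoly a b l p (by simpa using hs) z).mul_const _)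
    (s := s) (by simpa using hs)
  refine key.congr_deriv ?_
  rw [boostPairing, div_eq_mul_inv, mul_comm, ← integral_const_mul]
  congr 1; funext z; ring

theorem boostPairing_add (a b : ℂ) (l : Fin (n + 1)) {h : Sph n → ℂ} (hh : Continuous h)
    (p q : CPoly n) {s : ℂ} (hs : ‖s‖ < 1) : boostPairing a b l h (p + q) s
      = boostPairing a b l h p s + boostPairing a b l h q s := by
  simp only [boostPairing, boostPoly_add, add_mul]
  exact integral_add_sphere ((continuous_boostPoly a b l p hs).mul hh)
    ((continuous_boostPoly a b l q hs).mul hh)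

theorem boostPairing_smul (a b : ℂ) (l : Fin (n + 1)) (h : Sph n → ℂ) (c : ℂ) (p : CPoly n)
    (s : ℂ) : boostPairing a b l h (c • p) s = c * boostPairing a b l h p s := by
  simp only [boostPairing, boostPoly_smul, mul_assoc]
  exact integral_const_mul _ _

theorem boostPairing_sub (a b : ℂ) (l : Fin (n + 1)) {h : Sph n → ℂ} (hh : Continuous h)
    (p q : CPoly n) {s : ℂ} (hs : ‖s‖ < 1) : boostPairing a b l h (p - q) s
      = boostPairing a b l h p s - boostPairing a b l h q s := by
  rw [sub_eq_add_neg, ← neg_one_smul ℂ q, boostPairing_add a b l hh _ _ hs, boostPairing_smul]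
  ring

theorem boostPairing_one_sub_rho_mul (a b : ℂ) (l : Fin (n + 1)) (h : Sph n → ℂ) (p : CPoly n)
    {s : ℂ} (hs : ‖s‖ < 1) : boostPairing a b l h ((1 - rho n) * p) s = 0 := by
  simp [boostPairing, boostPoly_one_sub_rho_mul a b l p hs]

theorem boostPairing_zero (a b : ℂ) (l : Fin (n + 1)) (h : Sph n → ℂ) (p : CPoly n) :
    boostPairing a b l h p 0 = ∫ z : Sph n, evalAt p z * h z ∂(crVolume n) := by
  simp only [boostPairing, boostPoly_zero]

/-- A uniqueness theorem for a system `(1 - s²) D' = D₁` of possibly infinitely many equations: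
holomorphic functions vanishing at `0` whose derivatives are again of this kind vanish to
infinite order at `0`. -/
theorem eq_zero_of_deriv_mem_span {G : Set (ℂ → ℂ)} (h0 : ∀ D ∈ G, D 0 = 0)
    (hd : ∀ D ∈ G, ∃ D₁ ∈ Submodule.span ℂ G, ∀ s : ℂ, ‖s‖ < 1 →
      HasDerivAt D (D₁ s / (1 - s ^ 2)) s) {D : ℂ → ℂ} (hD : D ∈ G) {s : ℂ} (hs : ‖s‖ < 1) :
    D s = 0 := by
  have key : ∀ D ∈ Submodule.span ℂ G, D 0 = 0 ∧ ∃ D₁ ∈ Submodule.span ℂ G, ∀ s : ℂ, ‖s‖ < 1 →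
      HasDerivAt D (D₁ s / (1 - s ^ 2)) s := by
    intro D hD
    induction hD using Submodule.span_induction with
    | mem D hD => exact ⟨h0 D hD, hd D hD⟩
    | zero => exact ⟨rfl, 0, zero_mem _, fun s _ => by
      rw [Pi.zero_apply, zero_div]; exact hasDerivAt_const s (0 : ℂ)⟩
    | add D E _ _ hD hE =>
      obtain ⟨d0, D₁, hD₁, d1⟩ := hD
      obtain ⟨e0, E₁, hE₁, e1⟩ := hE
      exact ⟨by simp [d0, e0], D₁ + E₁, add_mem hD₁ hE₁, fun s hs => by
        simpa [add_div] using (d1 s hs).add (e1 s hs)⟩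
    | smul c D _ hD =>
      obtain ⟨d0, D₁, hD₁, d1⟩ := hD
      exact ⟨by simp [d0], c • D₁, Submodule.smul_mem _ _ hD₁, fun s hs => by
        have := (d1 s hs).const_mul c
        rw [← mul_div_assoc] at this
        exact this⟩
  have han : ∀ D ∈ Submodule.span ℂ G, AnalyticOnNhd ℂ D (Metric.ball 0 1) := by
    intro D hD
    obtain ⟨-, D₁, -, h1⟩ := key D hD
    refine DifferentiableOn.analyticOnNhd (fun s hs => ?_) Metric.isOpen_ball
    exact (h1 s (by simpa using hs)).differentiableAt.differentiableWithinAt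
  have hord : ∀ m : ℕ, ∀ D ∈ Submodule.span ℂ G, (m : ℕ∞) ≤ analyticOrderAt D 0 := by
    intro m
    induction m with
    | zero => intro D _; simp
    | succ m ih =>
      intro D hD
      obtain ⟨d0, D₁, hD₁, h1⟩ := key D hD
      have hA := han D hD 0 (by simp)
      have h2 := hA.analyticOrderAt_deriv_add_one
      simp only [d0, sub_zero] at h2
      rw [← h2]
      have hev : deriv D =ᶠ[nhds 0] fun s => (1 - s ^ 2)⁻¹ * D₁ s := by
        filter_upwards [Metric.ball_mem_nhds (0 : ℂ) one_pos] with s hs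
        rw [(h1 s (by simpa using hs)).deriv, div_eq_inv_mul]
      rw [analyticOrderAt_congr hev]
      have hu : AnalyticAt ℂ (fun s : ℂ => (1 - s ^ 2)⁻¹) 0 := by
        refine AnalyticAt.inv ?_ (by simp)
        fun_prop
      have h3 := analyticOrderAt_mul hu (han D₁ hD₁ 0 (by simp))
      have h4 : analyticOrderAt (fun s : ℂ => (1 - s ^ 2)⁻¹ * D₁ s) 0
        = analyticOrderAt (fun s : ℂ => (1 - s ^ 2)⁻¹) 0 + analyticOrderAt D₁ 0 := h3
      rw [h4]
      push_cast
      gcongr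
      exact (ih D₁ hD₁).trans le_add_self
  have hD' := Submodule.subset_span (R := ℂ) hD
  have htop : analyticOrderAt D 0 = ⊤ := by
    rw [ENat.eq_top_iff_forall_ge]
    exact fun m => hord m D hD'
  exact (han D hD').eqOn_zero_of_preconnected_of_eventuallyEq_zero
    (convex_ball 0 1).isPreconnected (by simp) (analyticOrderAt_eq_top.1 htop) (by simpa using hs)

/-- Diagonal operators whose eigenvalues satisfy the two recursions intertwine the actions of
weights `(a, b)` and `(n + 1 - b, n + 1 - a)`, on the level of matrix coefficients. -/
theorem mul_boostPairing_eq (hn : 1 ≤ n) (a b : ℂ) (l : Fin (n + 1)) {μ : ℕ → ℕ → ℂ}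
    (h1 : ∀ j k : ℕ, (a + j) * μ (j + 1) k = (n + 1 - b + j) * μ j k)
    (h2 : ∀ j k : ℕ, (b + k) * μ j (k + 1) = (n + 1 - a + k) * μ j k) {j k j' k' : ℕ}
    {p q : CPoly n} (hp : p ∈ harm n j k) (hq : q ∈ harm n k' j') {s : ℂ} (hs : ‖s‖ < 1) :
    μ j' k' * boostPairing a b l (fun z => evalAt q z) p s
      = μ j k * boostPairing (n + 1 - b) (n + 1 - a) l (fun z => evalAt q z) p s := by
  set h : Sph n → ℂ := fun z => evalAt q z with hh
  have hc : Continuous h := continuous_evalAt q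
  set Φ : ℕ → ℕ → CPoly n → ℂ → ℂ := fun j k p s => μ j' k' * boostPairing a b l h p s
    - μ j k * boostPairing (n + 1 - b) (n + 1 - a) l h p s with hΦ
  set G : Set (ℂ → ℂ) := {D | ∃ j k, ∃ p ∈ harm n j k, D = Φ j k p} with hG
  refine sub_eq_zero.1 (eq_zero_of_deriv_mem_span (G := G) ?_ ?_ ⟨j, k, p, hp, rfl⟩ hs)
  · rintro _ ⟨j, k, p, hp, rfl⟩
    simp only [hΦ, boostPairing_zero]
    by_cases hjk : k' = k ∧ j' = j
    · obtain ⟨rfl, rfl⟩ := hjk; ring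
    · have := isSphereMean_meanL.rotInvariant.eq_zero hn hp hq hjk
      rw [mulForm_apply, meanL_apply] at this
      simp only [evalAt_mul] at this
      rw [this]; ring
  · rintro _ ⟨j, k, p, hp, rfl⟩
    have hN := natCast_add_ne_zero hn j k
    have hmem : ∀ {j k : ℕ} {r : CPoly n}, r ∈ harm n j k → Φ j k r ∈ Submodule.span ℂ G :=
      fun {j k r} hr => Submodule.subset_span ⟨j, k, r, hr, rfl⟩
    refine ⟨-(a + j) • Φ (j + 1) k (raiseZ j k l p) - (b + k) • Φ j (k + 1) (raiseW j k l p)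
      + ((n + j - b) / (n + j + k)) • Φ (j - 1) k (dz l p)
      + ((n + k - a) / (n + j + k)) • Φ j (k - 1) (dw l p), ?_, fun s hs => ?_⟩
    · exact add_mem (add_mem (sub_mem (Submodule.smul_mem _ _ (hmem (raiseZ_mem_harm hn hp l)))
        (Submodule.smul_mem _ _ (hmem (raiseW_mem_harm hn hp l))))
        (Submodule.smul_mem _ _ (hmem (dz_mem_harm hp l))))
        (Submodule.smul_mem _ _ (hmem (dw_mem_harm hp l)))
    · refine (((hasDerivAt_boostPairing a b l hc p hs).const_mul (μ j' k')).sub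
        ((hasDerivAt_boostPairing (n + 1 - b) (n + 1 - a) l hc p hs).const_mul (μ j k))).congr_deriv ?_
      rw [boostField_harm hn _ _ hp, boostField_harm hn _ _ hp]
      simp only [boostPairing_add _ _ l hc _ _ hs, boostPairing_sub _ _ l hc _ _ hs,
        boostPairing_smul, boostPairing_one_sub_rho_mul _ _ l h _ hs, hΦ, Pi.add_apply,
        Pi.sub_apply, Pi.smul_apply, smul_eq_mul]
      have z1 : ((n : ℂ) + j - (n + 1 - a)) * μ j k
          * boostPairing (n + 1 - b) (n + 1 - a) l h (dz l p) s
          = (n + j - b) * μ (j - 1) k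
            * boostPairing (n + 1 - b) (n + 1 - a) l h (dz l p) s := by
        rcases j with _ | j
        · rw [dz_eq_zero_of_eulerZ (by simp [(mem_harm.1 hp).2.1])]
          simp [boostPairing, boostPoly]
        · have := h1 j k
          rw [Nat.add_sub_cancel]
          push_cast
          linear_combination (boostPairing (n + 1 - b) (n + 1 - a) l h (dz l p) s) * this
      have z2 : ((n : ℂ) + k - (n + 1 - b)) * μ j k
          * boostPairing (n + 1 - b) (n + 1 - a) l h (dw l p) s
          = (n + k - a) * μ j (k - 1)
            * boostPairing (n + 1 - b) (n + 1 - a) l h (dw l p) s := by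
        rcases k with _ | k
        · rw [dw_eq_zero_of_eulerW (by simp [(mem_harm.1 hp).2.2])]
          simp [boostPairing, boostPoly]
        · have := h2 j k
          rw [Nat.add_sub_cancel]
          push_cast
          linear_combination (boostPairing (n + 1 - b) (n + 1 - a) l h (dw l p) s) * this
      have z3 := h1 j k
      have z4 := h2 j k
      linear_combination (boostPairing (n + 1 - b) (n + 1 - a) l h (raiseZ j k l p) s
          / (1 - s ^ 2)) * (-z3)
        - (boostPairing (n + 1 - b) (n + 1 - a) l h (raiseW j k l p) s / (1 - s ^ 2)) * z4
        - z1 / (n + j + k) / (1 - s ^ 2) - z2 / (n + j + k) / (1 - s ^ 2)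

/-! ### The boosts as transformations of the sphere -/

theorem norm_ofReal_lt_one {s : ℝ} (hs : |s| < 1) : ‖(s : ℂ)‖ < 1 := by
  rwa [Complex.norm_real, Real.norm_eq_abs]

theorem conj_one_add_ofReal_mul (s : ℝ) (x : ℂ) : conj (1 + (s : ℂ) * x) = 1 + s * conj x := by
  simp

theorem arg_ne_pi_of_re_pos {x : ℂ} (h : 0 < x.re) : x.arg ≠ Real.pi := by
  intro h'
  rw [Complex.arg_eq_pi_iff] at h'
  linarith [h'.1]

theorem one_sub_sq_pos {s : ℝ} (hs : |s| < 1) : 0 < 1 - s ^ 2 := by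
  have := (sq_lt_one_iff_abs_lt_one s).2 hs
  linarith

theorem log_one_sub_sq {s : ℝ} (hs : |s| < 1) :
    Complex.log (1 - (s : ℂ) ^ 2) = (Real.log (1 - s ^ 2) : ℝ) := by
  rw [Complex.ofReal_log (one_sub_sq_pos hs).le]
  push_cast
  rfl

theorem conj_logJ {s : ℝ} (hs : |s| < 1) {x : ℂ} (hx : ‖x‖ ≤ 1) :
    conj (logJ s x) = logJ s (conj x) := by
  have h := one_add_mul_re_pos (norm_ofReal_lt_one hs) hx
  rw [logJ, logJ, log_one_sub_sq hs, map_sub, ← Complex.log_conj _ (arg_ne_pi_of_re_pos h),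
    conj_one_add_ofReal_mul, map_div₀, Complex.conj_ofReal, map_ofNat]

theorem boostFactor_eq {s : ℝ} (hs : |s| < 1) :
    boostFactor s = (Real.exp (Real.log (1 - s ^ 2) / 2) : ℝ) := by
  rw [boostFactor, log_one_sub_sq hs]
  push_cast
  rfl

theorem boostFactor_neg (s : ℂ) : boostFactor (-s) = boostFactor s := by simp [boostFactor]

theorem conj_boostFactor {s : ℝ} (hs : |s| < 1) : conj (boostFactor s) = boostFactor s := by
  rw [boostFactor_eq hs, Complex.conj_ofReal]

theorem boostFactor_ne_zero (s : ℂ) : boostFactor s ≠ 0 := Complex.exp_ne_zero _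

theorem exp_logJ {s x : ℂ} (hs : ‖s‖ < 1) (hx : ‖x‖ ≤ 1) :
    Complex.exp (logJ s x) = boostFactor s / (1 + s * x) := by
  rw [logJ, Complex.exp_sub, Complex.exp_log (ne_zero_of_re_pos (one_add_mul_re_pos hs hx)),
    boostFactor]

theorem conj_boostCoord (l : Fin (n + 1)) {s : ℝ} (hs : |s| < 1) (ζ : Fin (n + 1) → ℂ)
    (m : Fin (n + 1)) :
    conj (boostCoord l s ζ m) = boostCoord l s (fun m => conj (ζ m)) m := by
  rw [boostCoord, boostCoord]
  split_ifs
  · simp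
  · simp [conj_boostFactor hs]

/-- The boost of parameter `s` in the direction `e_l`. -/
def boostVec (l : Fin (n + 1)) (s : ℝ) (z : Cn n) : Cn n :=
  WithLp.toLp 2 (boostCoord l s fun m => z m)

theorem boostVec_apply (l : Fin (n + 1)) (s : ℝ) (z : Cn n) (m : Fin (n + 1)) :
    boostVec l s z m = boostCoord l s (fun m => z m) m := rfl

theorem boostVec_self (l : Fin (n + 1)) (s : ℝ) (z : Cn n) :
    boostVec l s z l = (z l + s) / (1 + s * z l) := by
  rw [boostVec_apply, boostCoord, if_pos rfl]

theorem eval_boostPoint (l : Fin (n + 1)) {s : ℝ} (hs : |s| < 1) (z : Cn n) (p : CPoly n) :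
    eval (boostPoint l s z) p = evalAt p (boostVec l s z) := by
  rw [evalAt, boostPoint]
  congr 2
  funext m
  rcases m with m | m
  · rfl
  · simp only [Sum.elim_inr, boostVec_apply, conj_boostCoord l hs]

theorem norm_eq_one_of_evalAt_rho {z : Cn n} (h : evalAt (rho n) z = 1) : ‖z‖ = 1 := by
  have : ((‖z‖ ^ 2 : ℝ) : ℂ) = 1 := by
    rw [← h, EuclideanSpace.norm_sq_eq, rho, evalAt_sum]
    push_cast
    refine Finset.sum_congr rfl fun l _ => ?_
    rw [evalAt_mul, evalAt_zv, evalAt_wv, Complex.mul_conj, Complex.normSq_eq_norm_sq]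
    push_cast; rfl
  have h' : ‖z‖ ^ 2 = 1 := by exact_mod_cast this
  exact (pow_eq_one_iff_of_nonneg (norm_nonneg z) two_ne_zero).1 h'

/-- The boost of parameter `s` as a transformation of the sphere. -/
def boostSph (l : Fin (n + 1)) (s : ℝ) (hs : |s| < 1) (z : Sph n) : Sph n :=
  ⟨boostVec l s z, mem_sphere_zero_iff_norm.2 (norm_eq_one_of_evalAt_rho (by
    rw [← eval_boostPoint l hs, eval_boostPoint_rho l (norm_ofReal_lt_one hs)]))⟩

theorem boostSph_coe (l : Fin (n + 1)) {s : ℝ} (hs : |s| < 1) (z : Sph n) :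
    (boostSph l s hs z : Cn n) = boostVec l s z := rfl

theorem boostPoly_ofReal (a b : ℂ) (l : Fin (n + 1)) (p : CPoly n) {s : ℝ} (hs : |s| < 1)
    (z : Sph n) : boostPoly a b l p s z
      = boostWeight a b s ((z : Cn n) l) * evalAt p (boostSph l s hs z : Cn n) := by
  rw [boostPoly, eval_boostPoint l hs, boostSph_coe]

theorem continuous_boostSph (l : Fin (n + 1)) {s : ℝ} (hs : |s| < 1) :
    Continuous (boostSph (n := n) l s hs) := by
  refine Continuous.subtype_mk ((PiLp.continuous_toLp 2 _).comp (continuous_pi fun m => ?_)) _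
  rw [← continuousOn_univ]
  exact (continuousOn_boostCoord l m (f := fun p : ℂ × Sph n => fun m => (p.2 : Cn n) m)
    (by fun_prop) fun q => norm_coord_le _ _).comp (f := fun z : Sph n => ((s : ℂ), z))
    (by fun_prop : Continuous fun z : Sph n => ((s : ℂ), z)).continuousOn
    fun z _ => ⟨by simpa using hs, trivial⟩

theorem continuous_boostWeight (a b : ℂ) (l : Fin (n + 1)) {s : ℝ} (hs : |s| < 1) :
    Continuous fun z : Sph n => boostWeight a b s ((z : Cn n) l) := by
  have := continuous_boostPoly (n := n) a b l 1 (norm_ofReal_lt_one hs)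
  simpa only [boostPoly, map_one, mul_one] using this

theorem one_sub_mul_boost {s x : ℂ} (hx : 1 + s * x ≠ 0) :
    1 + -s * ((x + s) / (1 + s * x)) = (1 - s ^ 2) * (1 + s * x)⁻¹ := by
  rw [← div_eq_mul_inv, ← mul_div_assoc, eq_div_iff hx, add_mul, div_mul_cancel₀ _ hx]
  ring

/-- The conformal factors of inverse boosts are inverse to each other. -/
theorem logJ_neg {s : ℝ} (hs : |s| < 1) {x : ℂ} (hx : ‖x‖ ≤ 1) :
    logJ (-s) ((x + s) / (1 + s * x)) = -logJ s x := by
  have h := one_add_mul_re_pos (norm_ofReal_lt_one hs) hx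
  have h0 := ne_zero_of_re_pos h
  have hr : (1 - (s : ℂ) ^ 2) = ((1 - s ^ 2 : ℝ) : ℂ) := by push_cast; rfl
  rw [logJ, logJ, one_sub_mul_boost h0, neg_sq, hr,
    Complex.log_ofReal_mul (one_sub_sq_pos hs) (inv_ne_zero h0),
    Complex.log_inv _ (arg_ne_pi_of_re_pos h), Complex.ofReal_log (one_sub_sq_pos hs).le]
  ring

theorem boostVec_neg (l : Fin (n + 1)) {s : ℝ} (hs : |s| < 1) {z : Cn n} (hz : ‖z l‖ ≤ 1) :
    boostVec l (-s) (boostVec l s z) = z := by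
  have h0 := ne_zero_of_re_pos (one_add_mul_re_pos (norm_ofReal_lt_one hs) hz)
  have hc := boostFactor_sq (norm_ofReal_lt_one hs)
  have h1 : (1 : ℂ) - s ^ 2 ≠ 0 := by rw [← hc]; exact pow_ne_zero 2 (boostFactor_ne_zero _)
  ext m
  rw [boostVec_apply, boostCoord, boostVec_self]
  push_cast
  rw [one_sub_mul_boost h0]
  split_ifs with hm
  · subst hm
    rw [div_eq_iff (mul_ne_zero h1 (inv_ne_zero h0)), div_add' _ _ _ h0, div_eq_mul_inv,
      ← mul_assoc]
    congr 1
    ring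
  · rw [boostVec_apply, boostCoord, if_neg hm, boostFactor_neg,
      div_eq_iff (mul_ne_zero h1 (inv_ne_zero h0)), ← hc, div_eq_mul_inv]
    ring

theorem boostSph_neg (l : Fin (n + 1)) {s : ℝ} (hs : |s| < 1) (hs' : |-s| < 1) (z : Sph n) :
    boostSph l (-s) hs' (boostSph l s hs z) = z :=
  Subtype.ext (boostVec_neg l hs (norm_coord_le z l))

theorem boostWeight_mul (a b a' b' : ℂ) (s x : ℂ) :
    boostWeight a b s x * boostWeight a' b' s x = boostWeight (a + a') (b + b') s x := by
  rw [boostWeight, boostWeight, boostWeight, ← Complex.exp_add]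
  congr 1; ring

theorem boostWeight_neg (a b : ℂ) {s : ℝ} (hs : |s| < 1) {x : ℂ} (hx : ‖x‖ ≤ 1) :
    boostWeight a b (-s) ((x + s) / (1 + s * x)) = boostWeight (-a) (-b) s x := by
  have h := logJ_neg hs (x := conj x) (by rwa [RCLike.norm_conj])
  have h' : conj ((x + s) / (1 + s * x)) = (conj x + s) / (1 + s * conj x) := by simp
  rw [boostWeight, boostWeight, h', h, logJ_neg hs hx]
  congr 1; ring

theorem boostWeight_eq_mixedPow {s : ℝ} (hs : |s| < 1) {x : ℂ} (hx : ‖x‖ ≤ 1) {a b : ℝ}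
    (h : ∃ m : ℤ, a - b = m) :
    boostWeight a b s x = mixedPow (boostFactor s / (1 + s * x)) a b := by
  obtain ⟨m, hm⟩ := h
  rw [← exp_logJ (norm_ofReal_lt_one hs) hx, boostWeight, mixedPow, ← conj_logJ hs hx, hm,
    Complex.ofReal_intCast, Complex.cpow_intCast, ← Complex.exp_int_mul, Complex.norm_exp,
    ← Real.exp_mul, Complex.ofReal_exp, ← Complex.exp_add]
  congr 1
  have ha : (a : ℂ) = b + m := by
    have : a = b + m := by linarith
    rw [this]; push_cast; rfl
  have hre := Complex.add_conj (logJ s x)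
  rw [ha]
  push_cast at hre ⊢
  linear_combination (b : ℂ) * hre

/-! ### Change of variables under boosts -/

theorem boostWeight_norm (a b : ℂ) {s : ℝ} (hs : |s| < 1) (l : Fin (n + 1)) :
    ∃ M : ℝ, 0 < M ∧ ∀ z : Sph n, ‖boostWeight a b s ((z : Cn n) l)‖ ≤ M := by
  obtain ⟨M, hM⟩ := (isCompact_range (continuous_boostWeight (n := n) a b l hs)).isBounded.exists_norm_le
  exact ⟨|M| + 1, by positivity, fun z => (hM _ ⟨z, rfl⟩).trans (by linarith [le_abs_self M])⟩

theorem integral_boost_harm (hn : 1 ≤ n) (l : Fin (n + 1)) {s : ℝ} (hs : |s| < 1) {j k : ℕ}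
    {p : CPoly n} (hp : p ∈ harm n j k) :
    ∫ z : Sph n, boostPoly (n + 1) (n + 1) l p s z ∂(crVolume n)
      = ∫ z : Sph n, evalAt p z ∂(crVolume n) := by
  have h := mul_boostPairing_eq hn (n + 1) (n + 1) l (μ := fun j k => if j = 0 ∧ k = 0 then 1 else 0)
    (fun j k => by rcases j with _ | j <;> simp) (fun j k => by rcases k with _ | k <;> simp)
    hp one_mem_harm (norm_ofReal_lt_one hs)
  simp only [boostPairing, evalAt_one, mul_one] at h
  simp only [and_self, if_true, one_mul] at h
  rw [h]
  by_cases hjk : j = 0 ∧ k = 0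
  · rw [if_pos hjk, one_mul, sub_self]
    obtain ⟨rfl, rfl⟩ := hjk
    obtain ⟨c, rfl⟩ := exists_smul_one_of_mem_harm_zero hp
    congr 1; funext z
    simp [boostPoly, boostWeight, evalAt_smul, evalAt_one]
  · rw [if_neg hjk, zero_mul]
    have := isSphereMean_meanL.rotInvariant.eq_zero hn hp one_mem_harm (by tauto)
    rw [mulForm_apply, mul_one, meanL_apply] at this
    exact this.symm

theorem integral_boost_evalAt (hn : 1 ≤ n) (l : Fin (n + 1)) {s : ℝ} (hs : |s| < 1) (p : CPoly n) :
    ∫ z : Sph n, boostPoly (n + 1) (n + 1) l p s z ∂(crVolume n)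
      = ∫ z : Sph n, evalAt p z ∂(crVolume n) := by
  obtain ⟨q, hq, r, rfl⟩ := exists_harmonic_decomposition hn p
  have hev : ∀ z : Sph n, evalAt (q + (rho n - 1) * r) (z : Cn n) = evalAt q z := fun z => by
    rw [evalAt_add, evalAt_mul, evalAt_sub, evalAt_rho_sphere, evalAt_one, sub_self, zero_mul,
      add_zero]
  simp only [boostPoly_ofReal _ _ l _ hs, hev]
  simp only [← boostPoly_ofReal _ _ l _ hs]
  clear hev
  induction hq using Submodule.span_induction with
  | mem q hq =>
    simp only [Set.mem_iUnion] at hq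
    obtain ⟨j, k, hq⟩ := hq
    exact integral_boost_harm hn l hs hq
  | zero => simp [boostPoly, evalAt]
  | add p q _ _ hp hq =>
    simp only [boostPoly_add, evalAt_add]
    rw [integral_add_sphere (continuous_evalAt p) (continuous_evalAt q), integral_add_sphere
      (continuous_boostPoly _ _ l p (norm_ofReal_lt_one hs))
      (continuous_boostPoly _ _ l q (norm_ofReal_lt_one hs)), hp, hq]
  | smul c q _ hq =>
    simp only [boostPoly_smul, evalAt_smul]
    rw [integral_const_mul, integral_const_mul, hq]

/-- The change of variables formula for a boost: its Jacobian is `|J|^{2(n+1)}`. -/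
theorem integral_boost (hn : 1 ≤ n) (l : Fin (n + 1)) {s : ℝ} (hs : |s| < 1) {f : Sph n → ℂ}
    (hf : Continuous f) :
    ∫ z : Sph n, boostWeight (n + 1) (n + 1) s ((z : Cn n) l) * f (boostSph l s hs z) ∂(crVolume n)
      = ∫ z : Sph n, f z ∂(crVolume n) := by
  obtain ⟨M, hM0, hM⟩ := boostWeight_norm (n := n) (n + 1) (n + 1) hs l
  have hW := continuous_boostWeight (n := n) (n + 1) (n + 1) l hs
  have hB := continuous_boostSph (n := n) l hs
  have key : ∀ ε > 0, ‖(∫ z : Sph n, boostWeight (n + 1) (n + 1) s ((z : Cn n) l)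
      * f (boostSph l s hs z) ∂(crVolume n)) - ∫ z : Sph n, f z ∂(crVolume n)‖
      ≤ ε * ((M + 1) * mass n) := by
    intro ε hε
    obtain ⟨p, hp⟩ := exists_evalAt_near hf hε
    have h1 := integral_boost_evalAt hn l hs p
    simp only [boostPoly_ofReal _ _ l _ hs] at h1
    have h2 : (∫ z : Sph n, boostWeight (n + 1) (n + 1) s ((z : Cn n) l)
      * f (boostSph l s hs z) ∂(crVolume n)) - ∫ z : Sph n, f z ∂(crVolume n)
      = ∫ z : Sph n, (boostWeight (n + 1) (n + 1) s ((z : Cn n) l)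
          * (f (boostSph l s hs z) - evalAt p (boostSph l s hs z : Cn n))
          - (f z - evalAt p z)) ∂(crVolume n) := by
      have c1 : Continuous fun z => evalAt p (boostSph l s hs z : Cn n) :=
        (continuous_evalAt p).comp hB
      have c2 : Continuous fun z => f (boostSph l s hs z) := hf.comp hB
      rw [integral_sub_sphere
        (f := fun z => boostWeight (n + 1) (n + 1) s ((z : Cn n) l)
          * (f (boostSph l s hs z) - evalAt p (boostSph l s hs z : Cn n)))
        (g := fun z => f z - evalAt p z) (hW.mul (c2.sub c1)) (hf.sub (continuous_evalAt p))]
      simp only [mul_sub]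
      rw [integral_sub_sphere
        (f := fun z => boostWeight (n + 1) (n + 1) s ((z : Cn n) l) * f (boostSph l s hs z))
        (g := fun z => boostWeight (n + 1) (n + 1) s ((z : Cn n) l)
          * evalAt p (boostSph l s hs z : Cn n)) (hW.mul c2) (hW.mul c1),
        integral_sub_sphere hf (continuous_evalAt p), h1]
      ring
    rw [h2]
    have h3 := norm_integral_le_of_norm_le_const (μ := crVolume n)
      (f := fun z : Sph n => boostWeight (n + 1) (n + 1) s ((z : Cn n) l)
          * (f (boostSph l s hs z) - evalAt p (boostSph l s hs z : Cn n))
          - (f z - evalAt p z)) (C := M * ε + ε) (Filter.Eventually.of_forall fun z => by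
        refine (norm_sub_le _ _).trans (add_le_add ?_ (hp z).le)
        rw [norm_mul]
        exact mul_le_mul (hM z) (hp _).le (norm_nonneg _) hM0.le)
    calc _ ≤ _ := h3
      _ = _ := by rw [mass]; ring
  rw [← sub_eq_zero, ← norm_le_zero_iff]
  have hpos : 0 < (M + 1) * mass n := mul_pos (by linarith) mass_pos
  refine le_of_forall_pos_le_add fun δ hδ => ?_
  refine (key (δ / ((M + 1) * mass n)) (by positivity)).trans ?_
  rw [div_mul_cancel₀ _ hpos.ne', zero_add]

/-- The action of a boost of weights `(n + 1 - b, n + 1 - a)` is dual to that of the inverse boost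
of weights `(b, a)`. -/
theorem integral_boost_mul (hn : 1 ≤ n) (a b : ℂ) (l : Fin (n + 1)) {s : ℝ} (hs : |s| < 1)
    (hs' : |-s| < 1) {f g : Sph n → ℂ} (hf : Continuous f) (hg : Continuous g) :
    ∫ z : Sph n, boostWeight (n + 1 - b) (n + 1 - a) s ((z : Cn n) l) * f (boostSph l s hs z)
        * g z ∂(crVolume n)
      = ∫ z : Sph n, f z * (boostWeight b a ((-s : ℝ) : ℂ) ((z : Cn n) l)
        * g (boostSph l (-s) hs' z)) ∂(crVolume n) := by
  have hc : Continuous fun z : Sph n => f z * (boostWeight b a ((-s : ℝ) : ℂ) ((z : Cn n) l)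
        * g (boostSph l (-s) hs' z)) :=
    hf.mul ((continuous_boostWeight b a l hs').mul (hg.comp (continuous_boostSph l hs')))
  rw [← integral_boost hn l hs hc]
  congr 1; funext z
  rw [boostSph_neg l hs hs', boostSph_coe, boostVec_self, Complex.ofReal_neg,
    boostWeight_neg _ _ hs (norm_coord_le z l)]
  have := boostWeight_mul (n + 1) (n + 1) (-b) (-a) s ((z : Cn n) l)
  rw [sub_eq_add_neg, sub_eq_add_neg, ← this]
  ring

/-! ### Differentials of maps on the sphere -/

/-- The differential at `z` of a vector valued function on the sphere. -/
def dFun {E : Type*} [NormedAddCommGroup E] [NormedSpace ℝ E] (f : Sph n → E) (z : Sph n) :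
    Tan z →L[ℝ] E :=
  mfderiv (𝓡 (2 * n + 1)) 𝓘(ℝ, E) f z

theorem dIncl_eq (z : Sph n) (v : Tan z) : dIncl z v = dFun (fun x : Sph n => (x : Cn n)) z v := rfl

theorem dMap_eq (τ : SphDiffeo n) (z : Sph n) (v : Tan z) :
    dMap τ z v = dFun (fun x : Sph n => (τ x : Cn n)) z v := rfl

theorem contMDiff_coe : ContMDiff (𝓡 (2 * n + 1)) 𝓘(ℝ, Cn n) ∞ (fun x : Sph n => (x : Cn n)) :=
  contMDiff_coe_sphere

theorem mdifferentiableAt_coe (z : Sph n) :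
    MDifferentiableAt (𝓡 (2 * n + 1)) 𝓘(ℝ, Cn n) (fun x : Sph n => (x : Cn n)) z :=
  (contMDiff_coe z).mdifferentiableAt (by simp)

theorem mdifferentiableAt_diffeo (τ : SphDiffeo n) (z : Sph n) :
    MDifferentiableAt (𝓡 (2 * n + 1)) (𝓡 (2 * n + 1)) τ z :=
  (τ.contMDiff z).mdifferentiableAt (by simp)

section

variable {E F : Type*} [NormedAddCommGroup E] [NormedSpace ℝ E] [NormedAddCommGroup F]
  [NormedSpace ℝ F]

/-- The chain rule for a function on an ambient vector space. -/
theorem dFun_comp_fderiv {g : E → F} {f : Sph n → E} {z : Sph n}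
    (hg : DifferentiableAt ℝ g (f z))
    (hf : MDifferentiableAt (𝓡 (2 * n + 1)) 𝓘(ℝ, E) f z) (v : Tan z) :
    dFun (fun x => g (f x)) z v = fderiv ℝ g (f z) (dFun f z v) := by
  have h := mfderiv_comp z (hg.mdifferentiableAt) hf
  rw [mfderiv_eq_fderiv] at h
  exact congrArg (fun L => L v) h

/-- The chain rule for restrictions of functions on the ambient space. -/
theorem dFun_restrict {g : Cn n → E} {z : Sph n} (hg : DifferentiableAt ℝ g (z : Cn n))
    (v : Tan z) : dFun (fun x : Sph n => g x) z v = fderiv ℝ g z (dIncl z v) :=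
  dFun_comp_fderiv (f := fun x : Sph n => (x : Cn n)) hg (mdifferentiableAt_coe z) v

/-- The image of a tangent vector under the differential of a diffeomorphism of the sphere. -/
def pushTan (τ : SphDiffeo n) (z : Sph n) (v : Tan z) : Tan (τ z) :=
  mfderiv (𝓡 (2 * n + 1)) (𝓡 (2 * n + 1)) τ z v

/-- The chain rule for the composition with a diffeomorphism. -/
theorem dFun_comp_diffeo {f : Sph n → E} (τ : SphDiffeo n) {z : Sph n}
    (hf : MDifferentiableAt (𝓡 (2 * n + 1)) 𝓘(ℝ, E) f (τ z)) (v : Tan z) :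
    dFun (fun x => f (τ x)) z v = dFun f (τ z) (pushTan τ z v) := by
  have h := mfderiv_comp z hf (mdifferentiableAt_diffeo τ z)
  exact congrArg (fun L => L v) h

end

theorem dIncl_pushTan (τ : SphDiffeo n) (z : Sph n) (v : Tan z) :
    dIncl (τ z) (pushTan τ z v) = dMap τ z v :=
  (dFun_comp_diffeo τ (mdifferentiableAt_coe (τ z)) v).symm

theorem dMap_trans (τ σ : SphDiffeo n) (z : Sph n) (v : Tan z) :
    dMap (τ.trans σ) z v = dMap σ (τ z) (pushTan τ z v) :=
  dFun_comp_diffeo (f := fun x : Sph n => (σ x : Cn n)) τ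
    (((contMDiff_coe.comp σ.contMDiff) (τ z)).mdifferentiableAt (by simp)) v

theorem dMap_symm (τ : SphDiffeo n) (z : Sph n) (v : Tan z) :
    dMap τ.symm (τ z) (pushTan τ z v) = dIncl z v := by
  rw [← dMap_trans, dMap_eq, dIncl_eq]
  congr 2
  funext x
  simp

theorem pushTan_surjective (τ : SphDiffeo n) (z : Sph n) : Function.Surjective (pushTan τ z) := by
  have h : Function.Surjective (mfderiv (𝓡 (2 * n + 1)) (𝓡 (2 * n + 1)) τ z) := by
    have := (τ.mfderivToContinuousLinearEquiv (by simp) z).surjective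
    exact this
  exact h

/-- Tangent vectors of the sphere are the real vectors orthogonal to the position vector. -/
theorem exists_dIncl_eq_iff (z : Sph n) (v : Cn n) :
    (∃ u : Tan z, dIncl z u = v) ↔ (inner ℂ (z : Cn n) v).re = 0 := by
  have h := range_mvfderiv_subtypeVal (n := 2 * n + 1) z
  have h1 : (∃ u : Tan z, dIncl z u = v) ↔ v ∈ (Submodule.span ℝ {(z : Cn n)})ᗮ := by
    rw [← h]; rfl
  rw [h1, Submodule.mem_orthogonal_singleton_iff_inner_right, PiLp.inner_apply, PiLp.inner_apply,
    Complex.re_sum]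
  rfl

theorem inner_dIncl_re (z : Sph n) (u : Tan z) : (inner ℂ (z : Cn n) (dIncl z u)).re = 0 :=
  (exists_dIncl_eq_iff z _).1 ⟨u, rfl⟩

theorem dIncl_injective (z : Sph n) : Function.Injective (dIncl z) :=
  injective_mvfderiv_subtypeVal_sphere (n := 2 * n + 1) z

theorem contactForm_eq (z v : Cn n) : contactForm z v = ((inner ℂ z v).im : ℂ) := by
  rw [contactForm, PiLp.inner_apply, Complex.im_sum, Finset.mul_sum]
  push_cast
  refine Finset.sum_congr rfl fun l _ => ?_
  have h : z l * conj (v l) = conj (conj (z l) * v l) := by simp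
  have h2 : inner ℂ (z l) (v l) = conj (z l) * v l := by
    rw [RCLike.inner_apply, mul_comm]
  have h3 := Complex.sub_conj (conj (z l) * v l)
  rw [h2, h]
  push_cast at h3
  linear_combination (-(Complex.I / 2)) * h3
    - (((conj (z l) * v l).im : ℂ)) * Complex.I_mul_I

/-- The maximal complex subspace of the tangent space. -/
theorem exists_dIncl_I_smul_iff (z : Sph n) (v : Tan z) :
    (∃ u : Tan z, dIncl z u = Complex.I • dIncl z v) ↔ inner ℂ (z : Cn n) (dIncl z v) = 0 := by
  rw [exists_dIncl_eq_iff, inner_smul_right, Complex.ext_iff]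
  have := inner_dIncl_re z v
  simp [this]

/-! ### Restrictions of holomorphic maps to the sphere -/

/-- The diffeomorphism of the sphere obtained by restricting two smooth maps `f`, `g` that preserve
the sphere and are inverse to each other there. -/
def diffeoOfMaps (f g : Cn n → Cn n) (hf : ∀ z : Sph n, ContDiffAt ℝ ∞ f z)
    (hg : ∀ z : Sph n, ContDiffAt ℝ ∞ g z) (hf1 : ∀ z : Sph n, f z ∈ Metric.sphere (0 : Cn n) 1)
    (hg1 : ∀ z : Sph n, g z ∈ Metric.sphere (0 : Cn n) 1) (hgf : ∀ z : Sph n, g (f z) = z)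
    (hfg : ∀ z : Sph n, f (g z) = z) : SphDiffeo n where
  toFun z := ⟨f z, hf1 z⟩
  invFun z := ⟨g z, hg1 z⟩
  left_inv z := Subtype.ext (hgf z)
  right_inv z := Subtype.ext (hfg z)
  contMDiff_toFun := ContMDiff.codRestrict_sphere (n := 2 * n + 1) (f := fun z : Sph n => f z)
    (fun z => (hf z).contMDiffAt.comp z (contMDiff_coe z)) hf1
  contMDiff_invFun := ContMDiff.codRestrict_sphere (n := 2 * n + 1) (f := fun z : Sph n => g z)
    (fun z => (hg z).contMDiffAt.comp z (contMDiff_coe z)) hg1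

theorem dMap_of_hasFDerivAt {τ : SphDiffeo n} {f : Cn n → Cn n} (hf : ∀ z : Sph n, (τ z : Cn n) = f z)
    {L : Cn n →L[ℂ] Cn n} {z : Sph n} (hL : HasFDerivAt f L (z : Cn n)) (v : Tan z) :
    dMap τ z v = L (dIncl z v) := by
  have h := hL.restrictScalars ℝ
  rw [dMap_eq, funext hf, dFun_restrict h.differentiableAt, h.fderiv]
  rfl

theorem isCRAut_of_hasFDerivAt {τ : SphDiffeo n} {f : Cn n → Cn n}
    (hf : ∀ z : Sph n, (τ z : Cn n) = f z) {L : Sph n → Cn n →L[ℂ] Cn n}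
    (hL : ∀ z : Sph n, HasFDerivAt f (L z) (z : Cn n)) : IsCRAut τ := by
  intro z u v h
  rw [dMap_of_hasFDerivAt hf (hL z), dMap_of_hasFDerivAt hf (hL z), h, map_smul]

theorem holVolume_eq_det (v : Fin (n + 1) → Cn n) :
    holVolume v = (EuclideanSpace.basisFun (Fin (n + 1)) ℂ).toBasis.det v := by
  rw [Module.Basis.det_apply, holVolume, ← Matrix.det_transpose]
  congr 1

theorem holVolume_comp (L : Cn n →ₗ[ℂ] Cn n) (v : Fin (n + 1) → Cn n) :
    holVolume (fun a => L (v a)) = LinearMap.det L * holVolume v := by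
  rw [holVolume_eq_det, holVolume_eq_det, ← Module.Basis.det_comp]
  rfl

theorem isConformalFactor_of_hasFDerivAt {τ : SphDiffeo n} {f : Cn n → Cn n}
    (hf : ∀ z : Sph n, (τ z : Cn n) = f z) {L : Sph n → Cn n →L[ℂ] Cn n}
    (hL : ∀ z : Sph n, HasFDerivAt f (L z) (z : Cn n)) {J : Smooth n} (hJ : ∀ z, J z ≠ 0)
    (hdet : ∀ z, LinearMap.det (L z : Cn n →ₗ[ℂ] Cn n) = J z ^ (n + 2))
    (hinner : ∀ (z : Sph n) (v : Cn n), inner ℂ (f z) (L z v)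
      = ((‖J z‖ ^ 2 : ℝ) : ℂ) * inner ℂ (z : Cn n) v) : IsConformalFactor τ J where
  ne_zero := hJ
  pullback_holVolume z v := by
    simp only [dMap_of_hasFDerivAt hf (hL z)]
    rw [← hdet, ← holVolume_comp]
    rfl
  pullback_contactForm z v := by
    rw [dMap_of_hasFDerivAt hf (hL z), hf, contactForm_eq, contactForm_eq, hinner,
      Complex.im_ofReal_mul]
    push_cast
    rfl

/-! ### Unitary maps -/

/-- The diffeomorphism of the sphere induced by a unitary map. -/
def unitaryDiffeo (U : Cn n ≃ₗᵢ[ℂ] Cn n) : SphDiffeo n :=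
  diffeoOfMaps U U.symm
    (fun _ => ((U : Cn n →L[ℂ] Cn n).restrictScalars ℝ).contDiff.contDiffAt)
    (fun _ => ((U.symm : Cn n →L[ℂ] Cn n).restrictScalars ℝ).contDiff.contDiffAt)
    (fun z => by rw [mem_sphere_zero_iff_norm, U.norm_map]; exact mem_sphere_zero_iff_norm.1 z.2)
    (fun z => by rw [mem_sphere_zero_iff_norm, U.symm.norm_map]; exact mem_sphere_zero_iff_norm.1 z.2)
    (fun z => U.symm_apply_apply z) (fun z => U.apply_symm_apply z)

theorem unitaryDiffeo_coe (U : Cn n ≃ₗᵢ[ℂ] Cn n) (z : Sph n) : (unitaryDiffeo U z : Cn n) = U z :=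
  rfl

theorem isCRAut_unitaryDiffeo (U : Cn n ≃ₗᵢ[ℂ] Cn n) : IsCRAut (unitaryDiffeo U) :=
  isCRAut_of_hasFDerivAt (unitaryDiffeo_coe U) fun _ =>
    (U.toContinuousLinearEquiv : Cn n →L[ℂ] Cn n).hasFDerivAt

/-- Constant functions as smooth functions. -/
def constSmooth (c : ℂ) : Smooth n := ⟨fun _ => c, contMDiff_const⟩

theorem norm_det_unitary (U : Cn n ≃ₗᵢ[ℂ] Cn n) :
    ‖LinearMap.det (U.toLinearEquiv : Cn n →ₗ[ℂ] Cn n)‖ = 1 := by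
  rw [← LinearMap.normDet_eq_norm_det]
  exact U.toLinearIsometry.normDet_eq_one

theorem exists_isConformalFactor_unitaryDiffeo (U : Cn n ≃ₗᵢ[ℂ] Cn n) :
    ∃ κ : ℂ, ‖κ‖ = 1 ∧ IsConformalFactor (unitaryDiffeo U) (constSmooth κ) := by
  obtain ⟨κ, hκ⟩ := IsAlgClosed.exists_pow_nat_eq
    (LinearMap.det (U.toLinearEquiv : Cn n →ₗ[ℂ] Cn n)) (Nat.succ_pos (n + 1))
  have h1 : ‖κ‖ = 1 := by
    have := norm_det_unitary U
    rw [← hκ, norm_pow] at this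
    exact (pow_eq_one_iff_of_nonneg (norm_nonneg _) (by omega)).1 this
  refine ⟨κ, h1, isConformalFactor_of_hasFDerivAt (unitaryDiffeo_coe U)
    (L := fun _ => (U.toContinuousLinearEquiv : Cn n →L[ℂ] Cn n))
    (fun _ => (U.toContinuousLinearEquiv : Cn n →L[ℂ] Cn n).hasFDerivAt) ?_ ?_ ?_⟩
  · intro z h
    have : κ = 0 := h
    rw [this] at h1; simp at h1
  · exact fun z => hκ.symm
  · intro z v
    have : (constSmooth (n := n) κ) z = κ := rfl
    rw [this, h1]
    simp only [one_pow, Complex.ofReal_one, one_mul]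
    exact U.inner_map_map z v

/-! ### Boosts as diffeomorphisms -/

theorem boost_deriv_identity {c s x : ℂ} (hD : 1 + s * x ≠ 0) (hc : c ^ 2 = 1 - s ^ 2) (v : ℂ) :
    -((x + s) * (((1 + s * x) ^ 2)⁻¹ * (s * v))) + (1 + s * x)⁻¹ * v
      = c / (1 + s * x) * (v + v * (c / (1 + s * x) - 1)) := by
  have hi := inv_mul_cancel₀ hD
  rw [div_eq_mul_inv, ← inv_pow]
  generalize (1 + s * x)⁻¹ = i at *
  linear_combination (-(i * v)) * hi - i ^ 2 * v * hc

theorem boost_inner_identity {s x : ℂ} (hD : 1 + s * x ≠ 0) (c e y v S : ℂ) :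
    c / (1 + s * x) * (v + v * (c / (1 + s * x) - 1)) * ((y + s) / e)
      + (c / (1 + s * x) * (c / e) * S
        - c / (1 + s * x) * (c / e) * (s * v / (1 + s * x)) * (1 - x * y))
      = c / (1 + s * x) * (c / e) * (v * y + S) := by
  have hi := inv_mul_cancel₀ hD
  simp only [div_eq_mul_inv]
  generalize (1 + s * x)⁻¹ = i at *
  linear_combination c ^ 2 * i * e⁻¹ * v * y * hi

/-- The complex derivative of a boost. -/
def boostDeriv (l : Fin (n + 1)) (s : ℝ) (z : Cn n) : Cn n →ₗ[ℂ] Cn n :=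
  (boostFactor s / (1 + s * z l)) • LinearMap.transvection
    ((EuclideanSpace.proj l : Cn n →L[ℂ] ℂ) : Module.Dual ℂ (Cn n))
    (WithLp.toLp 2 fun m => if m = l then boostFactor s / (1 + s * z l) - 1
      else -(s * z m / (1 + s * z l)))

theorem boostDeriv_apply (l : Fin (n + 1)) (s : ℝ) (z v : Cn n) (m : Fin (n + 1)) :
    boostDeriv l s z v m = boostFactor s / (1 + s * z l) * (v m + v l *
      if m = l then boostFactor s / (1 + s * z l) - 1 else -(s * z m / (1 + s * z l))) := rfl

theorem det_boostDeriv (l : Fin (n + 1)) (s : ℝ) (z : Cn n) :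
    LinearMap.det (boostDeriv l s z) = (boostFactor s / (1 + s * z l)) ^ (n + 2) := by
  rw [boostDeriv, LinearMap.det_smul, LinearMap.transvection.det, finrank_euclideanSpace,
    Fintype.card_fin, pow_succ _ (n + 1)]
  congr 1
  simp

theorem hasFDerivAt_boostVec (l : Fin (n + 1)) {s : ℝ} (hs : |s| < 1) (z : Sph n) :
    HasFDerivAt (𝕜 := ℂ) (boostVec l s) (LinearMap.toContinuousLinearMap (boostDeriv l s z))
      (z : Cn n) := by
  have h0 := ne_zero_of_re_pos (one_add_mul_re_pos (norm_ofReal_lt_one hs) (norm_coord_le z l))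
  have hc := boostFactor_sq (norm_ofReal_lt_one hs)
  rw [← hasFDerivWithinAt_univ, hasFDerivWithinAt_euclidean]
  intro m
  rw [hasFDerivWithinAt_univ]
  have hp : ∀ m, HasFDerivAt (𝕜 := ℂ) (fun x : Cn n => x m) (EuclideanSpace.proj m : Cn n →L[ℂ] ℂ)
    (z : Cn n) := fun m => (EuclideanSpace.proj m : Cn n →L[ℂ] ℂ).hasFDerivAt
  have hd := ((hp l).const_mul (s : ℂ)).const_add 1
  have hi : HasFDerivAt (𝕜 := ℂ) (fun x : Cn n => (1 + (s : ℂ) * x l)⁻¹) _ (z : Cn n) :=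
    HasDerivAt.comp_hasFDerivAt (f := fun x : Cn n => 1 + (s : ℂ) * x l) _ (hasDerivAt_inv h0) hd
  simp only [boostVec_apply, boostCoord, div_eq_mul_inv]
  split_ifs with hm
  · refine (((hp l).add_const (s : ℂ)).mul hi).congr_fderiv ?_
    ext v
    simpa [boostDeriv_apply, hm] using boost_deriv_identity h0 hc (v l)
  · refine (((hp m).const_mul (boostFactor s)).mul hi).congr_fderiv ?_
    ext v
    simp only [ContinuousLinearMap.comp_apply, PiLp.proj_apply,
      LinearMap.coe_toContinuousLinearMap', boostDeriv_apply, if_neg hm, _root_.add_apply,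
      _root_.smul_apply, smul_eq_mul, ← inv_pow]
    ring

theorem contDiffAt_boostVec (l : Fin (n + 1)) {s : ℝ} (hs : |s| < 1) (z : Sph n) :
    ContDiffAt ℝ ∞ (boostVec (n := n) l s) (z : Cn n) := by
  have h0 := ne_zero_of_re_pos (one_add_mul_re_pos (norm_ofReal_lt_one hs) (norm_coord_le z l))
  refine contDiffAt_piLp' 2 fun m => ?_
  have hp : ∀ m, ContDiffAt ℝ ∞ (fun x : Cn n => x m) (z : Cn n) := fun m =>
    ((EuclideanSpace.proj m : Cn n →L[ℂ] ℂ).restrictScalars ℝ).contDiff.contDiffAt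
  simp only [boostVec_apply, boostCoord]
  have hd : ContDiffAt ℝ ∞ (fun x : Cn n => 1 + (s : ℂ) * x l) (z : Cn n) :=
    contDiffAt_const.add (contDiffAt_const.mul (hp l))
  simp only [div_eq_mul_inv]
  split_ifs with hm
  · exact ((hp l).add contDiffAt_const).mul (hd.inv h0)
  · exact (contDiffAt_const.mul (hp m)).mul (hd.inv h0)

/-- A boost as a diffeomorphism of the sphere. -/
def boostDiffeo (l : Fin (n + 1)) (s : ℝ) (hs : |s| < 1) : SphDiffeo n :=
  diffeoOfMaps (boostVec l s) (boostVec l (-s)) (contDiffAt_boostVec l hs)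
    (contDiffAt_boostVec l (by rwa [abs_neg])) (fun z => (boostSph l s hs z).2)
    (fun z => (boostSph l (-s) (by rwa [abs_neg]) z).2) (fun z => boostVec_neg l hs (norm_coord_le z l))
    fun z => by
      conv_lhs => rw [← neg_neg s]
      rw [neg_neg (-s)]
      exact boostVec_neg l (by rwa [abs_neg]) (norm_coord_le z l)

/-- The conformal factor of a boost. -/
def boostJ (l : Fin (n + 1)) (s : ℝ) (hs : |s| < 1) : Smooth n :=
  ⟨fun z => boostFactor s / (1 + s * (z : Cn n) l), fun z => by
    have h0 := ne_zero_of_re_pos (one_add_mul_re_pos (norm_ofReal_lt_one hs) (norm_coord_le z l))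
    have hp : ContDiffAt ℝ ∞ (fun x : Cn n => x l) (z : Cn n) :=
      ((EuclideanSpace.proj l : Cn n →L[ℂ] ℂ).restrictScalars ℝ).contDiff.contDiffAt
    have hd : ContDiffAt ℝ ∞ (fun x : Cn n => boostFactor s / (1 + (s : ℂ) * x l)) (z : Cn n) := by
      simp only [div_eq_mul_inv]
      exact contDiffAt_const.mul (ContDiffAt.inv (contDiffAt_const.add (contDiffAt_const.mul hp)) h0)
    exact hd.contMDiffAt.comp z (contMDiff_coe z)⟩

theorem boostJ_apply (l : Fin (n + 1)) {s : ℝ} (hs : |s| < 1) (z : Sph n) :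
    boostJ l s hs z = boostFactor s / (1 + s * (z : Cn n) l) := rfl

theorem inner_boostVec_boostDeriv (l : Fin (n + 1)) {s : ℝ} (hs : |s| < 1) (z : Sph n) (v : Cn n) :
    inner ℂ (boostVec l s z) (boostDeriv l s z v)
      = ((‖boostJ l s hs z‖ ^ 2 : ℝ) : ℂ) * inner ℂ (z : Cn n) v := by
  have h0 := ne_zero_of_re_pos (one_add_mul_re_pos (norm_ofReal_lt_one hs) (norm_coord_le z l))
  have h0' := ne_zero_of_re_pos (one_add_mul_re_pos (norm_ofReal_lt_one hs) (norm_conj_coord_le z l))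
  have hsum := sum_mul_conj_sphere z
  rw [← Finset.add_sum_erase _ _ (Finset.mem_univ l)] at hsum
  rw [← Complex.normSq_eq_norm_sq, ← Complex.mul_conj, boostJ_apply, PiLp.inner_apply,
    PiLp.inner_apply]
  simp only [RCLike.inner_apply]
  rw [← Finset.add_sum_erase _ _ (Finset.mem_univ l), ← Finset.add_sum_erase _ _ (Finset.mem_univ l)]
  have h1 : ∀ m ∈ Finset.univ.erase l, boostDeriv l s z v m * conj (boostVec l s z m)
      = boostFactor s / (1 + s * (z : Cn n) l) * (boostFactor s / (1 + s * conj ((z : Cn n) l)))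
        * (v m * conj ((z : Cn n) m))
      - boostFactor s / (1 + s * (z : Cn n) l) * (boostFactor s / (1 + s * conj ((z : Cn n) l)))
        * (s * v l / (1 + s * (z : Cn n) l)) * ((z : Cn n) m * conj ((z : Cn n) m)) := by
    intro m hm
    have hml := (Finset.mem_erase.1 hm).1
    rw [boostDeriv_apply, if_neg hml, boostVec_apply, conj_boostCoord l hs, boostCoord, if_neg hml]
    ring
  rw [Finset.sum_congr rfl h1, Finset.sum_sub_distrib, ← Finset.mul_sum, ← Finset.mul_sum,
    ← sub_eq_iff_eq_add'.2 hsum.symm, boostDeriv_apply, if_pos rfl, boostVec_self,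
    map_div₀, map_div₀, conj_one_add_ofReal_mul, conj_boostFactor hs, map_add, Complex.conj_ofReal]
  exact boost_inner_identity h0 _ _ _ _ _

theorem isCRAut_boostDiffeo (l : Fin (n + 1)) {s : ℝ} (hs : |s| < 1) :
    IsCRAut (boostDiffeo (n := n) l s hs) :=
  isCRAut_of_hasFDerivAt (fun _ => rfl) (hasFDerivAt_boostVec l hs)

theorem isConformalFactor_boostDiffeo (l : Fin (n + 1)) {s : ℝ} (hs : |s| < 1) :
    IsConformalFactor (boostDiffeo (n := n) l s hs) (boostJ l s hs) := by
  refine isConformalFactor_of_hasFDerivAt (fun _ => rfl) (hasFDerivAt_boostVec l hs) ?_ ?_ ?_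
  · intro z
    rw [boostJ_apply]
    exact div_ne_zero (boostFactor_ne_zero _)
      (ne_zero_of_re_pos (one_add_mul_re_pos (norm_ofReal_lt_one hs) (norm_coord_le z l)))
  · exact fun z => det_boostDeriv l s z
  · exact fun z v => inner_boostVec_boostDeriv l hs z v

/-! ### Operators on smooth functions as bilinear forms on polynomials -/

theorem Smooth.continuous (F : Smooth n) : Continuous F := ContMDiff.continuous F.2

theorem Smooth.ext {F G : Smooth n} (h : ∀ z, F z = G z) : F = G := Subtype.ext (funext h)

theorem Smooth.mdifferentiableAt (F : Smooth n) (z : Sph n) :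
    MDifferentiableAt (𝓡 (2 * n + 1)) 𝓘(ℝ, ℂ) F z := (F.2 z).mdifferentiableAt (by simp)

/-- The restriction of a polynomial to the sphere. -/
def polySmooth (n : ℕ) : CPoly n →ₗ[ℂ] Smooth n where
  toFun p := ⟨fun z => evalAt p z, fun z => (contDiff_evalAt p).contMDiff.comp contMDiff_coe z⟩
  map_add' p q := Smooth.ext fun z => evalAt_add p q z
  map_smul' c p := Smooth.ext fun z => evalAt_smul c p z

theorem polySmooth_apply (p : CPoly n) (z : Sph n) : polySmooth n p z = evalAt p z := rfl

/-- The complex conjugate of a smooth function. -/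
def conjSmooth (F : Smooth n) : Smooth n :=
  ⟨fun z => conj (F z), Complex.conjCLE.contDiff.contMDiff.comp F.2⟩

theorem conjSmooth_apply (F : Smooth n) (z : Sph n) : conjSmooth F z = conj (F z) := rfl

/-- The transpose of a formally self-adjoint operator. -/
def transpose (A : Smooth n →ₗ[ℂ] Smooth n) (G : Smooth n) : Smooth n :=
  conjSmooth (A (conjSmooth G))

theorem IsFormallySelfAdjoint.integral_mul {A : Smooth n →ₗ[ℂ] Smooth n}
    (hA : IsFormallySelfAdjoint A) (F G : Smooth n) :
    ∫ z, A F z * G z ∂(crVolume n) = ∫ z, F z * transpose A G z ∂(crVolume n) := by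
  have := hA F (conjSmooth G)
  simp only [conjSmooth_apply, Complex.conj_conj] at this
  exact this

/-- The bilinear form `∫ (A F) G` of an operator. -/
def opForm (A : Smooth n →ₗ[ℂ] Smooth n) : CPoly n →ₗ[ℂ] CPoly n →ₗ[ℂ] ℂ :=
  LinearMap.mk₂ ℂ (fun F G => ∫ z, A (polySmooth n F) z * evalAt G z ∂(crVolume n))
    (fun F F' G => by
      rw [map_add, map_add, ← integral_add_sphere
        (continuous_mul_evalAt (A (polySmooth n F)).continuous G)
        (continuous_mul_evalAt (A (polySmooth n F')).continuous G)]
      congr 1; funext z; exact add_mul _ _ _)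
    (fun c F G => by
      rw [map_smul, map_smul, smul_eq_mul, ← integral_const_mul]
      congr 1; funext z; exact mul_assoc _ _ _)
    (fun F G G' => by
      rw [← integral_add_sphere (continuous_mul_evalAt (A (polySmooth n F)).continuous G)
        (continuous_mul_evalAt (A (polySmooth n F)).continuous G')]
      congr 1; funext z; rw [evalAt_add, mul_add])
    (fun c F G => by
      rw [smul_eq_mul, ← integral_const_mul]
      congr 1; funext z; rw [evalAt_smul]; ring)

theorem opForm_apply (A : Smooth n →ₗ[ℂ] Smooth n) (F G : CPoly n) :
    opForm A F G = ∫ z, A (polySmooth n F) z * evalAt G z ∂(crVolume n) := rfl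

theorem opForm_eq_transpose {A : Smooth n →ₗ[ℂ] Smooth n} (hA : IsFormallySelfAdjoint A)
    (F G : CPoly n) :
    opForm A F G = ∫ z : Sph n, evalAt F z * transpose A (polySmooth n G) z ∂(crVolume n) :=
  hA.integral_mul (polySmooth n F) (polySmooth n G)

theorem rhoInvariant_opForm (A : Smooth n →ₗ[ℂ] Smooth n) : RhoInvariant (opForm A) := by
  constructor
  · intro F G
    have : polySmooth n (rho n * F) = polySmooth n F := Smooth.ext fun z => by
      rw [polySmooth_apply, polySmooth_apply, evalAt_mul, evalAt_rho_sphere, one_mul]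
    rw [opForm_apply, opForm_apply, this]
  · intro F G
    simp only [opForm_apply, evalAt_mul, evalAt_rho_sphere, one_mul]

theorem flow_neg_apply {V : Cn n →L[ℝ] Cn n} (hV : ∀ x, V (V (V x)) = -V x) (t : ℝ) (x : Cn n) :
    flow V (-t) (flow V t x) = x := by
  simp only [flow_apply, Real.sin_neg, Real.cos_neg, map_add, map_smul, hV, map_neg]
  have h := Real.sin_sq_add_cos_sq t
  have h2 : x + -Real.sin t • V x + (1 - Real.cos t) • V (V x)
      + Real.sin t • (V x + -Real.sin t • V (V x) + (1 - Real.cos t) • -V x)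
      + (1 - Real.cos t) • (V (V x) + -Real.sin t • -V x + (1 - Real.cos t) • -V (V x))
      = x + (1 - (Real.sin t ^ 2 + Real.cos t ^ 2)) • V (V x) := by module
  rw [h2, h, sub_self, zero_smul, add_zero]

/-- The flow of a complex linear skew-adjoint field as a unitary map. -/
def flowUnitary {V : Cn n →L[ℝ] Cn n} (hskew : ∀ x y, inner ℝ (V x) y = -inner ℝ x (V y))
    (hV : ∀ x, V (V (V x)) = -V x) (hC : ∀ (c : ℂ) x, V (c • x) = c • V x) (t : ℝ) :
    Cn n ≃ₗᵢ[ℂ] Cn n :=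
  LinearIsometry.toLinearIsometryEquiv
    ⟨{ toFun := flow V t
       map_add' := fun x y => map_add _ x y
       map_smul' := fun c x => by
        simp only [flow_apply, hC, smul_add, RingHom.id_apply]
        rw [smul_comm c (Real.sin t) (V x), smul_comm c (1 - Real.cos t) (V (V x))] },
      norm_flow hskew hV t⟩ rfl

theorem hasDerivAt_comp_neg {f : ℝ → ℂ} {f' : ℂ} (h : HasDerivAt f f' 0) :
    HasDerivAt (fun t => f (-t)) (-f') 0 := by
  have h' : HasDerivAt f f' (-0) := by rwa [neg_zero]
  exact (h'.scomp (0 : ℝ) (hasDerivAt_neg (0 : ℝ))).congr_deriv (by simp)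

/-- The operator `A` commutes with unitary maps. -/
def CommutesWithUnitary (A : Smooth n →ₗ[ℂ] Smooth n) : Prop :=
  ∀ (U : Cn n ≃ₗᵢ[ℂ] Cn n) (F G : Smooth n), (∀ z, G z = F (unitaryDiffeo U z)) →
    ∀ z, A G z = A F (unitaryDiffeo U z)

/-- A self-adjoint operator that commutes with unitary maps defines an infinitesimally unitarily
invariant form. -/
theorem rotInvariant_opForm {A : Smooth n →ₗ[ℂ] Smooth n} (hA : IsFormallySelfAdjoint A)
    (hU : CommutesWithUnitary A) : RotInvariant (opForm A) := by
  have key : ∀ (V : Cn n →L[ℝ] Cn n), (∀ x y, inner ℝ (V x) y = -inner ℝ x (V y)) →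
      (∀ x, V (V (V x)) = -V x) → (∀ (c : ℂ) x, V (c • x) = c • V x) →
      ∀ X : CPoly n → CPoly n, (∀ p z, fderiv ℝ (evalAt p) z (V z) = evalAt (X p) z) →
      ∀ F G, opForm A (X F) G = -opForm A F (X G) := by
    intro V h1 h2 h3 X hX F G
    have hsm : ∀ p : CPoly n, ∀ z : Sph n, ContDiffAt ℝ 1 (evalAt p) (z : Cn n) := fun p z =>
      ((contDiff_evalAt p).of_le (by simp)).contDiffAt
    have d1 := hasDerivAt_integral_flow h1 h2 (hsm F)
      (transpose A (polySmooth n G)).continuous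
    have d2 := hasDerivAt_integral_flow h1 h2 (hsm G) (A (polySmooth n F)).continuous
    have d3 : HasDerivAt (fun t : ℝ => ∫ z : Sph n, evalAt G (flow V (-t) z)
        * A (polySmooth n F) z ∂(crVolume n))
        (-∫ z : Sph n, fderiv ℝ (evalAt G) z (V z) * A (polySmooth n F) z ∂(crVolume n)) 0 :=
      hasDerivAt_comp_neg d2
    have heq : (fun t => ∫ z : Sph n, evalAt F (flow V t z) * transpose A (polySmooth n G) z
        ∂(crVolume n)) = fun t => ∫ z : Sph n, evalAt G (flow V (-t) z)
        * A (polySmooth n F) z ∂(crVolume n) := by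
      funext t
      set U := flowUnitary h1 h2 h3 t with hUdef
      let F' : Smooth n := ⟨fun z => polySmooth n F (unitaryDiffeo U z),
        (polySmooth n F).2.comp (unitaryDiffeo U).contMDiff⟩
      have e1 := hA.integral_mul F' (polySmooth n G)
      have e2 := hU U (polySmooth n F) F' fun z => rfl
      have e3 : ∫ z : Sph n, evalAt F (flow V t z) * transpose A (polySmooth n G) z ∂(crVolume n)
        = ∫ z, F' z * transpose A (polySmooth n G) z ∂(crVolume n) := rfl
      rw [e3, ← e1]
      simp only [e2]
      have hc : Continuous fun z : Sph n => evalAt G (flow V (-t) z) * A (polySmooth n F) z :=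
        ((contDiff_evalAt G).continuous.comp ((flow V (-t)).continuous.comp
          continuous_subtype_val)).mul (A (polySmooth n F)).continuous
      rw [← integral_comp_sphMap (flowEquiv h1 h2 t) hc]
      congr 1; funext z
      have e4 : (sphMap (flowEquiv h1 h2 t) (flowEquiv h1 h2 t).norm_map z) = unitaryDiffeo U z :=
        rfl
      have e5 : flow V (-t) (unitaryDiffeo U z : Cn n) = z := flow_neg_apply h2 t z
      rw [e4, e5, polySmooth_apply, mul_comm]
    rw [heq] at d1
    have h := d1.unique d3
    simp only [hX] at h
    rw [opForm_eq_transpose hA, h, opForm_apply]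
    simp only [mul_comm]
  refine rotInvariant_of_generators ?_ ?_
  · intro l m c hlm hc F G
    refine key (unitaryField l m c) (unitaryField_skew l m c) (unitaryField_cube hlm hc) ?_
      (fun p => c • rot m l p - conj c • rot l m p) (fun p z => fderiv_evalAt_unitaryField l m c p z)
      F G
    intro d x
    ext i
    simp only [unitaryField_apply, PiLp.smul_apply, smul_eq_mul]
    split_ifs <;> ring
  · intro l F G
    refine key (phaseField l) (phaseField_skew l) (phaseField_cube l) ?_
      (fun p => Complex.I • rot l l p) (fun p z => fderiv_evalAt_phaseField l p z) F G
    intro d x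
    ext i
    simp only [phaseField_apply, PiLp.smul_apply, smul_eq_mul]
    split_ifs <;> ring

/-- A self-adjoint operator that intertwines the actions of the boosts of weights `(a, b)` and
`(n + 1 - b, n + 1 - a)` defines an infinitesimally Möbius invariant form. -/
theorem boostInvariant_opForm (hn : 1 ≤ n) {A : Smooth n →ₗ[ℂ] Smooth n}
    (hA : IsFormallySelfAdjoint A) {a b : ℂ}
    (hB : ∀ (l : Fin (n + 1)) (s : ℝ) (hs : |s| < 1) (F : CPoly n), ∃ G : Smooth n,
      (∀ z, G z = boostPoly a b l F s (z : Cn n)) ∧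
      ∀ z, A G z = boostWeight (n + 1 - b) (n + 1 - a) s ((z : Cn n) l)
        * A (polySmooth n F) (boostSph l s hs z)) : BoostInvariant a b (opForm A) := by
  intro l F G
  have h0 : ‖((0 : ℝ) : ℂ)‖ < 1 := by simp
  have d1 := (hasDerivAt_boostPairing a b l (transpose A (polySmooth n G)).continuous F h0).comp_ofReal
  have d2 := (hasDerivAt_boostPairing b a l (A (polySmooth n F)).continuous G h0).comp_ofReal
  have d3 : HasDerivAt (fun s : ℝ => boostPairing b a l (A (polySmooth n F)) G ((-s : ℝ) : ℂ))
      (-(boostPairing b a l (A (polySmooth n F)) (boostField b a l G) ((0 : ℝ) : ℂ)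
        / (1 - ((0 : ℝ) : ℂ) ^ 2))) 0 := hasDerivAt_comp_neg d2
  have heq : (fun s : ℝ => boostPairing a b l (transpose A (polySmooth n G)) F (s : ℂ))
      =ᶠ[nhds 0] fun s : ℝ => boostPairing b a l (A (polySmooth n F)) G ((-s : ℝ) : ℂ) := by
    filter_upwards [Metric.ball_mem_nhds (0 : ℝ) one_pos] with s hs
    have hs1 : |s| < 1 := by simpa using hs
    have hs2 : |-s| < 1 := by rwa [abs_neg]
    obtain ⟨H, h1, h2⟩ := hB l s hs1 F
    have e1 := hA.integral_mul H (polySmooth n G)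
    simp only [h1, h2] at e1
    rw [boostPairing, ← e1, boostPairing]
    refine (integral_boost_mul hn a b l hs1 hs2 (A (polySmooth n F)).continuous
      (polySmooth n G).continuous).trans ?_
    congr 1; funext z
    rw [boostPoly_ofReal _ _ _ _ hs2, polySmooth_apply, mul_comm]
  have h := (d1.congr_of_eventuallyEq heq.symm).unique d3
  simp only [Complex.ofReal_zero, boostPairing_zero, ne_eq, OfNat.ofNat_ne_zero, not_false_eq_true,
    zero_pow, sub_zero, div_one] at h
  rw [opForm_eq_transpose hA, h, opForm_apply]
  simp only [mul_comm]

/-! ### The eigenvalues -/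

theorem lam_succ {γ w : ℝ} (hreg : ∀ m : ℕ, γ - w ≠ -(m : ℝ)) (j : ℕ) :
    (-w + j) * lam γ w (j + 1) = (γ - w + j) * lam γ w j := by
  have h1 : (j : ℝ) + γ - w ≠ 0 := fun h => hreg j (by linarith)
  have h2 : Real.Gamma ((j + 1 : ℕ) + γ - w) = (j + γ - w) * Real.Gamma (j + γ - w) := by
    rw [← Real.Gamma_add_one h1]; congr 1; push_cast; ring
  rw [lam, lam, h2]
  rcases eq_or_ne ((j : ℝ) - w) 0 with h3 | h3
  · -- at the pole of `Γ (j - w)` both sides vanish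
    rw [h3, Real.Gamma_zero, div_zero, mul_zero, show -w + (j : ℝ) = 0 by linarith, zero_mul]
  · have h4 : Real.Gamma ((j + 1 : ℕ) - w) = (j - w) * Real.Gamma (j - w) := by
      rw [← Real.Gamma_add_one h3]; congr 1; push_cast; ring
    rw [h4, show -w + (j : ℝ) = j - w by ring, mul_div_assoc', mul_div_mul_left _ _ h3]
    ring

theorem lam_ne_zero {γ w : ℝ} (hreg : ∀ m : ℕ, γ - w ≠ -(m : ℝ)) {j : ℕ}
    (hj : ∀ m : ℕ, (j : ℝ) - w ≠ -(m : ℝ)) : lam γ w j ≠ 0 := by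
  refine div_ne_zero (Real.Gamma_ne_zero fun m h => hreg (m + j) ?_) (Real.Gamma_ne_zero hj)
  push_cast; linarith

theorem exists_lam_ne_zero {γ w : ℝ} (hreg : ∀ m : ℕ, γ - w ≠ -(m : ℝ)) : ∃ j, lam γ w j ≠ 0 := by
  obtain ⟨j, hj⟩ := exists_nat_gt w
  refine ⟨j, lam_ne_zero hreg fun m h => ?_⟩
  have : (0 : ℝ) ≤ m := m.cast_nonneg
  linarith

theorem mem_sphHarm_iff {j k : ℕ} {Y : Smooth n} :
    Y ∈ sphHarm n j k ↔ ∃ p ∈ harm n j k, Y = polySmooth n p := by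
  constructor
  · rintro ⟨p, hp, h⟩
    exact ⟨p, mem_harm.2 (isHarmonicBihomogeneous_iff.1 hp), Smooth.ext h⟩
  · rintro ⟨p, hp, rfl⟩
    exact ⟨p, isHarmonicBihomogeneous_iff.2 (mem_harm.1 hp), fun z => rfl⟩

theorem polySmooth_mem_sphHarm {j k : ℕ} {p : CPoly n} (hp : p ∈ harm n j k) :
    polySmooth n p ∈ sphHarm n j k := mem_sphHarm_iff.2 ⟨p, hp, rfl⟩

/-- An operator with invariant form acts by the expected scalars on spherical harmonics. -/
theorem exists_complex_eigenvalue (hn : 1 ≤ n) {γ w w' : ℝ} (hγn : γ < n + 1)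
    (hsum : w + w' + n + 1 = γ) (hreg : ∀ m : ℕ, γ - w ≠ -(m : ℝ))
    (hreg' : ∀ m : ℕ, γ - w' ≠ -(m : ℝ)) {A : Smooth n →ₗ[ℂ] Smooth n}
    (hrot : RotInvariant (opForm A))
    (hboost : BoostInvariant ((-w : ℝ) : ℂ) ((-w' : ℝ) : ℂ) (opForm A)) :
    ∃ c : ℂ, ∀ j k, ∀ p ∈ harm n j k,
      A (polySmooth n p) = (c * lam γ w j * lam γ w' k) • polySmooth n p := by
  have hcast : ∀ x : ℝ, ∀ j : ℕ, x + j ≠ 0 → ((x : ℝ) : ℂ) + j ≠ 0 := fun x j h => by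
    exact_mod_cast h
  have e1 : (n : ℂ) + 1 - ((-w' : ℝ) : ℂ) = ((γ - w : ℝ) : ℂ) := by
    rw [← hsum]; push_cast; ring
  have e2 : (n : ℂ) + 1 - ((-w : ℝ) : ℂ) = ((γ - w' : ℝ) : ℂ) := by
    rw [← hsum]; push_cast; ring
  have hab : (∀ k : ℕ, -w + (k : ℝ) ≠ 0) ∨ ∀ k : ℕ, -w' + (k : ℝ) ≠ 0 := by
    by_contra! h
    obtain ⟨⟨k, hk⟩, k', hk'⟩ := h
    have h1 : (0 : ℝ) ≤ k := k.cast_nonneg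
    have h2 : (0 : ℝ) ≤ k' := k'.cast_nonneg
    linarith
  obtain ⟨c, hc⟩ := exists_eq_mul_of_boostInvariant hn isSphereMean_meanL hboost hrot
    (rhoInvariant_opForm A)
    (hab.imp (fun h k => hcast _ _ (h k)) fun h k => hcast _ _ (h k))
    (fun j => by rw [e1]; exact hcast _ _ fun h => hreg j (by linarith))
    (fun j => by rw [e2]; exact hcast _ _ fun h => hreg' j (by linarith))
    (x := fun j => (lam γ w j : ℂ)) (y := fun k => (lam γ w' k : ℂ))
    (fun j => by rw [e1]; exact_mod_cast lam_succ hreg j)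
    (fun k => by rw [e2]; exact_mod_cast lam_succ hreg' k)
    ((exists_lam_ne_zero hreg).imp fun j h => by exact_mod_cast h)
    ((exists_lam_ne_zero hreg').imp fun j h => by exact_mod_cast h)
  refine ⟨c, fun j k p hp => ?_⟩
  set μ : ℂ := c * lam γ w j * lam γ w' k with hμ
  have hz : (fun z => A (polySmooth n p) z - μ * evalAt p (z : Cn n)) = 0 := by
    have c1 : Continuous fun z : Sph n => μ * evalAt p (z : Cn n) :=
      continuous_const.mul (continuous_evalAt p)
    refine eq_zero_of_integral_mul_harm hn ((A (polySmooth n p)).continuous.sub c1)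
      fun j' k' q hq => ?_
    simp only [sub_mul]
    rw [integral_sub_sphere (continuous_mul_evalAt (A (polySmooth n p)).continuous q)
      (continuous_mul_evalAt c1 q), ← opForm_apply]
    simp only [mul_assoc μ, ← evalAt_mul]
    rw [integral_const_mul, ← meanL_apply]
    by_cases hjk : j' = k ∧ k' = j
    · obtain ⟨rfl, rfl⟩ := hjk
      rw [hc k' j' p hp q hq, hμ, sub_self]
    · have h1 := hrot.eq_zero hn hp hq hjk
      have h2 := isSphereMean_meanL.rotInvariant.eq_zero hn hp hq hjk
      rw [mulForm_apply] at h2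
      rw [h1, h2, mul_zero, sub_zero]
  exact Smooth.ext fun z => sub_eq_zero.1 (congrFun hz z)

theorem integral_norm_sq_ne_zero {F : Smooth n} (h : F ≠ 0) :
    ∫ z, F z * conj (F z) ∂(crVolume n) ≠ 0 := by
  intro h0
  apply h
  have : ∀ z, F z * conj (F z) = ((‖F z‖ ^ 2 : ℝ) : ℂ) := fun z => by
    rw [Complex.mul_conj, Complex.normSq_eq_norm_sq]
  simp only [this, integral_complex_ofReal] at h0
  have := eq_zero_of_integral_norm_sq F.continuous (by exact_mod_cast h0)
  exact Smooth.ext fun z => congrFun this z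

/-- The eigenvalues of a formally self-adjoint operator are real. -/
theorem IsFormallySelfAdjoint.conj_eigenvalue {A : Smooth n →ₗ[ℂ] Smooth n}
    (hA : IsFormallySelfAdjoint A) {F : Smooth n} (hF : F ≠ 0) {μ : ℂ} (h : A F = μ • F) :
    conj μ = μ := by
  have h1 := hA F F
  rw [h] at h1
  have e1 : ∀ z, (μ • F) z = μ * F z := fun z => rfl
  simp only [e1, map_mul, mul_assoc, mul_left_comm _ (conj μ)] at h1
  rw [integral_const_mul, integral_const_mul] at h1
  exact (mul_right_cancel₀ (integral_norm_sq_ne_zero hF) h1).symm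

theorem polySmooth_ne_zero {p q : CPoly n} (h : meanL n (p * q) ≠ 0) : polySmooth n p ≠ 0 := by
  intro h0
  apply h
  have : ∀ z : Sph n, evalAt p (z : Cn n) = 0 := fun z => congrArg (fun F : Smooth n => F z) h0
  rw [meanL_apply]
  simp [evalAt_mul, this]

/-- The constant of proportionality of the eigenvalues is real: there is a nonzero eigenvalue on
holomorphic or on antiholomorphic polynomials. -/
theorem exists_real_eigenvalue (hn : 1 ≤ n) {γ w w' : ℝ} (hγn : γ < n + 1)
    (hsum : w + w' + n + 1 = γ) (hreg : ∀ m : ℕ, γ - w ≠ -(m : ℝ))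
    (hreg' : ∀ m : ℕ, γ - w' ≠ -(m : ℝ)) {A : Smooth n →ₗ[ℂ] Smooth n}
    (hA : IsFormallySelfAdjoint A) (hrot : RotInvariant (opForm A))
    (hboost : BoostInvariant ((-w : ℝ) : ℂ) ((-w' : ℝ) : ℂ) (opForm A)) :
    ∃ c : ℝ, ∀ (j k : ℕ), ∀ Y ∈ sphHarm n j k,
      A Y = ((c * lam γ w j * lam γ w' k : ℝ) : ℂ) • Y := by
  obtain ⟨c, hc⟩ := exists_complex_eigenvalue hn hγn hsum hreg hreg' hrot hboost
  have hreal : ∀ j k, ∀ p ∈ harm n j k, polySmooth n p ≠ 0 → lam γ w j ≠ 0 → lam γ w' k ≠ 0 →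
      conj c = c := by
    intro j k p hp h0 h1 h2
    have := hA.conj_eigenvalue h0 (hc j k p hp)
    simp only [map_mul, Complex.conj_ofReal] at this
    exact mul_right_cancel₀ (Complex.ofReal_ne_zero.2 h1)
      (mul_right_cancel₀ (Complex.ofReal_ne_zero.2 h2) this)
  have hcr : conj c = c := by
    by_cases hw : ∀ m : ℕ, ((0 : ℕ) : ℝ) - w ≠ -(m : ℝ)
    · obtain ⟨k, hk⟩ := exists_lam_ne_zero hreg'
      refine hreal 0 k _ (wv_pow_mem_harm 0 k) (polySmooth_ne_zero (q := zv 0 ^ k) ?_)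
        (lam_ne_zero hreg hw) hk
      rw [mul_comm]
      exact isSphereMean_meanL.zv_pow_mul_wv_pow_ne_zero 0 k
    · have hw' : ∀ m : ℕ, ((0 : ℕ) : ℝ) - w' ≠ -(m : ℝ) := by
        push Not at hw
        obtain ⟨m, hm⟩ := hw
        intro m' hm'
        have h1 : (0 : ℝ) ≤ m := m.cast_nonneg
        have h2 : (0 : ℝ) ≤ m' := m'.cast_nonneg
        push_cast at hm hm'
        linarith
      obtain ⟨j, hj⟩ := exists_lam_ne_zero hreg
      exact hreal j 0 _ (zv_pow_mem_harm 0 j) (polySmooth_ne_zero (q := wv 0 ^ j)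
        (isSphereMean_meanL.zv_pow_mul_wv_pow_ne_zero 0 j)) hj (lam_ne_zero hreg' hw')
  obtain ⟨r, rfl⟩ := Complex.conj_eq_iff_real.1 hcr
  refine ⟨r, fun j k Y hY => ?_⟩
  obtain ⟨p, hp, rfl⟩ := mem_sphHarm_iff.1 hY
  rw [hc j k p hp]
  push_cast
  rfl

/-! ### The intertwining relation -/

/-- The intertwining relation for a single transformation `τ` and a single factor `J`. -/
def Intertwines (γ w w' : ℝ) (A : Smooth n →ₗ[ℂ] Smooth n) (τ : SphDiffeo n) (J : Sph n → ℂ) :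
    Prop :=
  ∀ F G : Smooth n, (∀ z, G z = mixedPow (J z) (-w) (-w') * F (τ z)) →
    ∀ z, A G z = mixedPow (J z) (γ - w) (γ - w') * A F (τ z)

theorem IsIntertwining.intertwines {γ w w' : ℝ} {h : ∃ m : ℤ, w - w' = m}
    {A : Smooth n →ₗ[ℂ] Smooth n} (hA : IsIntertwining γ w w' h A) {τ : SphDiffeo n}
    (hτ : IsCRAut τ) {J : Smooth n} (hJ : IsConformalFactor τ J) : Intertwines γ w w' A τ J := by
  intro F G hG z
  have h1 := hA τ hτ J hJ F
  have h2 : G = twist τ J hJ.ne_zero (-w) (-w')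
      (by obtain ⟨m, hm⟩ := h; exact ⟨-m, by push_cast; linarith⟩) F := Smooth.ext hG
  rw [h2, ← h1]
  rfl

theorem isIntertwining_of_intertwines {γ w w' : ℝ} {h : ∃ m : ℤ, w - w' = m}
    {A : Smooth n →ₗ[ℂ] Smooth n} (hA : ∀ τ : SphDiffeo n, IsCRAut τ → ∀ J : Smooth n,
      IsConformalFactor τ J → Intertwines γ w w' A τ J) : IsIntertwining γ w w' h A :=
  fun τ hτ J hJ F => Smooth.ext fun z => (hA τ hτ J hJ F _ (fun _ => rfl) z).symm

theorem mixedPow_of_norm_eq_one {κ : ℂ} (h : ‖κ‖ = 1) (a b : ℝ) :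
    mixedPow κ a b = κ ^ ((a - b : ℝ) : ℂ) := by
  rw [mixedPow, h, Real.one_rpow, Complex.ofReal_one, one_mul]

theorem mixedPow_ne_zero {J : ℂ} (h : J ≠ 0) (a b : ℝ) : mixedPow J a b ≠ 0 := by
  refine mul_ne_zero (Complex.ofReal_ne_zero.2 (Real.rpow_pos_of_pos (norm_pos_iff.2 h) _).ne') ?_
  rw [Complex.cpow_def_of_ne_zero h]
  exact Complex.exp_ne_zero _

/-- For a constant factor of modulus one the powers on both sides of the intertwining relation
agree. -/
theorem intertwines_unitary_iff {γ w w' : ℝ} {A : Smooth n →ₗ[ℂ] Smooth n} {τ : SphDiffeo n}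
    {κ : ℂ} (h : ‖κ‖ = 1) : Intertwines γ w w' A τ (fun _ => κ) ↔
      ∀ F G : Smooth n, (∀ z, G z = F (τ z)) → ∀ z, A G z = A F (τ z) := by
  have hκ : κ ≠ 0 := by rintro rfl; simp at h
  have e : mixedPow κ (γ - w) (γ - w') = mixedPow κ (-w) (-w') := by
    rw [mixedPow_of_norm_eq_one h, mixedPow_of_norm_eq_one h]; congr 2; ring
  have h0 := mixedPow_ne_zero hκ (-w) (-w')
  set μ := mixedPow κ (-w) (-w') with hμ
  constructor
  · intro hA F G hG z
    have := hA F (μ • G) (fun z => by rw [← hG]; rfl) z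
    rw [e, map_smul] at this
    exact mul_left_cancel₀ h0 this
  · intro hA F G hG z
    have := hA (μ • F) G hG z
    rw [map_smul] at this
    rw [e]
    exact this

theorem IsIntertwining.intertwines_unitary {γ w w' : ℝ} {h : ∃ m : ℤ, w - w' = m}
    {A : Smooth n →ₗ[ℂ] Smooth n} (hA : IsIntertwining γ w w' h A) {U : Cn n ≃ₗᵢ[ℂ] Cn n} {κ : ℂ}
    (hJ : IsConformalFactor (unitaryDiffeo U) (constSmooth κ)) :
    Intertwines γ w w' A (unitaryDiffeo U) fun _ => κ :=
  hA.intertwines (J := constSmooth κ) (isCRAut_unitaryDiffeo U) hJ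

theorem IsIntertwining.commutesWithUnitary {γ w w' : ℝ} {h : ∃ m : ℤ, w - w' = m}
    {A : Smooth n →ₗ[ℂ] Smooth n} (hA : IsIntertwining γ w w' h A) : CommutesWithUnitary A :=
  fun U => (exists_isConformalFactor_unitaryDiffeo U).elim fun _ hκ =>
    (intertwines_unitary_iff hκ.1).1 (hA.intertwines_unitary hκ.2)

theorem mixedPow_boostJ {s : ℝ} (hs : |s| < 1) (l : Fin (n + 1)) {a b : ℝ}
    (h : ∃ m : ℤ, a - b = m) (z : Sph n) :
    mixedPow (boostJ l s hs z) a b = boostWeight a b s ((z : Cn n) l) :=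
  (boostWeight_eq_mixedPow hs (norm_coord_le z l) h).symm

/-- The first half of the classification: intertwining operators are determined up to a real
factor. -/
theorem IsIntertwining.exists_real_eigenvalue (hn : 1 ≤ n) {γ w w' : ℝ} (hγn : γ < n + 1)
    (hsum : w + w' + n + 1 = γ) {h : ∃ m : ℤ, w - w' = m} (hreg : ∀ m : ℕ, γ - w ≠ -(m : ℝ))
    (hreg' : ∀ m : ℕ, γ - w' ≠ -(m : ℝ)) {A : Smooth n →ₗ[ℂ] Smooth n}
    (hA : IsFormallySelfAdjoint A) (hI : IsIntertwining γ w w' h A) :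
    ∃ c : ℝ, ∀ (j k : ℕ), ∀ Y ∈ sphHarm n j k,
      A Y = ((c * lam γ w j * lam γ w' k : ℝ) : ℂ) • Y := by
  have h1 : ∃ m : ℤ, -w - -w' = m := by
    obtain ⟨m, hm⟩ := h; exact ⟨-m, by push_cast; linarith⟩
  have h2 : ∃ m : ℤ, γ - w - (γ - w') = m := by
    obtain ⟨m, hm⟩ := h; exact ⟨-m, by push_cast; linarith⟩
  have e1 : (n : ℂ) + 1 - ((-w' : ℝ) : ℂ) = ((γ - w : ℝ) : ℂ) := by
    rw [← hsum]; push_cast; ring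
  have e2 : (n : ℂ) + 1 - ((-w : ℝ) : ℂ) = ((γ - w' : ℝ) : ℂ) := by
    rw [← hsum]; push_cast; ring
  refine CRSphere.exists_real_eigenvalue hn hγn hsum hreg hreg' hA
    (rotInvariant_opForm hA hI.commutesWithUnitary)
    (boostInvariant_opForm hn hA fun l s hs F => ?_)
  have hJ := isConformalFactor_boostDiffeo (n := n) l hs
  refine ⟨twist (boostDiffeo l s hs) (boostJ l s hs) hJ.ne_zero (-w) (-w') h1 (polySmooth n F),
    fun z => ?_, fun z => ?_⟩
  · rw [boostPoly_ofReal _ _ _ _ hs, ← mixedPow_boostJ hs l h1]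
    rfl
  · rw [e1, e2, ← mixedPow_boostJ hs l h2]
    exact hI.intertwines (isCRAut_boostDiffeo l hs) hJ _ _ (fun _ => rfl) z

/-! ### Diagonal operators -/

/-- The operator `Q` acts on harmonic polynomials of bidegree `(j, k)` as the real number `μ j k`. -/
def IsDiagonal (Q : Smooth n →ₗ[ℂ] Smooth n) (μ : ℕ → ℕ → ℝ) : Prop :=
  ∀ j k, ∀ p ∈ harm n j k, Q (polySmooth n p) = (μ j k : ℂ) • polySmooth n p

theorem conjSmooth_polySmooth (p : CPoly n) :
    conjSmooth (polySmooth n p) = polySmooth n (conjPoly p) :=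
  Smooth.ext fun z => (evalAt_conjPoly p z).symm

theorem IsDiagonal.transpose_apply {Q : Smooth n →ₗ[ℂ] Smooth n} {μ : ℕ → ℕ → ℝ}
    (h : IsDiagonal Q μ) {j k : ℕ} {p : CPoly n} (hp : p ∈ harm n j k) (z : Sph n) :
    transpose Q (polySmooth n p) z = μ k j * evalAt p (z : Cn n) := by
  rw [transpose, conjSmooth_polySmooth, h k j _ (conjPoly_mem_harm hp), conjSmooth_apply]
  have : ((μ k j : ℂ) • polySmooth n (conjPoly p)) z = μ k j * evalAt (conjPoly p) (z : Cn n) := rfl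
  rw [this, map_mul, Complex.conj_ofReal, evalAt_conjPoly, Complex.conj_conj]

theorem eq_of_integral_mul_harm (hn : 1 ≤ n) {f g : Sph n → ℂ} (hf : Continuous f)
    (hg : Continuous g) (h : ∀ j k, ∀ p ∈ harm n j k, ∫ z : Sph n, f z * evalAt p z ∂(crVolume n)
      = ∫ z : Sph n, g z * evalAt p z ∂(crVolume n)) (z : Sph n) : f z = g z := by
  have := eq_zero_of_integral_mul_harm hn (f := fun z => f z - g z) (hf.sub hg) fun j k p hp => by
    simp only [sub_mul]
    rw [integral_sub_sphere (continuous_mul_evalAt hf p) (continuous_mul_evalAt hg p), h j k p hp,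
      sub_self]
  exact sub_eq_zero.1 (congrFun this z)

/-- Diagonal operators whose eigenvalues satisfy the two recursions intertwine the boosts. -/
theorem IsDiagonal.intertwines_boost (hn : 1 ≤ n) {γ w w' : ℝ} (hsum : w + w' + n + 1 = γ)
    (hint : ∃ m : ℤ, w - w' = m) {Q : Smooth n →ₗ[ℂ] Smooth n} {μ : ℕ → ℕ → ℝ}
    (hQ : IsDiagonal Q μ) (hA : IsFormallySelfAdjoint Q)
    (h1 : ∀ j k : ℕ, (-w + j) * μ (j + 1) k = (γ - w + j) * μ j k)
    (h2 : ∀ j k : ℕ, (-w' + k) * μ j (k + 1) = (γ - w' + k) * μ j k) (l : Fin (n + 1)) {s : ℝ}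
    (hs : |s| < 1) : Intertwines γ w w' Q (boostDiffeo l s hs) (boostJ l s hs) := by
  have hs' : |-s| < 1 := by rwa [abs_neg]
  have i1 : ∃ m : ℤ, -w - -w' = m := by
    obtain ⟨m, hm⟩ := hint; exact ⟨-m, by push_cast; linarith⟩
  have i2 : ∃ m : ℤ, γ - w - (γ - w') = m := by
    obtain ⟨m, hm⟩ := hint; exact ⟨-m, by push_cast; linarith⟩
  have i3 : ∃ m : ℤ, -w' - -w = m := by
    obtain ⟨m, hm⟩ := hint; exact ⟨m, by linarith⟩
  have e1 : (n : ℂ) + 1 - ((-w' : ℝ) : ℂ) = ((γ - w : ℝ) : ℂ) := by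
    rw [← hsum]; push_cast; ring
  have e2 : (n : ℂ) + 1 - ((-w : ℝ) : ℂ) = ((γ - w' : ℝ) : ℂ) := by
    rw [← hsum]; push_cast; ring
  have e3 : (n : ℂ) + 1 - ((γ - w' : ℝ) : ℂ) = ((-w : ℝ) : ℂ) := by rw [← e2]; ring
  have e4 : (n : ℂ) + 1 - ((γ - w : ℝ) : ℂ) = ((-w' : ℝ) : ℂ) := by rw [← e1]; ring
  -- the transposed operator on the translates of harmonic polynomials
  have key : ∀ j k, ∀ p ∈ harm n j k, ∀ H : Smooth n, (∀ z, H z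
      = boostPoly ((-w' : ℝ) : ℂ) ((-w : ℝ) : ℂ) l p ((-s : ℝ) : ℂ) (z : Cn n)) →
      ∀ z, transpose Q H z = μ k j * boostPoly ((γ - w' : ℝ) : ℂ) ((γ - w : ℝ) : ℂ) l p
        ((-s : ℝ) : ℂ) (z : Cn n) := by
    intro j k p hp H hH z
    have hc := continuous_boostPoly (n := n) ((γ - w' : ℝ) : ℂ) ((γ - w : ℝ) : ℂ) l p
      (norm_ofReal_lt_one hs')
    refine eq_of_integral_mul_harm hn (transpose Q H).continuous (g := fun z : Sph n => μ k j
      * boostPoly ((γ - w' : ℝ) : ℂ) ((γ - w : ℝ) : ℂ) l p ((-s : ℝ) : ℂ) (z : Cn n))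
      (continuous_const.mul hc) (fun k' j' q hq => ?_) z
    have t1 := hA.integral_mul (polySmooth n q) H
    rw [hQ _ _ q hq] at t1
    have t2 : ∀ z, ((μ k' j' : ℂ) • polySmooth n q) z * H z = μ k' j' * (boostPoly ((-w' : ℝ) : ℂ)
      ((-w : ℝ) : ℂ) l p ((-s : ℝ) : ℂ) (z : Cn n) * evalAt q z) := fun z => by
      rw [hH]
      have : ((μ k' j' : ℂ) • polySmooth n q) z = μ k' j' * evalAt q (z : Cn n) := rfl
      rw [this]; ring
    simp only [t2] at t1
    rw [integral_const_mul] at t1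
    have t3 := mul_boostPairing_eq hn ((-w' : ℝ) : ℂ) ((-w : ℝ) : ℂ) l
      (μ := fun j k => (μ k j : ℂ)) (fun j k => by rw [e2]; exact_mod_cast h2 k j)
      (fun j k => by rw [e1]; exact_mod_cast h1 k j) hp hq (norm_ofReal_lt_one hs')
    rw [boostPairing, boostPairing, e1, e2] at t3
    simp only [mul_assoc (μ k j : ℂ)]
    rw [integral_const_mul, ← t3, t1]
    simp only [polySmooth_apply, mul_comm]
  intro F G hG z
  have hG' : ∀ z, G z = boostWeight ((-w : ℝ) : ℂ) ((-w' : ℝ) : ℂ) s ((z : Cn n) l)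
      * F (boostSph l s hs z) := fun z => by rw [hG, mixedPow_boostJ hs l i1]; rfl
  rw [mixedPow_boostJ hs l i2]
  refine eq_of_integral_mul_harm hn (Q G).continuous (g := fun z : Sph n =>
    boostWeight ((γ - w : ℝ) : ℂ) ((γ - w' : ℝ) : ℂ) s ((z : Cn n) l) * Q F (boostSph l s hs z))
    ((continuous_boostWeight _ _ l hs).mul ((Q F).continuous.comp (continuous_boostSph l hs)))
    (fun j k p hp => ?_) z
  have t1 := hA.integral_mul G (polySmooth n p)
  simp only [hQ.transpose_apply hp, hG', mul_left_comm _ (μ k j : ℂ)] at t1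
  rw [integral_const_mul] at t1
  have t2 := integral_boost_mul hn ((γ - w : ℝ) : ℂ) ((γ - w' : ℝ) : ℂ) l hs hs' F.continuous
    (continuous_evalAt p)
  rw [e3, e4] at t2
  have t4 := integral_boost_mul hn ((-w : ℝ) : ℂ) ((-w' : ℝ) : ℂ) l hs hs' (Q F).continuous
    (continuous_evalAt p)
  rw [e1, e2] at t4
  have hJ := isConformalFactor_boostDiffeo (n := n) l hs'
  set H : Smooth n := twist (boostDiffeo l (-s) hs') (boostJ l (-s) hs') hJ.ne_zero (-w') (-w) i3
    (polySmooth n p) with hHdef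
  have hH : ∀ z, H z = boostPoly ((-w' : ℝ) : ℂ) ((-w : ℝ) : ℂ) l p ((-s : ℝ) : ℂ) (z : Cn n) := by
    intro z
    rw [boostPoly_ofReal _ _ _ _ hs', ← mixedPow_boostJ hs' l i3]
    rfl
  have t5 := hA.integral_mul F H
  have t6 : ∀ z : Sph n, boostWeight ((-w' : ℝ) : ℂ) ((-w : ℝ) : ℂ) ((-s : ℝ) : ℂ) ((z : Cn n) l)
      * evalAt p (boostSph l (-s) hs' z : Cn n) = H z := fun z => by
    rw [hH, boostPoly_ofReal _ _ _ _ hs']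
  simp only [t6] at t4
  have t7 : ∫ z, Q G z * evalAt p (z : Cn n) ∂(crVolume n) = _ := t1
  rw [t7, t2, t4, t5, ← integral_const_mul]
  congr 1; funext z
  rw [key j k p hp H hH, boostPoly_ofReal _ _ _ _ hs']
  ring

/-! ### Unitary substitutions in harmonic polynomials -/

/-- The matrix of a unitary map. -/
def unitaryMatrix (U : Cn n ≃ₗᵢ[ℂ] Cn n) (l m : Fin (n + 1)) : ℂ := U (EuclideanSpace.single m 1) l

theorem unitary_apply (U : Cn n ≃ₗᵢ[ℂ] Cn n) (z : Cn n) (l : Fin (n + 1)) :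
    U z l = ∑ m, unitaryMatrix U l m * z m := by
  have hz : z = ∑ m, z m • EuclideanSpace.single m (1 : ℂ) := by
    ext i; simp [Pi.single_apply]
  conv_lhs => rw [hz, map_sum]
  simp only [map_smul, WithLp.ofLp_sum, Finset.sum_apply, PiLp.smul_apply, smul_eq_mul]
  exact Finset.sum_congr rfl fun m _ => mul_comm _ _

theorem unitaryMatrix_symm (U : Cn n ≃ₗᵢ[ℂ] Cn n) (l m : Fin (n + 1)) :
    conj (unitaryMatrix U m l) = unitaryMatrix U.symm l m := by
  have h := U.inner_map_eq_flip (EuclideanSpace.single l 1) (EuclideanSpace.single m 1)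
  rw [EuclideanSpace.inner_single_right, EuclideanSpace.inner_single_left] at h
  simpa [unitaryMatrix] using h

theorem sum_unitaryMatrix_mul_conj (U : Cn n ≃ₗᵢ[ℂ] Cn n) (m m' : Fin (n + 1)) :
    ∑ l, unitaryMatrix U m l * conj (unitaryMatrix U m' l) = if m = m' then 1 else 0 := by
  simp only [unitaryMatrix_symm]
  have h : U (U.symm (EuclideanSpace.single m' 1)) m
    = ∑ l, unitaryMatrix U m l * unitaryMatrix U.symm l m' := unitary_apply U _ m
  rw [← h, U.apply_symm_apply]
  simp [PiLp.single_apply]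

/-- The substitution of a unitary map in a polynomial. -/
def unitarySubst (U : Cn n ≃ₗᵢ[ℂ] Cn n) : CPoly n →ₐ[ℂ] CPoly n :=
  aeval (Sum.elim (fun l => ∑ m, unitaryMatrix U l m • zv m)
    fun l => ∑ m, conj (unitaryMatrix U l m) • wv m)

theorem unitarySubst_zv (U : Cn n ≃ₗᵢ[ℂ] Cn n) (l : Fin (n + 1)) :
    unitarySubst U (zv l) = ∑ m, unitaryMatrix U l m • zv m := by
  simp [unitarySubst]

theorem unitarySubst_wv (U : Cn n ≃ₗᵢ[ℂ] Cn n) (l : Fin (n + 1)) :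
    unitarySubst U (wv l) = ∑ m, conj (unitaryMatrix U l m) • wv m := by
  simp [unitarySubst]

theorem evalAt_unitarySubst (U : Cn n ≃ₗᵢ[ℂ] Cn n) (p : CPoly n) (z : Cn n) :
    evalAt (unitarySubst U p) z = evalAt p (U z) := by
  induction p using MvPolynomial.induction_on with
  | C a => simp [unitarySubst, evalAt]
  | add p q hp hq => rw [map_add, evalAt_add, evalAt_add, hp, hq]
  | mul_X p i hp =>
    rw [map_mul, evalAt_mul, evalAt_mul, hp]
    congr 1
    rcases i with l | l
    · have := unitary_apply U z l
      change evalAt (unitarySubst U (zv l)) z = evalAt (zv l) (U z)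
      rw [unitarySubst_zv, evalAt_sum, evalAt_zv, this]
      simp only [evalAt_smul, evalAt_zv]
    · have := unitary_apply U z l
      change evalAt (unitarySubst U (wv l)) z = evalAt (wv l) (U z)
      rw [unitarySubst_wv, evalAt_sum, evalAt_wv, this, map_sum]
      simp only [evalAt_smul, evalAt_wv, map_mul]

theorem dz_unitarySubst (U : Cn n ≃ₗᵢ[ℂ] Cn n) (l : Fin (n + 1)) (p : CPoly n) :
    dz l (unitarySubst U p) = ∑ m, unitaryMatrix U m l • unitarySubst U (dz m p) := by
  induction p using MvPolynomial.induction_on with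
  | C a => simp [unitarySubst]
  | add p q hp hq => simp only [map_add, hp, hq, smul_add, Finset.sum_add_distrib]
  | mul_X p i hp =>
    simp only [map_mul, pderiv_mul, map_add, smul_add, Finset.sum_add_distrib, hp, Finset.sum_mul,
      smul_mul_assoc]
    congr 1
    rcases i with k | k
    · change unitarySubst U p * dz l (unitarySubst U (zv k))
        = ∑ m, unitaryMatrix U m l • (unitarySubst U p * unitarySubst U (dz m (zv k)))
      simp only [unitarySubst_zv, map_sum, Derivation.map_smul, dz_zv]
      simp [apply_ite]
    · change unitarySubst U p * dz l (unitarySubst U (wv k))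
        = ∑ m, unitaryMatrix U m l • (unitarySubst U p * unitarySubst U (dz m (wv k)))
      simp [unitarySubst_wv]

theorem dw_unitarySubst (U : Cn n ≃ₗᵢ[ℂ] Cn n) (l : Fin (n + 1)) (p : CPoly n) :
    dw l (unitarySubst U p) = ∑ m, conj (unitaryMatrix U m l) • unitarySubst U (dw m p) := by
  induction p using MvPolynomial.induction_on with
  | C a => simp [unitarySubst]
  | add p q hp hq => simp only [map_add, hp, hq, smul_add, Finset.sum_add_distrib]
  | mul_X p i hp =>
    simp only [map_mul, pderiv_mul, map_add, smul_add, Finset.sum_add_distrib, hp, Finset.sum_mul,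
      smul_mul_assoc]
    congr 1
    rcases i with k | k
    · change unitarySubst U p * dw l (unitarySubst U (zv k))
        = ∑ m, conj (unitaryMatrix U m l) • (unitarySubst U p * unitarySubst U (dw m (zv k)))
      simp [unitarySubst_zv]
    · change unitarySubst U p * dw l (unitarySubst U (wv k))
        = ∑ m, conj (unitaryMatrix U m l) • (unitarySubst U p * unitarySubst U (dw m (wv k)))
      simp only [unitarySubst_wv, map_sum, Derivation.map_smul, dw_wv]
      simp [apply_ite]

/-- Unitary substitutions preserve harmonic polynomials and their bidegrees. -/
theorem unitarySubst_mem_harm (U : Cn n ≃ₗᵢ[ℂ] Cn n) {j k : ℕ} {p : CPoly n} (hp : p ∈ harm n j k) :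
    unitarySubst U p ∈ harm n j k := by
  obtain ⟨h1, h2, h3⟩ := mem_harm.1 hp
  refine mem_harm.2 ⟨?_, ?_, ?_⟩
  · rw [lap_apply] at h1 ⊢
    simp only [dw_unitarySubst, map_sum, Derivation.map_smul, dz_unitarySubst, Finset.smul_sum, smul_smul]
    rw [Finset.sum_comm]
    have : ∀ m, ∑ l, ∑ i, (conj (unitaryMatrix U m l) * unitaryMatrix U i l)
        • unitarySubst U (dz i (dw m p)) = unitarySubst U (dz m (dw m p)) := by
      intro m
      rw [Finset.sum_comm]
      simp only [← Finset.sum_smul]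
      have : ∀ i, ∑ l, conj (unitaryMatrix U m l) * unitaryMatrix U i l = if i = m then 1 else 0 := by
        intro i
        rw [← sum_unitaryMatrix_mul_conj U]
        exact Finset.sum_congr rfl fun l _ => mul_comm _ _
      simp [this]
    rw [Finset.sum_congr rfl fun m _ => this m, ← map_sum, h1, map_zero]
  · rw [← map_smul, ← h2, eulerZ_apply, eulerZ_apply, map_sum]
    simp only [dz_unitarySubst, map_mul, unitarySubst_zv, Finset.mul_sum, Finset.sum_mul]
    rw [Finset.sum_comm]
    simp
  · rw [← map_smul, ← h3, eulerW_apply, eulerW_apply, map_sum]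
    simp only [dw_unitarySubst, map_mul, unitarySubst_wv, Finset.mul_sum, Finset.sum_mul]
    rw [Finset.sum_comm]
    simp

/-- Diagonal operators commute with unitary maps. -/
theorem IsDiagonal.commutesWithUnitary (hn : 1 ≤ n) {Q : Smooth n →ₗ[ℂ] Smooth n}
    {μ : ℕ → ℕ → ℝ} (hQ : IsDiagonal Q μ) (hA : IsFormallySelfAdjoint Q) :
    CommutesWithUnitary Q := by
  intro U F G hG z
  have hcov : ∀ f : Sph n → ℂ, Continuous f → ∀ p : CPoly n,
      ∫ z, f (unitaryDiffeo U z) * evalAt p (z : Cn n) ∂(crVolume n)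
        = ∫ z : Sph n, f z * evalAt (unitarySubst U.symm p) (z : Cn n) ∂(crVolume n) := by
    intro f hf p
    let e : Cn n ≃ₗᵢ[ℝ] Cn n := ⟨U.toLinearEquiv.restrictScalars ℝ, U.norm_map⟩
    rw [← integral_comp_sphMap e (continuous_mul_evalAt hf _)]
    congr 1; funext z
    have h1 : sphMap e e.norm_map z = unitaryDiffeo U z := rfl
    rw [h1, evalAt_unitarySubst, unitaryDiffeo_coe, U.symm_apply_apply]
  refine eq_of_integral_mul_harm hn (Q G).continuous (g := fun z => Q F (unitaryDiffeo U z))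
    ((Q F).continuous.comp (unitaryDiffeo U).continuous) (fun j k p hp => ?_) z
  have t1 := hA.integral_mul G (polySmooth n p)
  have t2 := hA.integral_mul F (polySmooth n (unitarySubst U.symm p))
  simp only [hQ.transpose_apply hp, hQ.transpose_apply (unitarySubst_mem_harm U.symm hp),
    mul_left_comm _ (μ k j : ℂ), polySmooth_apply, hG] at t1 t2
  rw [integral_const_mul, hcov F F.continuous] at t1
  rw [integral_const_mul] at t2
  rw [hcov (Q F) (Q F).continuous, t1, ← t2]

/-! ### CR functions -/

/-- The radial projection onto the sphere; its value at the origin is irrelevant. -/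
def radialProj (x : Cn n) : Sph n :=
  if h : x ≠ 0 then ⟨(‖x‖⁻¹ : ℝ) • x, by
    rw [mem_sphere_zero_iff_norm, norm_smul, norm_inv, norm_norm,
      inv_mul_cancel₀ (norm_ne_zero_iff.2 h)]⟩
  else Classical.arbitrary _

theorem ne_zero_of_sphere (z : Sph n) : (z : Cn n) ≠ 0 := by
  intro h
  have := mem_sphere_zero_iff_norm.1 z.2
  rw [h, norm_zero] at this
  exact zero_ne_one this

theorem radialProj_coe (z : Sph n) : radialProj (z : Cn n) = z := by
  rw [radialProj, dif_pos (ne_zero_of_sphere z)]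
  apply Subtype.ext
  simp [mem_sphere_zero_iff_norm.1 z.2]

theorem contMDiffAt_radialProj {x : Cn n} (hx : x ≠ 0) :
    ContMDiffAt 𝓘(ℝ, Cn n) (𝓡 (2 * n + 1)) ∞ (radialProj (n := n)) x := by
  let U : TopologicalSpace.Opens (Cn n) := ⟨{0}ᶜ, isOpen_compl_singleton⟩
  have h1 : ContMDiff 𝓘(ℝ, Cn n) 𝓘(ℝ, Cn n) ∞ (fun x : U => (‖(x : Cn n)‖⁻¹ : ℝ) • (x : Cn n)) := by
    intro x
    have hx : (x : Cn n) ≠ 0 := x.2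
    have hc : ContDiffAt ℝ ∞ (fun x : Cn n => (‖x‖⁻¹ : ℝ) • x) (x : Cn n) :=
      ((contDiffAt_norm ℝ hx).inv (norm_ne_zero_iff.2 hx)).smul contDiffAt_id
    exact contMDiffAt_subtype_iff.2 hc.contMDiffAt
  have h2 : ∀ x : U, (‖(x : Cn n)‖⁻¹ : ℝ) • (x : Cn n) ∈ Metric.sphere (0 : Cn n) 1 := by
    intro x
    have hx : (x : Cn n) ≠ 0 := x.2
    rw [mem_sphere_zero_iff_norm, norm_smul, norm_inv, norm_norm,
      inv_mul_cancel₀ (norm_ne_zero_iff.2 hx)]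
  have h3 := ContMDiff.codRestrict_sphere (n := 2 * n + 1) h1 h2
  have h4 : (fun x : U => radialProj (x : Cn n)) = Set.codRestrict _ _ h2 := by
    funext x
    have hx : (x : Cn n) ≠ 0 := x.2
    rw [radialProj, dif_pos hx]
    rfl
  rw [← h4] at h3
  exact contMDiffAt_subtype_iff.1 (h3 ⟨x, hx⟩)

/-- The radial extension of a smooth function. -/
theorem contDiffAt_comp_radialProj (f : Smooth n) (z : Sph n) :
    ContDiffAt ℝ ∞ (fun x : Cn n => f (radialProj x)) (z : Cn n) := by
  have h : ContMDiffAt (𝓡 (2 * n + 1)) 𝓘(ℝ, ℂ) ∞ f (radialProj (z : Cn n)) := f.2 _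
  exact (h.comp (z : Cn n) (contMDiffAt_radialProj (ne_zero_of_sphere z))).contDiffAt

theorem fderiv_comp_radialProj (f : Smooth n) (z : Sph n) (v : Tan z) :
    fderiv ℝ (fun x : Cn n => f (radialProj x)) z (dIncl z v) = dFun f z v := by
  rw [← dFun_restrict ((contDiffAt_comp_radialProj f z).differentiableAt (by simp))]
  simp only [radialProj_coe]

/-- CR functions: their differentials are complex linear on the maximal complex subspaces of the
tangent spaces. -/
def IsCR (f : Smooth n) : Prop :=
  ∀ (z : Sph n) (u v : Tan z), dIncl z u = Complex.I • dIncl z v →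
    dFun f z u = Complex.I * dFun f z v

/-- The coordinates of a diffeomorphism of the sphere. -/
def coordSmooth (τ : SphDiffeo n) (m : Fin (n + 1)) : Smooth n :=
  ⟨fun z => (τ z : Cn n) m, fun z =>
    (((EuclideanSpace.proj m : Cn n →L[ℂ] ℂ).restrictScalars ℝ).contDiff.contMDiff.comp
      (contMDiff_coe.comp τ.contMDiff)) z⟩

theorem dFun_coordSmooth (τ : SphDiffeo n) (m : Fin (n + 1)) (z : Sph n) (v : Tan z) :
    dFun (coordSmooth τ m) z v = dMap τ z v m := by
  have h := dFun_comp_fderiv (g := fun x : Cn n => x m) (f := fun x : Sph n => (τ x : Cn n)) (z := z)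
    (((EuclideanSpace.proj m : Cn n →L[ℂ] ℂ).restrictScalars ℝ).differentiableAt)
    (((contMDiff_coe.comp τ.contMDiff) z).mdifferentiableAt (by simp)) v
  have h2 : fderiv ℝ (fun x : Cn n => x m) (τ z : Cn n)
      = (EuclideanSpace.proj m : Cn n →L[ℂ] ℂ).restrictScalars ℝ :=
    ((EuclideanSpace.proj m : Cn n →L[ℂ] ℂ).restrictScalars ℝ).fderiv
  rw [h2] at h
  exact h

theorem IsCRAut.isCR_coordSmooth {τ : SphDiffeo n} (hτ : IsCRAut τ) (m : Fin (n + 1)) :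
    IsCR (coordSmooth τ m) := by
  intro z u v h
  rw [dFun_coordSmooth, dFun_coordSmooth, hτ z u v h]
  rfl

/-- The inverse of a CR automorphism is one too, because the contact form detects the maximal
complex subspaces. -/
theorem IsCRAut.symm {τ : SphDiffeo n} (hτ : IsCRAut τ) {J : Smooth n}
    (hJ : IsConformalFactor τ J) : IsCRAut τ.symm := by
  intro y u v h
  obtain ⟨z, hz⟩ : ∃ z, τ z = y := τ.surjective y
  subst hz
  obtain ⟨u, rfl⟩ := pushTan_surjective τ z u
  obtain ⟨v, rfl⟩ := pushTan_surjective τ z v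
  rw [dMap_symm, dMap_symm]
  rw [dIncl_pushTan, dIncl_pushTan] at h
  have h1 : inner ℂ (τ z : Cn n) (dMap τ z v) = 0 := by
    rw [← dIncl_pushTan, ← exists_dIncl_I_smul_iff]
    exact ⟨pushTan τ z u, by rw [dIncl_pushTan, dIncl_pushTan, h]⟩
  have h2 : inner ℂ (z : Cn n) (dIncl z v) = 0 := by
    have := hJ.pullback_contactForm z v
    rw [contactForm_eq, contactForm_eq, h1] at this
    have h3 : ((‖J z‖ ^ 2 : ℝ) : ℂ) ≠ 0 :=
      Complex.ofReal_ne_zero.2 (pow_ne_zero 2 (norm_ne_zero_iff.2 (hJ.ne_zero z)))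
    have h4 := (mul_eq_zero.1 this.symm).resolve_left h3
    exact Complex.ext (inner_dIncl_re z v) (Complex.ofReal_eq_zero.1 h4)
  obtain ⟨u', hu'⟩ := (exists_dIncl_I_smul_iff z v).2 h2
  have h5 : dMap τ z u' = dMap τ z u := by rw [hτ z u' v hu', h]
  have h6 : pushTan τ z u' = pushTan τ z u := by
    apply dIncl_injective (τ z)
    rw [dIncl_pushTan, dIncl_pushTan, h5]
  have h7 : dIncl z u' = dIncl z u := by rw [← dMap_symm τ, ← dMap_symm τ, h6]
  rw [← h7, hu']

/-- The field `c (z̄_m e_l - z̄_l e_m)`. -/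
def crField (l m : Fin (n + 1)) (c : ℂ) : Cn n →L[ℝ] Cn n :=
  planeField l m ((LinearMap.mulLeft ℂ c).restrictScalars ℝ ∘ₗ Complex.conjAe.toLinearMap)
    ((LinearMap.mulLeft ℂ c).restrictScalars ℝ ∘ₗ Complex.conjAe.toLinearMap)

theorem crField_apply (l m : Fin (n + 1)) (c : ℂ) (x : Cn n) (i : Fin (n + 1)) :
    crField l m c x i = (if i = l then c * conj (x m) else 0) - if i = m then c * conj (x l) else 0 :=
  rfl

theorem crField_skew (l m : Fin (n + 1)) (c : ℂ) (x y : Cn n) :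
    inner ℝ (crField l m c x) y = -inner ℝ x (crField l m c y) := by
  refine planeField_skew l m (fun a b => ?_) x y
  simp only [Complex.inner]
  change (b * conj (c * conj a)).re = ((c * conj b) * conj a).re
  rw [← Complex.conj_re]
  congr 1
  simp only [map_mul, Complex.conj_conj]
  ring

theorem crField_cube {l m : Fin (n + 1)} (hlm : l ≠ m) {c : ℂ} (hc : ‖c‖ = 1) (x : Cn n) :
    crField l m c (crField l m c (crField l m c x)) = -crField l m c x := by
  have h : c * conj c = 1 := by rw [Complex.mul_conj, Complex.normSq_eq_norm_sq, hc]; simp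
  have h2 : ∀ a : ℂ, c * conj (c * conj a) = a := fun a => by
    rw [map_mul, Complex.conj_conj, ← mul_assoc, h, one_mul]
  exact planeField_cube hlm h2 h2 x

theorem fderiv_evalAt_crField (l m : Fin (n + 1)) (c : ℂ) (p : CPoly n) (z : Cn n) :
    fderiv ℝ (evalAt p) z (crField l m c z)
      = c * evalAt (wv m * dz l p - wv l * dz m p) z
        + conj c * evalAt (zv m * dw l p - zv l * dw m p) z := by
  rw [crField, fderiv_evalAt_planeField]
  have e : ∀ a : ℂ, ((LinearMap.mulLeft ℂ c).restrictScalars ℝ ∘ₗ Complex.conjAe.toLinearMap) a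
    = c * conj a := fun a => rfl
  simp only [e, evalAt_sub, evalAt_mul, evalAt_zv, evalAt_wv, map_mul, Complex.conj_conj]
  ring

theorem crField_one_smul (l m : Fin (n + 1)) (c : ℂ) (x : Cn n) :
    crField l m c x = c • crField l m 1 x := by
  ext i
  simp only [crField_apply, PiLp.smul_apply, smul_eq_mul]
  split_ifs <;> ring

theorem inner_crField (l m : Fin (n + 1)) (c : ℂ) (x : Cn n) : inner ℂ x (crField l m c x) = 0 := by
  rw [PiLp.inner_apply]
  simp only [RCLike.inner_apply, crField_apply, sub_mul, ite_mul, zero_mul, Finset.sum_sub_distrib,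
    Finset.sum_ite_eq', Finset.mem_univ, if_true]
  ring

/-- The tangential Cauchy-Riemann equations in weak form. -/
theorem IsCR.integral_mul_eq_zero {f : Smooth n} (hf : IsCR f) (l m : Fin (n + 1)) (p : CPoly n) :
    ∫ z : Sph n, f z * evalAt (zv m * dw l p - zv l * dw m p) (z : Cn n) ∂(crVolume n) = 0 := by
  rcases eq_or_ne l m with rfl | hlm
  · simp [evalAt]
  set g : Cn n → ℂ := fun x => f (radialProj x) with hg
  have hgf : ∀ z : Sph n, g z = f z := fun z => by rw [hg]; simp only [radialProj_coe]
  have key : ∀ c : ℂ, ‖c‖ = 1 →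
      ∫ z : Sph n, (f z * fderiv ℝ (evalAt p) z (crField l m c z)
        + fderiv ℝ g z (crField l m c z) * evalAt p z) ∂(crVolume n) = 0 := by
    intro c hc
    have hd : ∀ z : Sph n, ContDiffAt ℝ 1 (fun x => g x * evalAt p x) (z : Cn n) := fun z =>
      ((contDiffAt_comp_radialProj f z).mul (contDiff_evalAt p).contDiffAt).of_le (by simp)
    rw [← integral_fderiv_skew (crField_skew l m c) (crField_cube hlm hc) hd]
    congr 1; funext z
    have h1 := ((contDiffAt_comp_radialProj f z).differentiableAt (by simp)).hasFDerivAt.mul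
      ((contDiff_evalAt p).contDiffAt.differentiableAt (x := (z : Cn n)) (by simp)).hasFDerivAt
    have h2 : fderiv ℝ (fun x => g x * evalAt p x) (z : Cn n) = _ := h1.fderiv
    rw [h2]
    simp only [_root_.add_apply, _root_.smul_apply, smul_eq_mul, radialProj_coe]
    rw [mul_comm (evalAt p (z : Cn n))]
  have hI : ∀ z : Sph n, fderiv ℝ g z (crField l m Complex.I z)
      = Complex.I * fderiv ℝ g z (crField l m 1 z) := by
    intro z
    obtain ⟨v, hv⟩ := (exists_dIncl_eq_iff z (crField l m 1 z)).2 (by rw [inner_crField]; rfl)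
    obtain ⟨u, hu⟩ := (exists_dIncl_eq_iff z (crField l m Complex.I z)).2
      (by rw [inner_crField]; rfl)
    rw [← hu, ← hv, fderiv_comp_radialProj, fderiv_comp_radialProj]
    exact hf z u v (by rw [hu, hv, crField_one_smul])
  have k1 := key 1 (by simp)
  have k2 := key Complex.I (by simp)
  simp only [hI, fderiv_evalAt_crField, map_one, Complex.conj_I, one_mul] at k1 k2
  have hc1 : Continuous fun z : Sph n => fderiv ℝ g z (crField l m 1 z) := by
    have : Continuous fun z : Sph n => fderiv ℝ g (z : Cn n) := by
      rw [continuous_iff_continuousAt]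
      intro z
      exact ((contDiffAt_comp_radialProj f z).fderiv_right (m := 0) (by simp)).continuousAt.comp
        (f := fun z : Sph n => (z : Cn n)) continuous_subtype_val.continuousAt
    exact this.clm_apply ((crField l m 1).continuous.comp continuous_subtype_val)
  have hc2 : Continuous fun z : Sph n => f z * (evalAt (wv m * dz l p - wv l * dz m p) (z : Cn n)
      + evalAt (zv m * dw l p - zv l * dw m p) (z : Cn n))
      + fderiv ℝ g z (crField l m 1 z) * evalAt p z :=
    (f.continuous.mul ((continuous_evalAt _).add (continuous_evalAt _))).add
      (hc1.mul (continuous_evalAt p))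
  have hc3 : Continuous fun z : Sph n => f z
      * (Complex.I * evalAt (wv m * dz l p - wv l * dz m p) (z : Cn n)
      + -Complex.I * evalAt (zv m * dw l p - zv l * dw m p) (z : Cn n))
      + Complex.I * fderiv ℝ g z (crField l m 1 z) * evalAt p z :=
    (f.continuous.mul ((continuous_const.mul (continuous_evalAt _)).add
      (continuous_const.mul (continuous_evalAt _)))).add
      ((continuous_const.mul hc1).mul (continuous_evalAt p))
  have k3 := integral_sub_sphere hc3 (g := fun z => Complex.I * (f z
      * (evalAt (wv m * dz l p - wv l * dz m p) (z : Cn n)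
      + evalAt (zv m * dw l p - zv l * dw m p) (z : Cn n))
      + fderiv ℝ g z (crField l m 1 z) * evalAt p z)) (continuous_const.mul hc2)
  rw [integral_const_mul, k1, k2, mul_zero, sub_zero] at k3
  have k4 : ∀ z : Sph n, f z * (Complex.I * evalAt (wv m * dz l p - wv l * dz m p) (z : Cn n)
      + -Complex.I * evalAt (zv m * dw l p - zv l * dw m p) (z : Cn n))
      + Complex.I * fderiv ℝ g z (crField l m 1 z) * evalAt p z - Complex.I * (f z
      * (evalAt (wv m * dz l p - wv l * dz m p) (z : Cn n)
      + evalAt (zv m * dw l p - zv l * dw m p) (z : Cn n))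
      + fderiv ℝ g z (crField l m 1 z) * evalAt p z)
      = (-2 * Complex.I) * (f z * evalAt (zv m * dw l p - zv l * dw m p) (z : Cn n)) := fun z => by
    ring
  simp only [k4] at k3
  rw [integral_const_mul] at k3
  exact (mul_eq_zero.1 k3).resolve_left (by simp)

/-- A Laplacian composed of the tangential Cauchy-Riemann operators `z_m ∂/∂z̄_l - z_l ∂/∂z̄_m` and
of `z̄_m ∂/∂z_l` acts on the harmonic polynomials of bidegree `(j, k)` by a scalar that, for
`1 ≤ n`, vanishes only if `j = 0`. -/
theorem sum_crOperator {j k : ℕ} {p : CPoly n} (hp : p ∈ harm n j k) :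
    ∑ l, ∑ m, (zv m * dw l (wv m * dz l p) - zv l * dw m (wv m * dz l p))
      = (-((j : ℂ) * (n + k))) • p := by
  obtain ⟨h1, h2, h3⟩ := mem_harm.1 hp
  rw [lap_apply] at h1
  rw [eulerZ_apply] at h2
  have hd : ∀ l, ∑ m, wv m * dw m (dz l p) = (k : ℂ) • dz l p := fun l => by
    rw [← eulerW_apply]; exact (mem_harm.1 (dz_mem_harm hp l)).2.2
  have e1 : ∀ l m, zv m * dw l (wv m * dz l p) - zv l * dw m (wv m * dz l p)
      = (if l = m then zv m * dz l p else 0) + (zv m * wv m) * dz l (dw l p)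
        - zv l * dz l p - zv l * (wv m * dw m (dz l p)) := by
    intro l m
    rw [pderiv_mul, pderiv_mul, dw_wv, dw_wv, if_pos rfl, pderiv_comm (Sum.inr l) (Sum.inl l)]
    split_ifs <;> ring
  simp only [e1, Finset.sum_sub_distrib, Finset.sum_add_distrib, ← Finset.mul_sum, hd,
    Finset.sum_ite_eq, Finset.mem_univ, if_true, ← Finset.sum_mul, h1, h2, mul_zero,
    Finset.sum_const, Finset.card_univ, Fintype.card_fin, mul_smul_comm, ← Finset.smul_sum]
  rw [← Nat.cast_smul_eq_nsmul ℂ]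
  simp only [smul_smul, add_zero]
  rw [← sub_smul, ← sub_smul]
  congr 1
  push_cast
  ring

/-- With respect to the bilinear pairing, CR functions are orthogonal to all spherical harmonics
except the antiholomorphic ones: the latter are the kernel of the operator in `sum_crOperator`. -/
theorem IsCR.integral_mul_harm (hn : 1 ≤ n) {f : Smooth n} (hf : IsCR f) {j k : ℕ} (hj : j ≠ 0)
    {p : CPoly n} (hp : p ∈ harm n j k) :
    ∫ z : Sph n, f z * evalAt p (z : Cn n) ∂(crVolume n) = 0 := by
  have hne : (-((j : ℂ) * (n + k))) ≠ 0 := by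
    refine neg_ne_zero.2 (mul_ne_zero (Nat.cast_ne_zero.2 hj) ?_)
    exact_mod_cast (by omega : n + k ≠ 0)
  have h : ∫ z : Sph n, f z * evalAt ((-((j : ℂ) * (n + k))) • p) (z : Cn n) ∂(crVolume n) = 0 := by
    rw [← sum_crOperator hp]
    simp only [evalAt_sum, Finset.mul_sum]
    rw [integral_finsetSum _ fun l _ => integrable_of_continuous
      (continuous_finsetSum _ fun m _ => continuous_mul_evalAt f.continuous _)]
    refine Finset.sum_eq_zero fun l _ => ?_
    rw [integral_finsetSum _ fun m _ => integrable_of_continuous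
      (continuous_mul_evalAt f.continuous _)]
    exact Finset.sum_eq_zero fun m _ => hf.integral_mul_eq_zero l m _
  simp only [evalAt_smul, mul_left_comm _ (-((j : ℂ) * (n + k)))] at h
  rw [integral_const_mul] at h
  exact (mul_eq_zero.1 h).resolve_left hne

/-! ### Diffeomorphisms distort the measure by a bounded factor -/

/-- The extension of a diffeomorphism of the sphere to a map that is homogeneous of degree one. -/
def coneMap (τ : SphDiffeo n) (x : Cn n) : Cn n := ‖x‖ • (τ (radialProj x) : Cn n)

theorem radialProj_smul {c : ℝ} (hc : 0 < c) {x : Cn n} (hx : x ≠ 0) :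
    radialProj (c • x) = radialProj x := by
  rw [radialProj, radialProj, dif_pos hx, dif_pos (smul_ne_zero hc.ne' hx)]
  apply Subtype.ext
  change (‖c • x‖⁻¹ : ℝ) • c • x = (‖x‖⁻¹ : ℝ) • x
  rw [norm_smul, Real.norm_of_nonneg hc.le, smul_smul, mul_inv, mul_right_comm,
    inv_mul_cancel₀ hc.ne', one_mul]

theorem coneMap_smul (τ : SphDiffeo n) {c : ℝ} (hc : 0 < c) (x : Cn n) :
    coneMap τ (c • x) = c • coneMap τ x := by
  rcases eq_or_ne x 0 with rfl | hx
  · simp [coneMap]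
  · rw [coneMap, coneMap, radialProj_smul hc hx, norm_smul, Real.norm_of_nonneg hc.le, mul_smul]

theorem contDiffAt_coneMap (τ : SphDiffeo n) {x : Cn n} (hx : x ≠ 0) :
    ContDiffAt ℝ ∞ (coneMap τ) x := by
  have h1 : ContDiffAt ℝ ∞ (fun x : Cn n => ((τ (radialProj x) : Sph n) : Cn n)) x :=
    ((contMDiff_coe (τ (radialProj x))).comp x
      ((τ.contMDiff (radialProj x)).comp x (contMDiffAt_radialProj hx))).contDiffAt
  exact (contDiffAt_norm ℝ hx).smul h1

theorem fderiv_coneMap_smul (τ : SphDiffeo n) {c : ℝ} (hc : 0 < c) (x : Cn n) :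
    fderiv ℝ (coneMap τ) (c • x) = fderiv ℝ (coneMap τ) x := by
  have h1 : fderiv ℝ (fun y => coneMap τ (c • y)) x = c • fderiv ℝ (coneMap τ) (c • x) :=
    fderiv_comp_smul c
  have h2 : (fun y => coneMap τ (c • y)) = c • coneMap τ := by
    funext y; exact coneMap_smul τ hc y
  rw [h2, fderiv_const_smul_field] at h1
  exact (smul_right_injective _ hc.ne' h1).symm

/-- The derivative of the cone map is homogeneous of degree zero, so compactness of the sphere bounds
its determinant. -/
theorem exists_abs_det_coneMap_le (τ : SphDiffeo n) :
    ∃ M : ℝ, 0 ≤ M ∧ ∀ x : Cn n, x ≠ 0 → |(fderiv ℝ (coneMap τ) x).det| ≤ M := by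
  have hc : Continuous fun z : Sph n => |(fderiv ℝ (coneMap τ) (z : Cn n)).det| := by
    refine continuous_abs.comp (ContinuousLinearMap.continuous_det.comp ?_)
    rw [continuous_iff_continuousAt]
    intro z
    exact ((contDiffAt_coneMap τ (ne_zero_of_sphere z)).fderiv_right (m := 0)
      (by simp)).continuousAt.comp
        (f := fun z : Sph n => (z : Cn n)) continuous_subtype_val.continuousAt
  obtain ⟨M, hM⟩ := (isCompact_range hc).bddAbove
  have hM' : ∀ z : Sph n, |(fderiv ℝ (coneMap τ) (z : Cn n)).det| ≤ M := fun z => hM ⟨z, rfl⟩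
  refine ⟨M, (abs_nonneg _).trans (hM' (Classical.arbitrary _)), fun x hx => ?_⟩
  have h := fderiv_coneMap_smul τ (inv_pos.2 (norm_pos_iff.2 hx)) x
  have h2 := hM' (radialProj x)
  rw [radialProj, dif_pos hx] at h2
  rw [← h]
  exact h2

theorem measurable_radialProj : Measurable (radialProj (n := n)) :=
  measurable_of_continuousOn_compl_singleton 0 fun _ hx =>
    (contMDiffAt_radialProj hx).continuousAt.continuousWithinAt

open scoped Pointwise in
theorem cone_eq (s : Set (Sph n)) : Set.Ioo (0 : ℝ) 1 • (Subtype.val '' s)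
    = {x : Cn n | x ≠ 0 ∧ ‖x‖ < 1 ∧ radialProj x ∈ s} := by
  ext x
  simp only [Set.mem_smul, Set.mem_image, Set.mem_ofPred_eq]
  constructor
  · rintro ⟨r, hr, _, ⟨y, hy, rfl⟩, rfl⟩
    refine ⟨smul_ne_zero hr.1.ne' (ne_zero_of_sphere y), ?_, ?_⟩
    · rw [norm_smul, Real.norm_of_nonneg hr.1.le, mem_sphere_zero_iff_norm.1 y.2, mul_one]
      exact hr.2
    · rwa [radialProj_smul hr.1 (ne_zero_of_sphere y), radialProj_coe]
  · rintro ⟨hx, h1, hs⟩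
    refine ⟨‖x‖, ⟨norm_pos_iff.2 hx, h1⟩, _, ⟨_, hs, rfl⟩, ?_⟩
    rw [radialProj, dif_pos hx]
    change ‖x‖ • (‖x‖⁻¹ : ℝ) • x = x
    rw [smul_smul, mul_inv_cancel₀ (norm_ne_zero_iff.2 hx), one_smul]

open scoped Pointwise in
theorem crVolume_map_le (τ : SphDiffeo n) :
    ∃ M : ℝ, 0 ≤ M ∧ (crVolume n).map τ ≤ ENNReal.ofReal M • crVolume n := by
  obtain ⟨M, hM0, hM⟩ := exists_abs_det_coneMap_le τ.symm
  refine ⟨M, hM0, Measure.le_iff.2 fun s hs => ?_⟩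
  have hτ : Measurable τ := τ.continuous.measurable
  rw [Measure.map_apply hτ hs, crVolume, Measure.smul_apply, Measure.smul_apply, Measure.smul_apply,
    Measure.toSphere_apply' _ hs, Measure.toSphere_apply' _ (hτ hs)]
  simp only [smul_eq_mul]
  rw [mul_left_comm (ENNReal.ofReal M), mul_left_comm (ENNReal.ofReal M)]
  refine mul_le_mul' le_rfl (mul_le_mul' le_rfl ?_)
  have hms : MeasurableSet (Set.Ioo (0 : ℝ) 1 • (Subtype.val '' s)) := by
    rw [cone_eq]
    exact (measurableSet_singleton (0 : Cn n)).compl.inter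
      ((measurableSet_lt measurable_norm measurable_const).inter (measurable_radialProj hs))
  have himg : Set.Ioo (0 : ℝ) 1 • (Subtype.val '' (τ ⁻¹' s))
      ⊆ coneMap τ.symm '' (Set.Ioo (0 : ℝ) 1 • (Subtype.val '' s)) := by
    rintro _ ⟨r, hr, _, ⟨y, hy, rfl⟩, rfl⟩
    refine ⟨r • (τ y : Cn n), ⟨r, hr, _, ⟨_, hy, rfl⟩, rfl⟩, ?_⟩
    rw [coneMap_smul _ hr.1, coneMap, radialProj_coe, mem_sphere_zero_iff_norm.1 (τ y).2, one_smul,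
      Diffeomorph.symm_apply_apply]
  have hne : ∀ x ∈ Set.Ioo (0 : ℝ) 1 • (Subtype.val '' s), x ≠ 0 := by
    intro x hx
    rw [cone_eq] at hx
    exact hx.1
  calc volume (Set.Ioo (0 : ℝ) 1 • (Subtype.val '' (τ ⁻¹' s)))
      ≤ volume (coneMap τ.symm '' (Set.Ioo (0 : ℝ) 1 • (Subtype.val '' s))) := measure_mono himg
    _ ≤ ∫⁻ x in Set.Ioo (0 : ℝ) 1 • (Subtype.val '' s),
          ENNReal.ofReal |(fderiv ℝ (coneMap τ.symm) x).det| :=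
        addHaar_image_le_lintegral_abs_det_fderiv volume hms fun x hx =>
          ((contDiffAt_coneMap τ.symm (hne x hx)).differentiableAt
            (by simp)).hasFDerivAt.hasFDerivWithinAt
    _ ≤ ∫⁻ _ in Set.Ioo (0 : ℝ) 1 • (Subtype.val '' s), ENNReal.ofReal M :=
        setLIntegral_mono measurable_const fun x hx => ENNReal.ofReal_le_ofReal (hM x (hne x hx))
    _ = _ := setLIntegral_const _ _

theorem exists_integral_comp_le (τ : SphDiffeo n) : ∃ M : ℝ, 0 ≤ M ∧ ∀ f : Sph n → ℝ,
    Continuous f → (∀ z, 0 ≤ f z) → ∫ z, f (τ z) ∂(crVolume n) ≤ M * ∫ z, f z ∂(crVolume n) := by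
  obtain ⟨M, hM0, hM⟩ := crVolume_map_le τ
  refine ⟨M, hM0, fun f hf h0 => ?_⟩
  rw [← integral_map (μ := crVolume n) (φ := τ) (f := f) τ.continuous.measurable.aemeasurable
    hf.aestronglyMeasurable]
  have h := integral_mono_measure hM (Filter.Eventually.of_forall h0)
    ((integrable_of_continuous_real hf).smul_measure ENNReal.ofReal_ne_top)
  rwa [integral_smul_measure, ENNReal.toReal_ofReal hM0, smul_eq_mul] at h

/-! ### The algebra of CR functions -/

/-- The algebra of the (smooth) CR functions, as continuous functions. -/
def crAlg (n : ℕ) : Subalgebra ℂ C(Sph n, ℂ) where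
  carrier := {F | ∃ f : Smooth n, IsCR f ∧ ∀ z, F z = f z}
  mul_mem' := by
    rintro F G ⟨f, hf, hF⟩ ⟨g, hg, hG⟩
    refine ⟨⟨fun z => f z * g z,
      (contDiff_fst.mul contDiff_snd : ContDiff ℝ ∞ (fun p : ℂ × ℂ => p.1 * p.2)).contMDiff.comp
        (f.2.prodMk_space g.2)⟩, fun z u v h => ?_, fun z => by rw [ContinuousMap.mul_apply, hF, hG]⟩
    have hd : ∀ w, dFun (fun z => f z * g z) z w = f z * dFun g z w + g z * dFun f z w := by
      intro w
      rw [← fderiv_comp_radialProj ⟨fun z => f z * g z,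
        (contDiff_fst.mul contDiff_snd : ContDiff ℝ ∞ (fun p : ℂ × ℂ => p.1 * p.2)).contMDiff.comp
          (f.2.prodMk_space g.2)⟩, ← fderiv_comp_radialProj, ← fderiv_comp_radialProj]
      have h1 := ((contDiffAt_comp_radialProj f z).differentiableAt (by simp)).hasFDerivAt.mul
        ((contDiffAt_comp_radialProj g z).differentiableAt (by simp)).hasFDerivAt
      have h2 : fderiv ℝ (fun x => f (radialProj x) * g (radialProj x)) (z : Cn n) = _ := h1.fderiv
      change fderiv ℝ (fun x => f (radialProj x) * g (radialProj x)) (z : Cn n) _ = _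
      rw [h2]
      simp only [_root_.add_apply, _root_.smul_apply, smul_eq_mul, radialProj_coe]
    change dFun (fun z => f z * g z) z u = Complex.I * dFun (fun z => f z * g z) z v
    rw [hd, hd, hf z u v h, hg z u v h]
    ring
  add_mem' := by
    rintro F G ⟨f, hf, hF⟩ ⟨g, hg, hG⟩
    refine ⟨f + g, fun z u v h => ?_, fun z => by rw [ContinuousMap.add_apply, hF, hG]; rfl⟩
    have hd : ∀ w, dFun (f + g : Smooth n) z w = dFun f z w + dFun g z w := by
      intro w
      rw [← fderiv_comp_radialProj, ← fderiv_comp_radialProj, ← fderiv_comp_radialProj]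
      have h1 := ((contDiffAt_comp_radialProj f z).differentiableAt (by simp)).hasFDerivAt.add
        ((contDiffAt_comp_radialProj g z).differentiableAt (by simp)).hasFDerivAt
      have h2 : fderiv ℝ (fun x => f (radialProj x) + g (radialProj x)) (z : Cn n) = _ := h1.fderiv
      change fderiv ℝ (fun x => f (radialProj x) + g (radialProj x)) (z : Cn n) _ = _
      rw [h2]
      rfl
    rw [hd, hd, hf z u v h, hg z u v h, mul_add]
  algebraMap_mem' := fun c => by
    refine ⟨constSmooth c, fun z u v _ => ?_, fun z => rfl⟩
    have hd : ∀ w, dFun (constSmooth c : Smooth n) z w = 0 := by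
      intro w
      rw [← fderiv_comp_radialProj]
      change fderiv ℝ (fun _ : Cn n => c) (z : Cn n) _ = 0
      rw [fderiv_const_apply]
      rfl
    rw [hd, hd, mul_zero]

/-- A diffeomorphism of the sphere as a continuous map. -/
def diffeoC (τ : SphDiffeo n) : C(Sph n, Sph n) := ⟨τ, τ.continuous⟩

/-- The coordinates of a diffeomorphism of the sphere as continuous functions. -/
def coordC (τ : SphDiffeo n) (m : Fin (n + 1)) : C(Sph n, ℂ) :=
  ⟨fun z => (τ z : Cn n) m, (coordSmooth τ m).continuous⟩

theorem coordC_apply (τ : SphDiffeo n) (m : Fin (n + 1)) (z : Sph n) :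
    coordC τ m z = (τ z : Cn n) m := rfl

theorem IsCRAut.coordC_mem {τ : SphDiffeo n} (hτ : IsCRAut τ) (m : Fin (n + 1)) :
    coordC τ m ∈ crAlg n := ⟨coordSmooth τ m, hτ.isCR_coordSmooth m, fun _ => rfl⟩

theorem IsCRAut.comp_mem {τ : SphDiffeo n} (hτ : IsCRAut τ) {F : C(Sph n, ℂ)} (hF : F ∈ crAlg n) :
    F.comp (diffeoC τ) ∈ crAlg n := by
  obtain ⟨f, hf, hF⟩ := hF
  refine ⟨⟨fun z => f (τ z), ContMDiff.comp f.2 τ.contMDiff⟩, fun z u v h => ?_, fun z => hF _⟩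
  have hd : ∀ w, dFun (fun z => f (τ z)) z w = dFun f (τ z) (pushTan τ z w) := fun w =>
    dFun_comp_diffeo τ (f.mdifferentiableAt _) w
  change dFun (fun z => f (τ z)) z u = Complex.I * dFun (fun z => f (τ z)) z v
  rw [hd, hd]
  refine hf _ _ _ ?_
  rw [dIncl_pushTan, dIncl_pushTan, hτ z u v h]

theorem isCRAut_refl : IsCRAut (Diffeomorph.refl (𝓡 (2 * n + 1)) (Sph n) ∞) := fun _ _ _ h => h

/-- Holomorphic polynomials as functions on the sphere. -/
def holC (n : ℕ) : MvPolynomial (Fin (n + 1)) ℂ →ₐ[ℂ] C(Sph n, ℂ) :=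
  aeval (coordC (Diffeomorph.refl _ _ _))

theorem holC_X (l : Fin (n + 1)) : holC n (X l) = coordC (Diffeomorph.refl _ _ _) l := aeval_X _ _

theorem holC_mem (P : MvPolynomial (Fin (n + 1)) ℂ) : holC n P ∈ crAlg n := by
  induction P using MvPolynomial.induction_on with
  | C a => rw [← MvPolynomial.algebraMap_eq, AlgHom.commutes]; exact (crAlg n).algebraMap_mem a
  | add P Q hP hQ => rw [map_add]; exact (crAlg n).add_mem hP hQ
  | mul_X P l hP => rw [map_mul, holC_X]; exact (crAlg n).mul_mem hP (isCRAut_refl.coordC_mem l)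

theorem holC_apply (P : MvPolynomial (Fin (n + 1)) ℂ) (z : Sph n) :
    holC n P z = evalAt (rename Sum.inl P) (z : Cn n) := by
  induction P using MvPolynomial.induction_on with
  | C a => rw [← MvPolynomial.algebraMap_eq, AlgHom.commutes]; simp [evalAt, MvPolynomial.algebraMap_eq]
  | add P Q hP hQ => rw [map_add, map_add, evalAt_add, ContinuousMap.add_apply, hP, hQ]
  | mul_X P l hP =>
    rw [map_mul, map_mul, evalAt_mul, ContinuousMap.mul_apply, hP, holC_X, rename_X, coordC_apply,
      evalAt_zv]
    rfl

/-! ### CR functions are limits of holomorphic polynomials -/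

/-- A sum of spherical harmonics is a holomorphic polynomial up to a part that is orthogonal to all CR
functions. -/
theorem exists_holomorphic_part {h : CPoly n}
    (hh : h ∈ Submodule.span ℂ (⋃ j, ⋃ k, (harm n j k : Set (CPoly n)))) (hn : 1 ≤ n) :
    ∃ (P : MvPolynomial (Fin (n + 1)) ℂ) (q : CPoly n), h = rename Sum.inl P + conjPoly q ∧
      ∀ G ∈ crAlg n, ∫ z : Sph n, G z * evalAt q (z : Cn n) ∂(crVolume n) = 0 := by
  induction hh using Submodule.span_induction with
  | mem h hh =>
    simp only [Set.mem_iUnion] at hh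
    obtain ⟨j, k, hh⟩ := hh
    rcases eq_or_ne k 0 with rfl | hk
    · have h0 : eulerW n h = 0 := by simpa using (mem_harm.1 hh).2.2
      obtain ⟨P, rfl⟩ := exists_rename_eq_of_vars_subset_range h (Sum.inl : Fin (n + 1) → _)
        Sum.inl_injective (by
          rintro (l | l) hl
          · exact ⟨l, rfl⟩
          · exact absurd hl (inr_notMem_vars h0 l))
      exact ⟨P, 0, by simp [conjPoly], fun G _ => by simp⟩
    · refine ⟨0, conjPoly h, by rw [conjPoly_conjPoly]; simp, ?_⟩
      rintro G ⟨g, hg, hG⟩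
      simp only [hG]
      exact hg.integral_mul_harm hn hk (conjPoly_mem_harm hh)
  | zero => exact ⟨0, 0, by simp [conjPoly], fun G _ => by simp⟩
  | add x y _ _ hx hy =>
    obtain ⟨P, q, rfl, h1⟩ := hx
    obtain ⟨P', q', rfl, h2⟩ := hy
    refine ⟨P + P', q + q', by simp [conjPoly]; ring, fun G hG => ?_⟩
    simp only [evalAt_add, mul_add]
    rw [integral_add_sphere (continuous_mul_evalAt G.continuous q)
      (continuous_mul_evalAt G.continuous q'), h1 G hG, h2 G hG, add_zero]
  | smul a x _ hx =>
    obtain ⟨P, q, rfl, h1⟩ := hx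
    refine ⟨a • P, conj a • q, by rw [conjPoly_smul]; simp, fun G hG => ?_⟩
    simp only [evalAt_smul, mul_left_comm _ (conj a)]
    rw [integral_const_mul, h1 G hG, mul_zero]

/-- CR functions are limits of holomorphic polynomials in the mean: by orthogonality, the best
approximation in mean square by spherical harmonics is holomorphic. -/
theorem exists_hol_near (hn : 1 ≤ n) {F : C(Sph n, ℂ)} (hF : F ∈ crAlg n) {ε : ℝ} (hε : 0 < ε) :
    ∃ P, ∫ z : Sph n, ‖F z - holC n P z‖ ∂(crVolume n) ≤ ε := by
  have hV := mass_pos (n := n)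
  set t := ε / mass n with ht
  have ht0 : 0 < t := div_pos hε hV
  obtain ⟨p, hp⟩ := exists_evalAt_near F.continuous ht0
  obtain ⟨h, hh, r, hr⟩ := exists_harmonic_decomposition hn p
  obtain ⟨P, q, hPq, hq⟩ := exists_holomorphic_part hh hn
  refine ⟨P, ?_⟩
  have h0 := hq (F - holC n P) ((crAlg n).sub_mem hF (holC_mem P))
  have hc : Continuous fun z : Sph n => (F - holC n P) z * evalAt q (z : Cn n) :=
    continuous_mul_evalAt (F - holC n P).continuous q
  have hpt : ∀ z : Sph n, ‖F z - holC n P z‖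
      ≤ t + t⁻¹ * ((F - holC n P) z * evalAt q (z : Cn n)).re := by
    intro z
    have h1 : F z - evalAt p z = (F - holC n P) z - conj (evalAt q z) := by
      rw [hr, evalAt_add, evalAt_mul, evalAt_sub, evalAt_rho_sphere, evalAt_one, sub_self, zero_mul,
        add_zero, hPq, evalAt_add, evalAt_conjPoly, ← holC_apply, ContinuousMap.sub_apply]
      ring
    have h2 := hp z
    rw [h1] at h2
    rw [← ContinuousMap.sub_apply]
    set a := (F - holC n P) z
    set b := evalAt q (z : Cn n)
    have h3 : ‖a - conj b‖ ^ 2 = ‖a‖ ^ 2 + ‖b‖ ^ 2 - 2 * (a * b).re := by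
      rw [← Complex.normSq_eq_norm_sq, ← Complex.normSq_eq_norm_sq, ← Complex.normSq_eq_norm_sq,
        Complex.normSq_sub, Complex.conj_conj, Complex.normSq_conj]
    have h4 : ‖a - conj b‖ ^ 2 ≤ t ^ 2 := pow_le_pow_left₀ (norm_nonneg _) h2.le 2
    have h5 : t * ‖a‖ ≤ t * (t + t⁻¹ * (a * b).re) := by
      rw [mul_add, ← mul_assoc, mul_inv_cancel₀ ht0.ne', one_mul]
      nlinarith [sq_nonneg (‖a‖ - t), sq_nonneg ‖b‖]
    exact le_of_mul_le_mul_left h5 ht0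
  have hre : ∫ z : Sph n, ((F - holC n P) z * evalAt q (z : Cn n)).re ∂(crVolume n) = 0 := by
    have := integral_re (integrable_of_continuous hc)
    rw [h0] at this
    simpa using this
  have hc2 : Continuous fun z : Sph n => t⁻¹ * ((F - holC n P) z * evalAt q (z : Cn n)).re :=
    continuous_const.mul (Complex.continuous_re.comp hc)
  calc ∫ z : Sph n, ‖F z - holC n P z‖ ∂(crVolume n)
      ≤ ∫ z : Sph n, (t + t⁻¹ * ((F - holC n P) z * evalAt q (z : Cn n)).re) ∂(crVolume n) :=
        integral_mono (integrable_of_continuous_real (F - holC n P).continuous.norm)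
          (integrable_of_continuous_real (continuous_const.add hc2)) hpt
    _ = ε := by
        rw [integral_add (integrable_of_continuous_real continuous_const)
          (integrable_of_continuous_real hc2), integral_const_mul, hre,
          mul_zero, add_zero, integral_const, smul_eq_mul]
        exact mul_div_cancel₀ _ hV.ne'

/-- Integration as a linear functional on continuous functions. -/
def sphInt (n : ℕ) : C(Sph n, ℂ) →ₗ[ℂ] ℂ where
  toFun k := ∫ z, k z ∂(crVolume n)
  map_add' k k' := integral_add_sphere k.continuous k'.continuous
  map_smul' c _ := integral_const_mul c _

theorem sphInt_apply (k : C(Sph n, ℂ)) : sphInt n k = ∫ z, k z ∂(crVolume n) := rfl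

theorem norm_sphInt_mul_le (F k : C(Sph n, ℂ)) :
    ‖sphInt n (F * k)‖ ≤ ‖k‖ * ∫ z, ‖F z‖ ∂(crVolume n) := by
  rw [← integral_const_mul]
  refine (norm_integral_le_integral_norm _).trans (integral_mono
    (integrable_of_continuous_real (F * k).continuous.norm)
    (integrable_of_continuous_real (continuous_const.mul F.continuous.norm)) fun z => ?_)
  change ‖F z * k z‖ ≤ ‖k‖ * ‖F z‖
  rw [norm_mul, mul_comm]
  exact mul_le_mul_of_nonneg_right (k.norm_coe_le_norm z) (norm_nonneg _)

/-- Identities between integrals extend from holomorphic polynomials to CR functions. -/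
theorem sphInt_comp_mul_eq (hn : 1 ≤ n) (τ : SphDiffeo n) {k k' : C(Sph n, ℂ)}
    (h : ∀ P, sphInt n ((holC n P).comp (diffeoC τ) * k) = sphInt n (holC n P * k'))
    {F : C(Sph n, ℂ)} (hF : F ∈ crAlg n) :
    sphInt n (F.comp (diffeoC τ) * k) = sphInt n (F * k') := by
  obtain ⟨M, hM0, hM⟩ := exists_integral_comp_le τ
  have hb : ∀ ε > 0, ‖sphInt n (F.comp (diffeoC τ) * k) - sphInt n (F * k')‖
      ≤ (‖k‖ * M + ‖k'‖) * ε := by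
    intro ε hε
    obtain ⟨P, hP⟩ := exists_hol_near hn hF hε
    set D := F - holC n P with hD
    have e1 : F.comp (diffeoC τ) * k = D.comp (diffeoC τ) * k + (holC n P).comp (diffeoC τ) * k := by
      ext z; simp [hD]; ring
    have e2 : F * k' = D * k' + holC n P * k' := by rw [hD]; ring
    rw [e1, e2, map_add, map_add, h, add_sub_add_right_eq_sub]
    have h1 := norm_sphInt_mul_le (D.comp (diffeoC τ)) k
    have h2 := norm_sphInt_mul_le D k'
    have h3 : ∫ z, ‖D.comp (diffeoC τ) z‖ ∂(crVolume n) ≤ M * ∫ z, ‖D z‖ ∂(crVolume n) :=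
      hM (fun z => ‖D z‖) D.continuous.norm fun _ => norm_nonneg _
    have hP' : ∫ z, ‖D z‖ ∂(crVolume n) ≤ ε := hP
    calc _ ≤ ‖sphInt n (D.comp (diffeoC τ) * k)‖ + ‖sphInt n (D * k')‖ := norm_sub_le _ _
      _ ≤ ‖k‖ * (M * ε) + ‖k'‖ * ε := by
          refine add_le_add (h1.trans (mul_le_mul_of_nonneg_left (h3.trans ?_) (norm_nonneg _)))
            (h2.trans (mul_le_mul_of_nonneg_left hP' (norm_nonneg _)))
          exact mul_le_mul_of_nonneg_left hP' hM0
      _ = _ := by ring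
  rw [← sub_eq_zero, ← norm_le_zero_iff]
  refine le_of_forall_pos_le_add fun δ hδ => ?_
  have hpos : 0 < ‖k‖ * M + ‖k'‖ + 1 := by positivity
  refine (hb (δ / (‖k‖ * M + ‖k'‖ + 1)) (by positivity)).trans ?_
  rw [zero_add, mul_div_assoc', div_le_iff₀ hpos]
  nlinarith

theorem sphInt_mul_eq_zero (hn : 1 ≤ n) {k : C(Sph n, ℂ)} (h : ∀ P, sphInt n (holC n P * k) = 0)
    {F : C(Sph n, ℂ)} (hF : F ∈ crAlg n) : sphInt n (F * k) = 0 := by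
  have := sphInt_comp_mul_eq hn (Diffeomorph.refl _ _ _) (k := k) (k' := 0)
    (fun P => by rw [mul_zero, map_zero]; exact h P) hF
  rw [mul_zero, map_zero] at this
  exact this

/-! ### Mean values of CR functions -/

/-- The coordinate functions on the sphere. -/
abbrev zC (l : Fin (n + 1)) : C(Sph n, ℂ) := coordC (Diffeomorph.refl _ _ _) l

theorem meanL_rename_X_mul (l : Fin (n + 1)) (P : MvPolynomial (Fin (n + 1)) ℂ) :
    meanL n (zv l * rename Sum.inl P) = 0 := by
  induction P using MvPolynomial.induction_on' with
  | monomial u a =>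
    have hE : eulerZ n (rename Sum.inl (monomial u a)) = ((u.degree : ℕ) : ℂ) •
        (rename Sum.inl (monomial u a) : CPoly n) := by
      have h := (isHomogeneous_monomial a (rfl : u.degree = u.degree)).sum_X_mul_pderiv
      rw [eulerZ_apply, Nat.cast_smul_eq_nsmul, ← map_nsmul, ← h, map_sum]
      refine Finset.sum_congr rfl fun i _ => ?_
      rw [map_mul, rename_X, pderiv_rename Sum.inl_injective]
    have hd : dw l (rename Sum.inl (monomial u a) : CPoly n) = 0 := by
      refine pderiv_eq_zero_of_notMem_vars fun h => ?_
      have := vars_rename _ _ h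
      simp at this
    have h := isSphereMean_meanL.zv_mul hE l
    rw [hd, map_zero] at h
    refine (mul_eq_zero.1 h).resolve_left ?_
    exact_mod_cast (by omega : n + 1 + u.degree ≠ 0)
  | add P Q hP hQ => rw [map_add, mul_add, map_add, hP, hQ, add_zero]

theorem sphInt_holC (P : MvPolynomial (Fin (n + 1)) ℂ) :
    sphInt n (holC n P) = mass n * constantCoeff P := by
  induction P using MvPolynomial.induction_on with
  | C a =>
    rw [← MvPolynomial.algebraMap_eq, AlgHom.commutes, MvPolynomial.algebraMap_eq, constantCoeff_C,
      ← integral_const_crVolume]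
    rfl
  | add P Q hP hQ => rw [map_add, map_add, map_add, hP, hQ, mul_add]
  | mul_X P l hP =>
    rw [map_mul (constantCoeff), constantCoeff_X, mul_zero, mul_zero, ← meanL_rename_X_mul l P,
      meanL_apply, sphInt_apply]
    congr 1; funext z
    rw [holC_apply, map_mul, rename_X, mul_comm]

theorem sphInt_holC_mul_star (P : MvPolynomial (Fin (n + 1)) ℂ) (l : Fin (n + 1)) :
    (n + 1) * sphInt n (holC n P * star (zC l)) = mass n * constantCoeff (pderiv l P) := by
  have hE : eulerW n (rename Sum.inl P) = (0 : ℂ) • (rename Sum.inl P : CPoly n) := by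
    rw [eulerW_apply, zero_smul]
    refine Finset.sum_eq_zero fun i _ => ?_
    rw [pderiv_eq_zero_of_notMem_vars, mul_zero]
    intro h
    have := vars_rename _ _ h
    simp at this
  have h := isSphereMean_meanL.wv_mul hE l
  rw [pderiv_rename Sum.inl_injective, add_zero] at h
  rw [← sphInt_holC]
  convert h using 2
  · rw [meanL_apply, sphInt_apply]
    congr 1; funext z
    rw [evalAt_mul, evalAt_wv, ContinuousMap.mul_apply, holC_apply, mul_comm]
    rfl
  · rw [meanL_apply, sphInt_apply]
    congr 1; funext z
    rw [holC_apply]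

theorem mass_ne_zero : (mass n : ℂ) ≠ 0 := by exact_mod_cast (mass_pos (n := n)).ne'

theorem natCast_succ_ne_zero : ((n : ℂ) + 1) ≠ 0 := Nat.cast_add_one_ne_zero n

theorem sphInt_mul_holC (hn : 1 ≤ n) {F : C(Sph n, ℂ)} (hF : F ∈ crAlg n)
    (Q : MvPolynomial (Fin (n + 1)) ℂ) :
    sphInt n (F * holC n Q) = constantCoeff Q * sphInt n F := by
  have h := sphInt_mul_eq_zero hn (k := holC n Q - constantCoeff Q • 1) (fun P => by
    rw [mul_sub, mul_smul_comm, mul_one, ← map_mul, map_sub, map_smul, sphInt_holC, sphInt_holC,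
      map_mul, smul_eq_mul]
    ring) hF
  rw [mul_sub, mul_smul_comm, mul_one, map_sub, map_smul, smul_eq_mul] at h
  exact sub_eq_zero.1 h

/-- The mean value is multiplicative on CR functions. -/
theorem sphInt_mul (hn : 1 ≤ n) {F G : C(Sph n, ℂ)} (hF : F ∈ crAlg n) (hG : G ∈ crAlg n) :
    mass n * sphInt n (F * G) = sphInt n F * sphInt n G := by
  have h := sphInt_mul_eq_zero hn (k := (mass n : ℂ) • F - sphInt n F • 1) (fun P => by
    rw [mul_sub, mul_smul_comm, mul_smul_comm, mul_one, map_sub, map_smul, map_smul, sphInt_holC,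
      mul_comm (holC n P), sphInt_mul_holC hn hF, smul_eq_mul, smul_eq_mul]
    ring) hG
  rw [mul_sub, mul_smul_comm, mul_smul_comm, mul_one, map_sub, map_smul, map_smul, smul_eq_mul,
    smul_eq_mul, mul_comm G] at h
  exact sub_eq_zero.1 h

theorem sphInt_mul_holC_mul_star (hn : 1 ≤ n) {F : C(Sph n, ℂ)} (hF : F ∈ crAlg n)
    (Q : MvPolynomial (Fin (n + 1)) ℂ) (l : Fin (n + 1)) :
    (n + 1) * sphInt n (F * (holC n Q * star (zC l)))
      = (n + 1) * constantCoeff Q * sphInt n (F * star (zC l))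
        + constantCoeff (pderiv l Q) * sphInt n F := by
  have h := sphInt_mul_eq_zero hn (k := ((n : ℂ) + 1) • (holC n Q * star (zC l))
    - ((n + 1) * constantCoeff Q) • star (zC l) - constantCoeff (pderiv l Q) • 1) (fun P => by
    rw [mul_sub, mul_sub, mul_smul_comm, mul_smul_comm, mul_smul_comm, mul_one, ← mul_assoc,
      ← map_mul, map_sub, map_sub, map_smul, map_smul, map_smul, sphInt_holC, smul_eq_mul,
      smul_eq_mul, smul_eq_mul, sphInt_holC_mul_star, mul_right_comm, sphInt_holC_mul_star,
      pderiv_mul, map_add, map_mul, map_mul]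
    ring) hF
  rw [mul_sub, mul_sub, mul_smul_comm, mul_smul_comm, mul_smul_comm, mul_one, map_sub, map_sub,
    map_smul, map_smul, map_smul, smul_eq_mul, smul_eq_mul, smul_eq_mul, sub_sub] at h
  exact sub_eq_zero.1 h

/-- The pairing with `z̄_l` is a derivation, at the mean value, of the algebra of CR functions; for
holomorphic functions it is the derivative at the centre of the ball. -/
theorem sphInt_mul_mul_star (hn : 1 ≤ n) {F G : C(Sph n, ℂ)} (hF : F ∈ crAlg n)
    (hG : G ∈ crAlg n) (l : Fin (n + 1)) :
    mass n * sphInt n (F * G * star (zC l))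
      = sphInt n G * sphInt n (F * star (zC l)) + sphInt n F * sphInt n (G * star (zC l)) := by
  have h := sphInt_mul_eq_zero hn (k := (mass n : ℂ) • (F * star (zC l))
    - sphInt n (F * star (zC l)) • 1 - sphInt n F • star (zC l)) (fun P => by
    rw [mul_sub, mul_sub, mul_smul_comm, mul_smul_comm, mul_smul_comm, mul_one, mul_left_comm,
      map_sub, map_sub, map_smul, map_smul, map_smul, sphInt_holC, smul_eq_mul, smul_eq_mul,
      smul_eq_mul]
    refine mul_left_cancel₀ (natCast_succ_ne_zero (n := n)) ?_
    have h1 := sphInt_mul_holC_mul_star hn hF P l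
    have h2 := sphInt_holC_mul_star P l
    linear_combination mass n * h1 - sphInt n F * h2) hG
  rw [mul_sub, mul_sub, mul_smul_comm, mul_smul_comm, mul_smul_comm, mul_one, map_sub, map_sub,
    map_smul, map_smul, map_smul, smul_eq_mul, smul_eq_mul, smul_eq_mul, sub_sub,
    mul_left_comm, ← mul_assoc F] at h
  linear_combination h

/-! ### CR automorphisms that fix the mean value -/

theorem comp_holC_X (τ : SphDiffeo n) (m : Fin (n + 1)) :
    (holC n (X m)).comp (diffeoC τ) = coordC τ m := by
  rw [holC_X]; rfl

theorem comp_mul (τ : SphDiffeo n) (F G : C(Sph n, ℂ)) :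
    (F * G).comp (diffeoC τ) = F.comp (diffeoC τ) * G.comp (diffeoC τ) := rfl

theorem comp_add (τ : SphDiffeo n) (F G : C(Sph n, ℂ)) :
    (F + G).comp (diffeoC τ) = F.comp (diffeoC τ) + G.comp (diffeoC τ) := rfl

theorem IsCRAut.sphInt_comp_holC (hn : 1 ≤ n) {τ : SphDiffeo n} (hτ : IsCRAut τ)
    (h0 : ∀ m, sphInt n (coordC τ m) = 0) (P : MvPolynomial (Fin (n + 1)) ℂ) :
    sphInt n ((holC n P).comp (diffeoC τ)) = mass n * constantCoeff P := by
  induction P using MvPolynomial.induction_on with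
  | C a =>
    rw [← sphInt_holC, ← MvPolynomial.algebraMap_eq, AlgHom.commutes]
    rfl
  | add P Q hP hQ => rw [map_add, comp_add, map_add, map_add, hP, hQ, mul_add]
  | mul_X P m hP =>
    rw [map_mul (holC n), comp_mul, comp_holC_X, map_mul constantCoeff, constantCoeff_X, mul_zero, mul_zero]
    have h := sphInt_mul hn (hτ.comp_mem (holC_mem P)) (hτ.coordC_mem m)
    rw [h0, mul_zero] at h
    exact (mul_eq_zero.1 h).resolve_left mass_ne_zero

theorem IsCRAut.sphInt_comp_holC_mul_star (hn : 1 ≤ n) {τ : SphDiffeo n} (hτ : IsCRAut τ)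
    (h0 : ∀ m, sphInt n (coordC τ m) = 0) (l : Fin (n + 1)) (P : MvPolynomial (Fin (n + 1)) ℂ) :
    sphInt n ((holC n P).comp (diffeoC τ) * star (zC l))
      = ∑ m, constantCoeff (pderiv m P) * sphInt n (coordC τ m * star (zC l)) := by
  induction P using MvPolynomial.induction_on with
  | C a =>
    have h1 : (holC n (C a)).comp (diffeoC τ) = holC n (C a) := by
      rw [← MvPolynomial.algebraMap_eq, AlgHom.commutes]; rfl
    have h2 := sphInt_holC_mul_star (n := n) (C a) l
    rw [pderiv_C, map_zero, mul_zero] at h2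
    simp only [pderiv_C, map_zero, zero_mul, Finset.sum_const_zero, h1]
    exact (mul_eq_zero.1 h2).resolve_left natCast_succ_ne_zero
  | add P Q hP hQ =>
    simp only [map_add, comp_add, add_mul, hP, hQ, Finset.sum_add_distrib]
  | mul_X P m hP =>
    have h := sphInt_mul_mul_star hn (hτ.comp_mem (holC_mem P)) (hτ.coordC_mem m) l
    rw [h0, zero_mul, zero_add, hτ.sphInt_comp_holC hn h0, mul_assoc] at h
    rw [mul_assoc (mass n : ℂ)] at h
    rw [map_mul (holC n), comp_mul, comp_holC_X, mul_assoc,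
      mul_left_cancel₀ (mass_ne_zero (n := n)) h]
    simp only [pderiv_mul, map_add, map_mul, constantCoeff_X, mul_zero, zero_add, pderiv_X]
    rw [Finset.sum_eq_single m]
    · simp
    · intro i _ hi
      rw [Pi.single_eq_of_ne' hi]
      simp
    · simp

/-- The derivative at the centre of the ball of the holomorphic extension of a diffeomorphism. -/
def centerDeriv (τ : SphDiffeo n) (m l : Fin (n + 1)) : ℂ :=
  (n + 1) / mass n * sphInt n (coordC τ m * star (zC l))

theorem sphInt_zC_mul_star (m l : Fin (n + 1)) :
    sphInt n (zC m * star (zC l)) = if m = l then (mass n : ℂ) / (n + 1) else 0 := by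
  have h := sphInt_holC_mul_star (X m) l
  rw [holC_X, pderiv_X, mul_comm, ← eq_div_iff natCast_succ_ne_zero] at h
  rw [h]
  split_ifs with hml
  · subst hml; simp
  · rw [Pi.single_apply, if_neg hml]; simp

theorem sphInt_coordC_mul_star (τ : SphDiffeo n) (m l : Fin (n + 1)) :
    sphInt n (coordC τ m * star (zC l)) = mass n / (n + 1) * centerDeriv τ m l := by
  have := mass_ne_zero (n := n)
  have := natCast_succ_ne_zero (n := n)
  rw [centerDeriv]
  field_simp

theorem IsCRAut.sum_centerDeriv_mul (hn : 1 ≤ n) {τ : SphDiffeo n} (hτ : IsCRAut τ)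
    (hσ : IsCRAut τ.symm) (h0 : ∀ m, sphInt n (coordC τ m) = 0) (k l : Fin (n + 1)) :
    ∑ m, centerDeriv τ.symm k m * centerDeriv τ m l = if k = l then 1 else 0 := by
  have hV := mass_ne_zero (n := n)
  have hN := natCast_succ_ne_zero (n := n)
  have h := sphInt_comp_mul_eq hn τ (k := star (zC l))
    (k' := ∑ m, centerDeriv τ m l • star (zC m)) (fun P => by
      rw [hτ.sphInt_comp_holC_mul_star hn h0, Finset.mul_sum, map_sum]
      refine Finset.sum_congr rfl fun m _ => ?_
      have h1 := sphInt_holC_mul_star P m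
      rw [mul_comm, ← eq_div_iff hN] at h1
      rw [mul_smul_comm, map_smul, h1, sphInt_coordC_mul_star, smul_eq_mul]
      ring) (hσ.coordC_mem k)
  have h2 : (coordC τ.symm k).comp (diffeoC τ) = zC k := by
    ext z
    change ((τ.symm (τ z) : Sph n) : Cn n) k = _
    rw [Diffeomorph.symm_apply_apply]
    rfl
  rw [h2, sphInt_zC_mul_star, Finset.mul_sum, map_sum] at h
  simp only [mul_smul_comm, map_smul, sphInt_coordC_mul_star, smul_eq_mul] at h
  have h3 : ∑ m, centerDeriv τ m l * (mass n / (n + 1) * centerDeriv τ.symm k m)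
      = mass n / (n + 1) * ∑ m, centerDeriv τ.symm k m * centerDeriv τ m l := by
    rw [Finset.mul_sum]; exact Finset.sum_congr rfl fun m _ => by ring
  rw [h3] at h
  have hκ : (mass n : ℂ) / (n + 1) ≠ 0 := div_ne_zero hV hN
  refine mul_left_cancel₀ hκ ?_
  rw [← h]
  split_ifs <;> simp

/-- The difference between a component of a diffeomorphism and that of its derivative at the
centre. -/
def linRem (τ : SphDiffeo n) (m : Fin (n + 1)) : C(Sph n, ℂ) :=
  coordC τ m - ∑ l, centerDeriv τ m l • zC l

theorem sphInt_star (F : C(Sph n, ℂ)) : sphInt n (star F) = conj (sphInt n F) :=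
  integral_conj

/-- The remainder is orthogonal to the coordinate functions, hence Pythagoras' identity. -/
theorem sphInt_linRem (τ : SphDiffeo n) (m : Fin (n + 1)) :
    sphInt n (linRem τ m * star (linRem τ m)) = sphInt n (coordC τ m * star (coordC τ m))
      - mass n / (n + 1) * ∑ l, centerDeriv τ m l * conj (centerDeriv τ m l) := by
  have h1 : ∀ l, sphInt n (linRem τ m * star (zC l)) = 0 := by
    intro l
    rw [linRem, sub_mul, Finset.sum_mul, map_sub, map_sum, sphInt_coordC_mul_star]
    simp only [smul_mul_assoc, map_smul, sphInt_zC_mul_star, smul_eq_mul, mul_ite, mul_zero,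
      Finset.sum_ite_eq', Finset.mem_univ, if_true]
    ring
  have h2 : sphInt n (linRem τ m * star (linRem τ m)) = sphInt n (linRem τ m * star (coordC τ m)) := by
    conv_lhs => rw [linRem.eq_1 τ m, star_sub, star_sum, mul_sub, Finset.mul_sum, map_sub, map_sum]
    rw [← linRem]
    simp only [star_smul, mul_smul_comm, map_smul, h1, smul_zero, Finset.sum_const_zero, sub_zero]
  have h3 : ∀ l, sphInt n (zC l * star (coordC τ m))
      = mass n / (n + 1) * conj (centerDeriv τ m l) := by
    intro l
    have : zC l * star (coordC τ m) = star (coordC τ m * star (zC l)) := by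
      rw [star_mul, star_star]
    rw [this, sphInt_star, sphInt_coordC_mul_star]
    simp
  rw [h2, linRem, sub_mul, Finset.sum_mul, map_sub, map_sum, Finset.mul_sum]
  simp only [smul_mul_assoc, map_smul, h3, smul_eq_mul]
  congr 1
  exact Finset.sum_congr rfl fun l _ => by ring

theorem sum_integral_linRem (τ : SphDiffeo n) :
    ∑ m, ∫ z, ‖linRem τ m z‖ ^ 2 ∂(crVolume n)
      = mass n - mass n / (n + 1) * ∑ m, ∑ l, ‖centerDeriv τ m l‖ ^ 2 := by
  have hsq : ∀ F : C(Sph n, ℂ),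
      sphInt n (F * star F) = ((∫ z, ‖F z‖ ^ 2 ∂(crVolume n) : ℝ) : ℂ) := by
    intro F
    rw [← integral_complex_ofReal, sphInt_apply]
    congr 1; funext z
    change F z * conj (F z) = _
    rw [Complex.mul_conj, Complex.normSq_eq_norm_sq]
  have hone : ∑ m, coordC τ m * star (coordC τ m) = 1 := by
    ext z
    rw [ContinuousMap.sum_apply]
    exact sum_mul_conj_sphere (τ z)
  have h : ∑ m, sphInt n (linRem τ m * star (linRem τ m)) = mass n
      - mass n / (n + 1) * ∑ m, ∑ l, centerDeriv τ m l * conj (centerDeriv τ m l) := by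
    simp only [sphInt_linRem]
    rw [Finset.sum_sub_distrib, ← map_sum, hone, ← Finset.mul_sum]
    congr 1
    rw [← mul_one (mass n : ℂ), ← integral_const_crVolume]
    rfl
  simp only [hsq, Complex.mul_conj, Complex.normSq_eq_norm_sq] at h
  exact_mod_cast h

/-- Schwarz's lemma for CR automorphisms: the derivative at the centre and that of the inverse map
are inverse matrices and, by Bessel's inequality, they are both small; hence they are unitary, and
nothing is left for the terms of higher order. -/
theorem IsCRAut.exists_unitary (hn : 1 ≤ n) {τ : SphDiffeo n} (hτ : IsCRAut τ)
    (hσ : IsCRAut τ.symm) (h0 : ∀ m, sphInt n (coordC τ m) = 0) :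
    ∃ U : Cn n ≃ₗᵢ[ℂ] Cn n, ∀ z, τ z = unitaryDiffeo U z := by
  have hV := mass_pos (n := n)
  have hN : (0 : ℝ) < n + 1 := by positivity
  set E : SphDiffeo n → ℝ := fun τ => ∑ m, ∑ l, ‖centerDeriv τ m l‖ ^ 2 with hE
  have hle : ∀ τ : SphDiffeo n, E τ ≤ n + 1 := by
    intro τ
    have h := sum_integral_linRem τ
    have h1 : 0 ≤ ∑ m, ∫ z, ‖linRem τ m z‖ ^ 2 ∂(crVolume n) :=
      Finset.sum_nonneg fun m _ => integral_nonneg fun z => by positivity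
    rw [h, sub_nonneg, div_mul_eq_mul_div, div_le_iff₀ hN] at h1
    exact le_of_mul_le_mul_left h1 hV
  have hge : 2 * ((n : ℝ) + 1) ≤ E τ.symm + E τ := by
    have h1 : ∑ k, ∑ m, centerDeriv τ.symm k m * centerDeriv τ m k = ((n : ℂ) + 1) := by
      simp only [hτ.sum_centerDeriv_mul hn hσ h0, if_true, Finset.sum_const, Finset.card_univ,
        Fintype.card_fin]
      simp
    have h2 : ((n : ℝ) + 1) ≤ ∑ k, ∑ m, (‖centerDeriv τ.symm k m‖ ^ 2
        + ‖centerDeriv τ m k‖ ^ 2) / 2 := by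
      have h3 : ((n : ℝ) + 1) = ‖((n : ℂ) + 1)‖ := by
        have := Complex.norm_natCast (n + 1)
        push_cast at this
        exact this.symm
      rw [h3, ← h1]
      refine (norm_sum_le _ _).trans (Finset.sum_le_sum fun k _ =>
        (norm_sum_le _ _).trans (Finset.sum_le_sum fun m _ => ?_))
      rw [norm_mul]
      nlinarith [sq_nonneg (‖centerDeriv τ.symm k m‖ - ‖centerDeriv τ m k‖)]
    have h4 : ∑ k, ∑ m, (‖centerDeriv τ.symm k m‖ ^ 2 + ‖centerDeriv τ m k‖ ^ 2) / 2
        = (E τ.symm + E τ) / 2 := by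
      simp only [← Finset.sum_div, Finset.sum_add_distrib]
      rw [Finset.sum_comm (f := fun k m => ‖centerDeriv τ m k‖ ^ 2)]
    rw [h4] at h2
    linarith
  have hEτ : E τ = n + 1 := le_antisymm (hle τ) (by linarith [hle τ.symm])
  have hrem := sum_integral_linRem τ
  change _ = mass n - mass n / (n + 1) * E τ at hrem
  rw [hEτ, div_mul_cancel₀ _ hN.ne', sub_self, Finset.sum_eq_zero_iff_of_nonneg fun m _ =>
    integral_nonneg fun z => by positivity] at hrem
  have hlin : ∀ z m, (τ z : Cn n) m = ∑ l, centerDeriv τ m l * (z : Cn n) l := by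
    intro z m
    have h := congrFun (eq_zero_of_integral_norm_sq (linRem τ m).continuous
      (hrem m (Finset.mem_univ m))) z
    rw [linRem, ContinuousMap.sub_apply, ContinuousMap.sum_apply] at h
    exact sub_eq_zero.1 h
  let L : Cn n →ₗ[ℂ] Cn n := Matrix.toEuclideanLin (Matrix.of (centerDeriv τ))
  have hL : ∀ z : Sph n, L z = τ z := by
    intro z
    ext m
    rw [hlin]
    rfl
  have hnorm : ∀ x, ‖L x‖ = ‖x‖ := by
    intro x
    rcases eq_or_ne x 0 with rfl | hx
    · simp
    · have h1 : x = (‖x‖ : ℂ) • (radialProj x : Cn n) := by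
        rw [radialProj, dif_pos hx]
        change x = (‖x‖ : ℂ) • (‖x‖⁻¹ : ℝ) • x
        rw [Complex.coe_smul, smul_smul, mul_inv_cancel₀ (norm_ne_zero_iff.2 hx), one_smul]
      conv_lhs => rw [h1]
      rw [map_smul, hL, norm_smul, mem_sphere_zero_iff_norm.1 (τ (radialProj x)).2]
      simp
  exact ⟨LinearIsometry.toLinearIsometryEquiv ⟨L, hnorm⟩ rfl,
    fun z => Subtype.ext ((hL z).symm)⟩

/-! ### The classification of CR automorphisms -/

theorem IsCRAut.trans {τ σ : SphDiffeo n} (hτ : IsCRAut τ) (hσ : IsCRAut σ) :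
    IsCRAut (τ.trans σ) := by
  intro z u v h
  rw [dMap_trans, dMap_trans]
  refine hσ _ _ _ ?_
  rw [dIncl_pushTan, dIncl_pushTan, hτ z u v h]

/-- The factor `(J_σ ∘ τ) J_τ`. -/
def transFactor (τ : SphDiffeo n) (J K : Smooth n) : Smooth n :=
  ⟨fun z => K (τ z) * J z,
    (contDiff_fst.mul contDiff_snd : ContDiff ℝ ∞ (fun p : ℂ × ℂ => p.1 * p.2)).contMDiff.comp
      ((ContMDiff.comp K.2 τ.contMDiff).prodMk_space J.2)⟩

theorem transFactor_apply (τ : SphDiffeo n) (J K : Smooth n) (z : Sph n) :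
    transFactor τ J K z = K (τ z) * J z := rfl

theorem IsConformalFactor.trans {τ σ : SphDiffeo n} {J K : Smooth n} (hJ : IsConformalFactor τ J)
    (hK : IsConformalFactor σ K) : IsConformalFactor (τ.trans σ) (transFactor τ J K) where
  ne_zero z := mul_ne_zero (hK.ne_zero _) (hJ.ne_zero _)
  pullback_holVolume z v := by
    simp only [dMap_trans]
    rw [hK.pullback_holVolume]
    simp only [dIncl_pushTan]
    rw [hJ.pullback_holVolume, transFactor_apply]
    ring
  pullback_contactForm z v := by
    rw [dMap_trans]
    change contactForm (σ (τ z) : Cn n) _ = _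
    rw [hK.pullback_contactForm, dIncl_pushTan, hJ.pullback_contactForm, transFactor_apply, norm_mul]
    push_cast
    ring

theorem exists_unitary_map_eq (p : Cn n) :
    ∃ U : Cn n ≃ₗᵢ[ℂ] Cn n, U p = (‖p‖ : ℂ) • EuclideanSpace.single 0 1 := by
  rcases eq_or_ne p 0 with rfl | hp
  · exact ⟨LinearIsometryEquiv.refl ℂ _, by simp⟩
  · have hp' : (‖p‖ : ℂ) ≠ 0 := by exact_mod_cast norm_ne_zero_iff.2 hp
    have h1 : Orthonormal ℂ (Set.domRestrict ({0} : Set (Fin (n + 1)))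
        fun _ => (‖p‖ : ℂ)⁻¹ • p) := by
      refine ⟨fun _ => ?_, fun i j hij => absurd (Subsingleton.elim i j) hij⟩
      change ‖(‖p‖ : ℂ)⁻¹ • p‖ = 1
      rw [norm_smul, norm_inv, Complex.norm_real, norm_norm,
        inv_mul_cancel₀ (norm_ne_zero_iff.2 hp)]
    obtain ⟨b, hb⟩ := h1.exists_orthonormalBasis_extension_of_card_eq (by simp)
    refine ⟨b.repr, ?_⟩
    have h2 : p = (‖p‖ : ℂ) • b 0 := by
      rw [hb 0 rfl, smul_smul, mul_inv_cancel₀ hp', one_smul]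
    conv_lhs => rw [h2]
    rw [map_smul, b.repr_self]

/-- The mean value of the position vector of the image. -/
def meanPoint (τ : SphDiffeo n) : Cn n :=
  WithLp.toLp 2 fun m => sphInt n (coordC τ m) / mass n

theorem sphInt_coordC_trans_unitary (τ : SphDiffeo n) (U : Cn n ≃ₗᵢ[ℂ] Cn n) (m : Fin (n + 1)) :
    sphInt n (coordC (τ.trans (unitaryDiffeo U)) m) = mass n * U (meanPoint τ) m := by
  have h : coordC (τ.trans (unitaryDiffeo U)) m = ∑ j, unitaryMatrix U m j • coordC τ j := by
    ext z
    rw [ContinuousMap.sum_apply]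
    change U (τ z : Cn n) m = _
    rw [unitary_apply]
    rfl
  rw [h, map_sum, unitary_apply, Finset.mul_sum]
  refine Finset.sum_congr rfl fun j _ => ?_
  rw [map_smul, smul_eq_mul]
  have := mass_ne_zero (n := n)
  change _ = (mass n : ℂ) * (_ * (sphInt n (coordC τ j) / mass n))
  field_simp

theorem lt_one_of_sphInt_coordC {τ : SphDiffeo n} {r : ℝ}
    (h : sphInt n (coordC τ 0) = mass n * r) : r < 1 := by
  by_contra! hr
  have hV := mass_pos (n := n)
  have hre : ∫ z, (coordC τ 0 z).re ∂(crVolume n) = mass n * r := by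
    have h1 := integral_re (integrable_of_continuous (coordC τ 0).continuous)
    have h2 : ∫ z, coordC τ 0 z ∂(crVolume n) = mass n * r := h
    rw [h2, ← Complex.ofReal_mul] at h1
    exact h1
  have hc : Continuous fun z => (coordC τ 0 z).re :=
    Complex.continuous_re.comp (coordC τ 0).continuous
  have hc2 : Continuous fun z => 2 * (coordC τ 0 z).re := continuous_const.mul hc
  have hle : ∫ z, ‖coordC τ 0 z - 1‖ ^ 2 ∂(crVolume n) ≤ 2 * mass n - 2 * (mass n * r) := by
    have h1 : ∫ z, (2 - 2 * (coordC τ 0 z).re) ∂(crVolume n) = 2 * mass n - 2 * (mass n * r) := by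
      rw [integral_sub (integrable_of_continuous_real continuous_const)
        (integrable_of_continuous_real hc2), integral_const_mul, hre,
        integral_const, smul_eq_mul, mul_comm 2 (mass n)]
      rfl
    rw [← h1]
    refine integral_mono (integrable_of_continuous_real
      (((coordC τ 0).continuous.sub continuous_const).norm.pow 2))
      (integrable_of_continuous_real (continuous_const.sub hc2)) fun z => ?_
    have h2 : ‖coordC τ 0 z‖ ≤ 1 := norm_coord_le (τ z) 0
    change ‖coordC τ 0 z - 1‖ ^ 2 ≤ _
    rw [← Complex.normSq_eq_norm_sq, Complex.normSq_sub, Complex.normSq_eq_norm_sq, map_one,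
      map_one, mul_one]
    nlinarith [norm_nonneg (coordC τ 0 z)]
  have h0 : ∫ z, ‖coordC τ 0 z - 1‖ ^ 2 ∂(crVolume n) = 0 :=
    le_antisymm (hle.trans (by nlinarith)) (integral_nonneg fun z => by positivity)
  have h1 := eq_zero_of_integral_norm_sq ((coordC τ 0).continuous.sub continuous_const) h0
  have h2 : ∀ y : Sph n, (y : Cn n) 0 = 1 := by
    intro y
    obtain ⟨z, hz⟩ : ∃ z, τ z = y := τ.surjective y
    have := sub_eq_zero.1 (congrFun h1 z)
    rw [← hz]
    exact this
  have h3 : Sph n := Classical.arbitrary _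
  have h4 := h2 (-h3)
  have h5 : ((-h3 : Sph n) : Cn n) 0 = -((h3 : Cn n) 0) := rfl
  rw [h5, h2 h3] at h4
  norm_num at h4

/-- A boost moves a mean value on its axis to the centre. -/
theorem IsCRAut.sphInt_coordC_trans_boost (hn : 1 ≤ n) {τ : SphDiffeo n} (hτ : IsCRAut τ) {r : ℝ}
    (hr : |r| < 1) (hr' : |-r| < 1) (h0 : sphInt n (coordC τ 0) = mass n * r)
    (h : ∀ m, m ≠ 0 → sphInt n (coordC τ m) = 0) (m : Fin (n + 1)) :
    sphInt n (coordC (τ.trans (boostDiffeo 0 (-r) hr')) m) = 0 := by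
  have hV := mass_ne_zero (n := n)
  set τ' := τ.trans (boostDiffeo 0 (-r) hr') with hτ'
  have hcr : IsCRAut τ' := hτ.trans (isCRAut_boostDiffeo 0 hr')
  have hz : ∀ z, (1 : ℂ) + ((-r : ℝ) : ℂ) * (τ z : Cn n) 0 ≠ 0 := fun z =>
    ne_zero_of_re_pos (one_add_mul_re_pos (norm_ofReal_lt_one hr') (norm_coord_le (τ z) 0))
  have e0 : sphInt n (1 : C(Sph n, ℂ)) = mass n := by
    rw [← mul_one (mass n : ℂ), ← integral_const_crVolume]
    rfl
  have hmul : sphInt n (coordC τ' m * (1 + ((-r : ℝ) : ℂ) • coordC τ 0)) = 0 := by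
    rcases eq_or_ne m 0 with rfl | hm
    · have : coordC τ' 0 * (1 + ((-r : ℝ) : ℂ) • coordC τ 0) = coordC τ 0 + ((-r : ℝ) : ℂ) • 1 := by
        ext z
        change boostVec 0 (-r) (τ z : Cn n) 0 * (1 + ((-r : ℝ) : ℂ) * (τ z : Cn n) 0)
          = (τ z : Cn n) 0 + ((-r : ℝ) : ℂ) * 1
        rw [boostVec_self, div_mul_cancel₀ _ (hz z), mul_one]
      rw [this, map_add, map_smul, h0, e0, smul_eq_mul]
      push_cast
      ring
    · have : coordC τ' m * (1 + ((-r : ℝ) : ℂ) • coordC τ 0)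
          = boostFactor ((-r : ℝ) : ℂ) • coordC τ m := by
        ext z
        change boostVec 0 (-r) (τ z : Cn n) m * (1 + ((-r : ℝ) : ℂ) * (τ z : Cn n) 0)
          = boostFactor ((-r : ℝ) : ℂ) * (τ z : Cn n) m
        rw [boostVec_apply, boostCoord, if_neg hm, div_mul_cancel₀ _ (hz z)]
      rw [this, map_smul, h m hm, smul_zero]
  have h1 := sphInt_mul hn (hcr.coordC_mem m) ((crAlg n).add_mem (crAlg n).one_mem
    ((crAlg n).smul_mem (hτ.coordC_mem 0) ((-r : ℝ) : ℂ)))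
  rw [hmul, mul_zero, map_add, map_smul, e0, h0, smul_eq_mul] at h1
  refine (mul_eq_zero.1 h1.symm).resolve_right ?_
  have h2 : (mass n : ℂ) + ((-r : ℝ) : ℂ) * (mass n * r) = mass n * ((1 - r ^ 2 : ℝ) : ℂ) := by
    push_cast; ring
  rw [h2]
  exact mul_ne_zero hV (Complex.ofReal_ne_zero.2 (one_sub_sq_pos hr).ne')

/-- Every CR automorphism is the composition of a unitary map, a boost, and a unitary map. -/
theorem IsCRAut.exists_decomposition (hn : 1 ≤ n) {τ : SphDiffeo n} (hτ : IsCRAut τ)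
    {J : Smooth n} (hJ : IsConformalFactor τ J) :
    ∃ (U V : Cn n ≃ₗᵢ[ℂ] Cn n) (s : ℝ) (hs : |s| < 1),
      τ = ((unitaryDiffeo U).trans (boostDiffeo 0 s hs)).trans (unitaryDiffeo V) := by
  obtain ⟨V, hV⟩ := exists_unitary_map_eq (meanPoint τ)
  obtain ⟨κ, -, hκ⟩ := exists_isConformalFactor_unitaryDiffeo V
  set r := ‖meanPoint τ‖
  have hτ1 := hτ.trans (isCRAut_unitaryDiffeo V)
  have hJ1 := hJ.trans hκ
  have hm0 : sphInt n (coordC (τ.trans (unitaryDiffeo V)) 0) = mass n * r := by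
    rw [sphInt_coordC_trans_unitary, hV]; simp
  have hm : ∀ m, m ≠ 0 → sphInt n (coordC (τ.trans (unitaryDiffeo V)) m) = 0 := by
    intro m hm
    rw [sphInt_coordC_trans_unitary, hV]; simp [hm]
  have hr : |r| < 1 := by
    rw [abs_of_nonneg (norm_nonneg _)]; exact lt_one_of_sphInt_coordC hm0
  have hr' : |-r| < 1 := by rwa [abs_neg]
  have hτ2 := hτ1.trans (isCRAut_boostDiffeo 0 hr')
  have hJ2 := hJ1.trans (isConformalFactor_boostDiffeo 0 hr')
  obtain ⟨U, hU⟩ := hτ2.exists_unitary hn (hτ2.symm hJ2)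
    (hτ1.sphInt_coordC_trans_boost hn hr hr' hm0 hm)
  refine ⟨U, V.symm, r, hr, Diffeomorph.ext fun z => ?_⟩
  change τ z = unitaryDiffeo V.symm (boostDiffeo 0 r hr (unitaryDiffeo U z))
  rw [← hU]
  change τ z = unitaryDiffeo V.symm (boostSph 0 r hr (boostSph 0 (-r) hr' (unitaryDiffeo V (τ z))))
  have h1 := boostSph_neg 0 hr' (by rwa [neg_neg]) (unitaryDiffeo V (τ z))
  simp only [neg_neg] at h1
  rw [h1]
  apply Subtype.ext
  rw [unitaryDiffeo_coe, unitaryDiffeo_coe, LinearIsometryEquiv.symm_apply_apply]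

/-! ### Conformal factors are unique up to a constant -/

theorem exists_tangent_frame (z : Sph n) :
    ∃ v : Fin (n + 1) → Tan z, holVolume (fun a => dIncl z (v a)) ≠ 0 := by
  -- on each complex coordinate axis there is a tangent vector
  set u : Fin (n + 1) → ℂ := fun a => if (z : Cn n) a = 0 then 1 else Complex.I * (z : Cn n) a
    with hu
  have hu0 : ∀ a, u a ≠ 0 := by
    intro a
    simp only [hu]
    split_ifs with h
    · exact one_ne_zero
    · exact mul_ne_zero Complex.I_ne_zero h
  have h1 : ∀ a, ∃ v : Tan z, dIncl z v = EuclideanSpace.single a (u a) := by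
    intro a
    rw [exists_dIncl_eq_iff, EuclideanSpace.inner_single_right]
    simp only [hu]
    split_ifs with h
    · rw [h]; simp
    · rw [mul_assoc, Complex.mul_conj]; simp
  choose v hv using h1
  refine ⟨v, ?_⟩
  simp only [hv]
  have h2 : (Matrix.of fun a l => (EuclideanSpace.single a (u a) : Cn n) l) = Matrix.diagonal u := by
    ext a l
    rw [Matrix.of_apply, PiLp.single_apply, Matrix.diagonal_apply]
    by_cases h : a = l
    · subst h; simp
    · rw [if_neg h, if_neg (Ne.symm h)]
  rw [holVolume, h2, Matrix.det_diagonal]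
  exact Finset.prod_ne_zero_iff.2 fun a _ => hu0 a

theorem IsConformalFactor.exists_eq_const_mul {τ : SphDiffeo n} {J K : Smooth n}
    (hJ : IsConformalFactor τ J) (hK : IsConformalFactor τ K) :
    ∃ κ : ℂ, ‖κ‖ = 1 ∧ ∀ z, K z = κ * J z := by
  have hpow : ∀ z, (K z / J z) ^ (n + 2) = 1 := by
    intro z
    obtain ⟨v, hv⟩ := exists_tangent_frame z
    have h := (hK.pullback_holVolume z v).symm.trans (hJ.pullback_holVolume z v)
    rw [div_pow, mul_right_cancel₀ hv h, div_self (pow_ne_zero _ (hJ.ne_zero z))]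
  have hpre : PreconnectedSpace (Sph n) := by
    refine Subtype.preconnectedSpace (isPreconnected_sphere ?_ _ _)
    rw [← Module.finrank_eq_rank, (finrank_Cn n).out]
    exact_mod_cast (by omega : 1 < 2 * n + 1 + 1)
  have hfin : ({x : ℂ | x ^ (n + 2) = 1}).Finite := by
    have h0 : (Polynomial.X ^ (n + 2) - Polynomial.C (1 : ℂ)) ≠ 0 :=
      Polynomial.X_pow_sub_C_ne_zero (by omega) _
    refine (Polynomial.X ^ (n + 2) - Polynomial.C (1 : ℂ)).rootSet_finite ℂ |>.subset fun x hx => ?_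
    rw [Polynomial.mem_rootSet_of_ne h0]
    simpa [sub_eq_zero] using hx
  obtain ⟨κ, hκ, h⟩ := (isPreconnected_univ (α := Sph n)).eqOn_const_of_mapsTo hfin.isDiscrete
    (f := fun z => K z / J z) (K.continuous.div J.continuous hJ.ne_zero).continuousOn
    (fun z _ => hpow z) ⟨1, one_pow _⟩
  refine ⟨κ, ?_, fun z => ?_⟩
  · have h1 : κ ^ (n + 2) = 1 := hκ
    exact Complex.norm_eq_one_of_pow_eq_one h1 (by omega)
  · have h1 : K z / J z = κ := h (Set.mem_univ z)
    rw [← h1, div_mul_cancel₀ _ (hJ.ne_zero z)]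

/-! ### Diagonal operators are intertwining -/

theorem mixedPow_mul (x y : ℂ) {a b : ℝ} (h : ∃ m : ℤ, a - b = m) :
    mixedPow (x * y) a b = mixedPow x a b * mixedPow y a b := by
  obtain ⟨m, hm⟩ := h
  simp only [mixedPow, hm, Complex.ofReal_intCast, Complex.cpow_intCast, norm_mul, mul_zpow]
  rw [Real.mul_rpow (norm_nonneg _) (norm_nonneg _)]
  push_cast
  ring

theorem Intertwines.trans {γ w w' : ℝ} (h : ∃ m : ℤ, w - w' = m) {A : Smooth n →ₗ[ℂ] Smooth n}
    {τ σ : SphDiffeo n} {J K : Smooth n} (hK0 : ∀ z, K z ≠ 0)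
    (hJ : Intertwines γ w w' A τ J) (hK : Intertwines γ w w' A σ K) :
    Intertwines γ w w' A (τ.trans σ) (transFactor τ J K) := by
  have h1 : ∃ m : ℤ, -w - -w' = m := by
    obtain ⟨m, hm⟩ := h; exact ⟨-m, by push_cast; linarith⟩
  have h2 : ∃ m : ℤ, γ - w - (γ - w') = m := by
    obtain ⟨m, hm⟩ := h; exact ⟨-m, by push_cast; linarith⟩
  intro F G hG z
  have e1 := hK F (twist σ K hK0 (-w) (-w') h1 F) (fun _ => rfl)
  have e2 := hJ (twist σ K hK0 (-w) (-w') h1 F) G (fun z => by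
    rw [hG, transFactor_apply, mixedPow_mul _ _ h1, mul_comm (mixedPow (K (τ z)) _ _),
      mul_assoc]
    rfl) z
  rw [e2, e1, transFactor_apply, mixedPow_mul _ _ h2, mul_assoc, mul_left_comm]
  rfl

theorem Intertwines.const_mul {γ w w' : ℝ} (h : ∃ m : ℤ, w - w' = m)
    {A : Smooth n →ₗ[ℂ] Smooth n} {τ : SphDiffeo n} {J K : Smooth n}
    (hJ : Intertwines γ w w' A τ J) {κ : ℂ} (hκ : ‖κ‖ = 1) (hK : ∀ z, K z = κ * J z) :
    Intertwines γ w w' A τ K := by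
  have h1 : ∃ m : ℤ, -w - -w' = m := by
    obtain ⟨m, hm⟩ := h; exact ⟨-m, by push_cast; linarith⟩
  have h2 : ∃ m : ℤ, γ - w - (γ - w') = m := by
    obtain ⟨m, hm⟩ := h; exact ⟨-m, by push_cast; linarith⟩
  have e : mixedPow κ (γ - w) (γ - w') = mixedPow κ (-w) (-w') := by
    rw [mixedPow_of_norm_eq_one hκ, mixedPow_of_norm_eq_one hκ]; congr 2; ring
  intro F G hG z
  have h3 := hJ (mixedPow κ (-w) (-w') • F) G (fun z => by
    rw [hG, hK, mixedPow_mul _ _ h1, mul_comm (mixedPow κ _ _), mul_assoc]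
    rfl) z
  rw [h3, map_smul, hK, mixedPow_mul _ _ h2, e, mul_comm (mixedPow κ _ _), mul_assoc]
  rfl

/-- The second half of the classification: operators with the eigenvalues in question are
intertwining. -/
theorem isIntertwining_of_eigenvalues (hn : 1 ≤ n) {γ w w' : ℝ} (hsum : w + w' + n + 1 = γ)
    {h : ∃ m : ℤ, w - w' = m} (hreg : ∀ m : ℕ, γ - w ≠ -(m : ℝ))
    (hreg' : ∀ m : ℕ, γ - w' ≠ -(m : ℝ)) {Q : Smooth n →ₗ[ℂ] Smooth n} {c : ℝ}
    (hA : IsFormallySelfAdjoint Q) (hQ : ∀ (j k : ℕ), ∀ Y ∈ sphHarm n j k,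
      Q Y = ((c * lam γ w j * lam γ w' k : ℝ) : ℂ) • Y) : IsIntertwining γ w w' h Q := by
  have hd : IsDiagonal Q fun j k => c * lam γ w j * lam γ w' k := fun j k p hp =>
    hQ j k _ (polySmooth_mem_sphHarm hp)
  have hU : ∀ (U : Cn n ≃ₗᵢ[ℂ] Cn n) (κ : ℂ), ‖κ‖ = 1 →
      Intertwines γ w w' Q (unitaryDiffeo U) (constSmooth (n := n) κ) := fun U κ hκ =>
    (intertwines_unitary_iff hκ).2 (hd.commutesWithUnitary hn hA U)
  refine isIntertwining_of_intertwines fun τ hτ J hJ => ?_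
  obtain ⟨U, V, s, hs, rfl⟩ := hτ.exists_decomposition hn hJ
  have hB := hd.intertwines_boost hn hsum h hA
    (fun j k => by linear_combination c * lam γ w' k * lam_succ hreg j)
    (fun j k => by linear_combination c * lam γ w j * lam_succ hreg' k) 0 hs
  obtain ⟨κ, hκ, hκU⟩ := exists_isConformalFactor_unitaryDiffeo U
  obtain ⟨ν, hν, hνV⟩ := exists_isConformalFactor_unitaryDiffeo V
  have hJB := isConformalFactor_boostDiffeo (n := n) 0 hs
  have hT := (hκU.trans hJB).trans hνV
  obtain ⟨ε, hε, hJε⟩ := hT.exists_eq_const_mul hJ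
  exact (((hU U κ hκ).trans h hJB.ne_zero hB).trans h hνV.ne_zero (hU V ν hν)).const_mul h hε hJε

end CRSphere

end

theorem propositionA1 (n : ℕ) (hn : 1 ≤ n) (γ w w' : ℝ) (hγ : 0 < γ) (hγn : γ < n + 1)
    (hsum : w + w' + n + 1 = γ) (hint : ∃ m : ℤ, w - w' = m)
    -- no pole of the numerators `Γ(j + γ - w)` and `Γ(k + γ - w')` is met
    (hreg : ∀ m : ℕ, γ - w ≠ -(m : ℝ)) (hreg' : ∀ m : ℕ, γ - w' ≠ -(m : ℝ)) :
    (∀ A : CRSphere.Smooth n →ₗ[ℂ] CRSphere.Smooth n,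
      CRSphere.IsFormallySelfAdjoint A → CRSphere.IsIntertwining γ w w' hint A →
        ∃ c : ℝ, ∀ (j k : ℕ), ∀ Y ∈ CRSphere.sphHarm n j k,
          A Y = ((c * CRSphere.lam γ w j * CRSphere.lam γ w' k : ℝ) : ℂ) • Y) ∧
    (∀ (Q : CRSphere.Smooth n →ₗ[ℂ] CRSphere.Smooth n) (c : ℝ),
      CRSphere.IsFormallySelfAdjoint Q →
      (∀ (j k : ℕ), ∀ Y ∈ CRSphere.sphHarm n j k,
          Q Y = ((c * CRSphere.lam γ w j * CRSphere.lam γ w' k : ℝ) : ℂ) • Y) →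
        CRSphere.IsIntertwining γ w w' hint Q) := by
  refine ⟨fun A hA hI => hI.exists_real_eigenvalue hn hγn hsum hreg hreg' hA,
    fun Q c hA hQ => CRSphere.isIntertwining_of_eigenvalues hn hsum hreg hreg' hA hQ⟩
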